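/- **Setting.** Let $U$ be a unitary on a finite-dimensional Hilbert space with orthonormal eigenbasis $U|\phi_j\rangle=e^{i\phi_j}|\phi_j\rangle$, $\phi_j\in[0,2\pi)$, let $|\psi\rangle$ be a unit vector and $a_j=|\langle\phi_j|\psi\rangle|^2$. Let $0<\Delta\le\pi$ with $|\phi_j-\phi_0|>\Delta$ for all $j\ne0$, suppose that the overlap $a_0>0$ and the circuit fidelity $F\in(0,1)$ are known, and let $\phi_{guess}$ satisfy $|\phi_0-\phi_{guess}|<\Delta/3$. Put $\mathcal D=[\phi_{guess}-\Delta/2,\phi_{guess}+\Delta/2]$ and assume $\mathcal D\subset[\Delta/6,2\pi-\Delta/6)$ (i.e. the interval with its buffer $\Delta/6$ does not wrap around the circle). Let $f_\sigma$ be the $2\pi$-periodic Gaussian kernel: $f_\sigma(x)\propto e^{-x^2/2\sigma^2}$ on $(-\pi,\pi]$, $\int_{-\pi}^{\pi}f_\sigma=1$. One circuit run under global depolarizing noise outputs $x\in[0,2\pi)$ with density $p(x)=F\sum_j a_jf_\sigma(x-\phi_j)+\frac{1-F}{2\pi}$ and uses $t$ calls to the controlled unitary, where $t=\Theta(\sigma^{-1})$,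 i.e. $\kappa_1\le t\sigma\le\kappa_2$ for fixed $0<\kappa_1\le\kappa_2$. Runs with $x\notin\mathcal D$ are discarded, so the retained samples are independent with density $P=p/\int_{\mathcal D}p$ on $\mathcal D$, and $M$ retained samples cost $T=Mt/\int_{\mathcal D}p$ calls on average. The fMPE (filtered moment projection phase estimator) is a measurable choice of $$\tilde\phi_M\in\operatorname*{argmax}_{\phi\in\mathcal D}\ \frac1M\sum_{j=1}^M\log Q(x_j|\phi),\qquad Q(x|\phi)=\frac{Fa_0f_\sigma(x-\phi)+(1-F)\frac1{2\pi}}{Fa_0\int_{\mathcal D}f_\sigma(y-\phi)\,dy+(1-F)\frac{\Delta}{2\pi}} .$$ **Theorem 4.** There are constants $c,C_T>0$ depending only on $\kappa_1,\kappa_2$, for every $F$ a constant $C_M>0$ depending only on $\kappa_1,\kappa_2,F$, and for all $\Delta,a_0$ a threshold $\varepsilon_0>0$ depending only on $\kappa_1,\kappa_2,F,\Delta,a_0$, such that the following holds for every instance as above with every $t$, $\sigma$ and fMPE. There is $N_0$ such that, for every $0<\varepsilon\le\Delta/3$ with $$t\ \ge\ c\,\Delta^{-1}\log^{1/2}\!\bigl(\Delta\,\varepsilon^{-1}a_0^{-2}F^{-1}\bigr),$$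 the limits $b=\lim_M(\mathbb E[\tilde\phi_M]-\phi_0)$ (asymptotic bias) and $v=\lim_M M\,\mathrm{Var}[\tilde\phi_M]$ (asymptotic variance) exist, and there is a number of samples $M_\varepsilon\ge1$ for which: 1. $M_\varepsilon=O(a_0^{-1}t^{-2}\varepsilon^{-2})$ as $\varepsilon\to0$: if $\varepsilon\le\varepsilon_0$, then $M_\varepsilon\le\max\bigl(1,\ C_M\,a_0^{-1}t^{-2}\varepsilon^{-2}\bigr)$; 2. $T=O(\varepsilon^{-2}t^{-1}F^{-2}a_0^{-2})$: the mean number of calls for $M_\varepsilon$ samples is at most $\max\bigl(T_1,\ C_T\,\varepsilon^{-2}t^{-1}F^{-2}a_0^{-2}\bigr)$, where $T_1=t/\int_{\mathcal D}p$ is the mean cost of a single sample; 3. for every $M\ge M_\varepsilon$ the large-$M$ RMS error satisfies $\sqrt{b^2+v/M}\le\varepsilon$; and if also $M\ge N_0$ (where $N_0$ does not depend on $\varepsilon$), then the actual RMS error satisfies $\sqrt{\mathbb E[(\tilde\phi_M-\phi_0)^2]}\le\varepsilon$. -/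

import Mathlib

open Filter Topology MeasureTheory
open scoped Real

universe u v

noncomputable section

namespace QPE

/-- The input of quantum phase estimation: a unitary `U` on a finite-dimensional Hilbert space `H`
with an orthonormal eigenbasis `U |φ_j⟩ = e^{iφ_j} |φ_j⟩`, `φ_j ∈ [0, 2π)`, and a normalized
initial state `ψ`. -/
structure Input (ι : Type u) (H : Type v) [Fintype ι] [NormedAddCommGroup H]
    [InnerProductSpace ℂ H] where
  /-- the unitary -/
  U : H ≃ₗᵢ[ℂ] H
  /-- the eigenbasis -/
  eigvec : OrthonormalBasis ι ℂ H
  /-- the eigenphases -/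
  phase : ι → ℝ
  phase_mem : ∀ j, phase j ∈ Set.Ico 0 (2 * π)
  eigen : ∀ j, U (eigvec j) = Complex.exp (Complex.I * (phase j : ℂ)) • eigvec j
  /-- the initial state -/
  ψ : H
  norm_ψ : ‖ψ‖ = 1

/-- The weight `a_j = |⟨φ_j|ψ⟩|²` of the phase `φ_j` in the spectral distribution. -/
def Input.weight {ι : Type u} {H : Type v} [Fintype ι] [NormedAddCommGroup H]
    [InnerProductSpace ℂ H] (S : Input ι H) (j : ι) : ℝ :=
  ‖inner ℂ (S.eigvec j) S.ψ‖ ^ 2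

/-- The Gaussian kernel function of width `σ` on the circle `ℝ / 2πℤ`, as a `2π`-periodic function:
on `(-π, π]` it is proportional to `exp (-x² / (2σ²))`, and its integral over a period is `1`. -/
def gaussianKernel (σ x : ℝ) : ℝ :=
  Real.exp (-(toIocMod Real.two_pi_pos (-π) x) ^ 2 / (2 * σ ^ 2)) /
    ∫ y in (-π)..π, Real.exp (-y ^ 2 / (2 * σ ^ 2))

/-- The density on `[0, 2π)` of the outcome of one run of the circuit under global depolarizing
noise with circuit fidelity `F`: `p(x) = F ∑_j a_j f_σ(x - φ_j) + (1 - F) / (2π)`. -/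
def Input.noisyDensity {ι : Type u} {H : Type v} [Fintype ι] [NormedAddCommGroup H]
    [InnerProductSpace ℂ H] (S : Input ι H) (F σ x : ℝ) : ℝ :=
  F * ∑ j, S.weight j * gaussianKernel σ (x - S.phase j) + (1 - F) * (1 / (2 * π))

/-- The filtering interval of length `Δ` centred at the initial guess. -/
def filterInterval (guess Δ : ℝ) : Set ℝ :=
  Set.Icc (guess - Δ / 2) (guess + Δ / 2)

/-- The probability `∫_D p` that the outcome of a run lies in `D`. -/
def Input.acceptProb {ι : Type u} {H : Type v} [Fintype ι] [NormedAddCommGroup H]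
    [InnerProductSpace ℂ H] (S : Input ι H) (F σ : ℝ) (D : Set ℝ) : ℝ :=
  ∫ x in D, S.noisyDensity F σ x

/-- The filtered distribution: it lives on `D` and has density `p(x) / ∫_D p` there. -/
def Input.filtered {ι : Type u} {H : Type v} [Fintype ι] [NormedAddCommGroup H]
    [InnerProductSpace ℂ H] (S : Input ι H) (F σ : ℝ) (D : Set ℝ) : Measure ℝ :=
  (volume.restrict D).withDensity
    fun x => ENNReal.ofReal (S.noisyDensity F σ x / S.acceptProb F σ D)

/-- The joint law of `M` independent samples from the filtered distribution. -/
def Input.samples {ι : Type u} {H : Type v} [Fintype ι] [NormedAddCommGroup H]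
    [InnerProductSpace ℂ H] (S : Input ι H) (F σ : ℝ) (D : Set ℝ) (M : ℕ) :
    Measure (Fin M → ℝ) :=
  Measure.pi fun _ => S.filtered F σ D

/-- The mean number of calls to the controlled unitary needed for `M` accepted samples, when a run
makes `t` calls: a run is accepted with probability `∫_D p`, so `M / ∫_D p` runs are needed on
average. -/
def Input.calls {ι : Type u} {H : Type v} [Fintype ι] [NormedAddCommGroup H]
    [InnerProductSpace ℂ H] (S : Input ι H) (F σ : ℝ) (D : Set ℝ) (t M : ℕ) : ℝ :=
  M * t / S.acceptProb F σ D

/-- The single-phase model of the filtered distribution, `Q(x|φ)` for `x ∈ D`. -/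
def modelDensity (F a₀ σ : ℝ) (D : Set ℝ) (x φ : ℝ) : ℝ :=
  (F * a₀ * gaussianKernel σ (x - φ) + (1 - F) * (1 / (2 * π))) /
    (F * a₀ * (∫ y in D, gaussianKernel σ (y - φ)) + (1 - F) * (volume.real D / (2 * π)))

/-- The log-likelihood `ℓ(φ | x₁, …, x_M) = M⁻¹ ∑_j log Q(x_j|φ)`. -/
def logLikelihood (F a₀ σ : ℝ) (D : Set ℝ) {M : ℕ} (x : Fin M → ℝ) (φ : ℝ) : ℝ :=
  (1 / (M : ℝ)) * ∑ j, Real.log (modelDensity F a₀ σ D (x j) φ)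

/-- `est` is a filtered moment projection phase estimator (one function for each number `M` of
samples): it is measurable, and on samples from `D` it takes a value in `D` that maximizes the
log-likelihood over `D`. -/
structure IsFMPE (F a₀ σ : ℝ) (D : Set ℝ) (est : (M : ℕ) → (Fin M → ℝ) → ℝ) : Prop where
  measurable : ∀ M, Measurable (est M)
  mem : ∀ M (x : Fin M → ℝ), (∀ j, x j ∈ D) → est M x ∈ D
  isMax : ∀ M (x : Fin M → ℝ), (∀ j, x j ∈ D) →
    ∀ φ ∈ D, logLikelihood F a₀ σ D x φ ≤ logLikelihood F a₀ σ D x (est M x)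

/-- The estimators `est`, applied to samples with joint laws `law`, have asymptotic bias `b` and
asymptotic variance `v` as estimators of `θ`: `E[est_M] - θ → b` and `M · Var[est_M] → v`. -/
def HasAsymptoticBiasVariance (law : (M : ℕ) → Measure (Fin M → ℝ))
    (est : (M : ℕ) → (Fin M → ℝ) → ℝ) (θ b v : ℝ) : Prop :=
  Tendsto (fun M : ℕ => (∫ x, est M x ∂(law M)) - θ) atTop (𝓝 b) ∧
    Tendsto (fun M : ℕ => (M : ℝ) * ProbabilityTheory.variance (est M) (law M)) atTop (𝓝 v)

/-- The root-mean-square error at `M` samples for asymptotic bias `b` and asymptotic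
variance `v`. -/
def asymptoticRMS (b v : ℝ) (M : ℕ) : ℝ :=
  √(b ^ 2 + v / M)

/-- The root-mean-square error of the estimate of `θ` from `M` samples. -/
def rmsError (law : (M : ℕ) → Measure (Fin M → ℝ))
    (est : (M : ℕ) → (Fin M → ℝ) → ℝ) (θ : ℝ) (M : ℕ) : ℝ :=
  √(∫ x, (est M x - θ) ^ 2 ∂(law M))

end QPE

end

/-!
The log-likelihood of the single-phase model is a smooth contrast, so the fMPE is an M-estimator:
it is consistent for the maximizer `θ` of the expected log-likelihood and asymptotically normal
around it. Hence the bias tends to `θ - φ₀`, and `M` times the variance tends to the variance of the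
score divided by the square of the curvature at `θ`.

If only the target phase were present, `θ` would be `φ₀`, the gap of the expected log-likelihood
would be at least quadratic with the signal-to-noise ratio of the model as its rate, and the
variance would be the inverse Fisher information. The separation of the phases puts all others at a
distance of at least `Δ / 6` from the window, so that they contaminate the density by an amount
exponentially small in `(Δ / σ)²`. This moves `θ` by a comparably small amount, which the condition
on `t` keeps below `ε / 2`, and changes the variance by at most a constant factor.
-/

namespace QPE

section EmpiricalMean

open ProbabilityTheory

variable {𝒳 : Type*}

/-- The empirical mean `M⁻¹ ∑ⱼ h(xⱼ)` of `h` over a sample `x`. -/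
noncomputable def empiricalMean {M : ℕ} (h : 𝒳 → ℝ) (x : Fin M → 𝒳) : ℝ :=
  (1 / (M : ℝ)) * ∑ j, h (x j)

lemma empiricalMean_sub {M : ℕ} (h h' : 𝒳 → ℝ) (x : Fin M → 𝒳) :
    empiricalMean h x - empiricalMean h' x = empiricalMean (fun y => h y - h' y) x := by
  rw [empiricalMean, empiricalMean, empiricalMean, Finset.sum_sub_distrib, mul_sub]

lemma natCast_mul_empiricalMean {M : ℕ} (hM : 0 < M) (h : 𝒳 → ℝ) (x : Fin M → 𝒳) :
    M * empiricalMean h x = ∑ j, h (x j) := by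
  rw [empiricalMean]
  field_simp

lemma abs_empiricalMean_le {M : ℕ} {h : 𝒳 → ℝ} {x : Fin M → 𝒳} {C : ℝ} (hC : 0 ≤ C)
    (hx : ∀ j, |h (x j)| ≤ C) : |empiricalMean h x| ≤ C := by
  rcases Nat.eq_zero_or_pos M with rfl | hM
  · simpa [empiricalMean] using hC
  · have hMr : (0 : ℝ) < M := by exact_mod_cast hM
    refine le_of_mul_le_mul_left ?_ hMr
    rw [← Nat.abs_cast, ← abs_mul, natCast_mul_empiricalMean hM, Nat.abs_cast]
    calc |∑ j, h (x j)| ≤ ∑ j, |h (x j)| := Finset.abs_sum_le_sum_abs _ _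
      _ ≤ ∑ _j : Fin M, C := Finset.sum_le_sum fun j _ => hx j
      _ = M * C := by simp

lemma hasDerivAt_empiricalMean {M : ℕ} {m m₁ : 𝒳 → ℝ → ℝ} {x : Fin M → 𝒳} {φ : ℝ}
    (h : ∀ j, HasDerivAt (m (x j)) (m₁ (x j) φ) φ) :
    HasDerivAt (fun ψ => empiricalMean (fun y => m y ψ) x)
      (empiricalMean (fun y => m₁ y φ) x) φ :=
  (HasDerivAt.fun_sum fun j _ => h j).const_mul _

variable [MeasurableSpace 𝒳]

/-- The joint law of `M` independent samples from `P`. -/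
noncomputable abbrev iidLaw (P : Measure 𝒳) (M : ℕ) : Measure (Fin M → 𝒳) :=
  Measure.pi fun _ => P

/-- The samples for which the empirical mean of `h` deviates from `∫ h` by at least `δ`: the
exceptional sets of the law of large numbers. -/
def deviationSet (P : Measure 𝒳) (h : 𝒳 → ℝ) (δ : ℝ) (M : ℕ) : Set (Fin M → 𝒳) :=
  {x | δ ≤ |empiricalMean h x - ∫ y, h y ∂P|}

lemma measurable_empiricalMean {h : 𝒳 → ℝ} (hm : Measurable h) (M : ℕ) :
    Measurable (fun x : Fin M → 𝒳 => empiricalMean h x) := by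
  unfold empiricalMean
  fun_prop

lemma measurableSet_deviationSet (P : Measure 𝒳) {h : 𝒳 → ℝ} (hm : Measurable h) (δ : ℝ) (M : ℕ) :
    MeasurableSet (deviationSet P h δ M) :=
  measurableSet_le measurable_const ((measurable_empiricalMean hm M).sub_const _).norm

variable {P : Measure 𝒳} [IsProbabilityMeasure P]

lemma ae_iidLaw_forall_mem {K : Set 𝒳} (hK : ∀ᵐ x ∂P, x ∈ K) (M : ℕ) :
    ∀ᵐ x ∂(iidLaw P M), ∀ j, x j ∈ K :=
  ae_all_iff.mpr fun j => (measurePreserving_eval _ j).quasiMeasurePreserving.ae hK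

lemma integral_empiricalMean {h : 𝒳 → ℝ} (hi : Integrable h P) {M : ℕ} (hM : 0 < M) :
    ∫ x, empiricalMean h x ∂(iidLaw P M) = ∫ y, h y ∂P := by
  have hi' (j : Fin M) : Integrable (fun x : Fin M → 𝒳 => h (x j)) (iidLaw P M) :=
    (measurePreserving_eval _ j).integrable_comp_of_integrable hi
  unfold empiricalMean
  rw [integral_const_mul, integral_finsetSum _ fun j _ => hi' j]
  simp_rw [integral_comp_eval (μ := fun _ : Fin M => P) hi.aestronglyMeasurable]
  rw [Finset.sum_const, Finset.card_univ, Fintype.card_fin, nsmul_eq_mul]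
  field_simp

lemma natCast_mul_variance_empiricalMean {h : 𝒳 → ℝ} (hL : MemLp h 2 P) {M : ℕ} (hM : 0 < M) :
    M * Var[empiricalMean h; iidLaw P M] = Var[h; P] := by
  have hsum : (∑ i, fun x : Fin M → 𝒳 => h (x i)) = fun x => M * empiricalMean h x := by
    ext x
    rw [Finset.sum_apply, natCast_mul_empiricalMean hM]
  have hvar := variance_sum_pi (μ := fun _ : Fin M => P) (X := fun _ => h) fun _ => hL
  rw [hsum, variance_const_mul, Finset.sum_const, Finset.card_univ, Fintype.card_fin,
    nsmul_eq_mul, sq, mul_assoc] at hvar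
  exact mul_left_cancel₀ (by positivity) hvar

lemma measureReal_le_sum_sub_integral_le_exp {h : 𝒳 → ℝ} (hm : Measurable h) {B : ℝ} (hB0 : 0 < B)
    (hB : ∀ᵐ x ∂P, |h x| ≤ B) {δ : ℝ} (hδ : 0 ≤ δ) (M : ℕ) :
    (iidLaw P M).real {x | M * δ ≤ ∑ j, (h (x j) - ∫ y, h y ∂P)} ≤
      Real.exp (-(δ ^ 2 / (2 * B ^ 2)) * M) := by
  set c := (‖B - (-B)‖₊ / 2) ^ 2
  have hc : (c : ℝ) = B ^ 2 := by
    rw [NNReal.coe_pow, NNReal.coe_div, coe_nnnorm, Real.norm_of_nonneg (by linarith)]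
    norm_num
  have hsubgaussian : ∀ j ∈ (Finset.univ : Finset (Fin M)), HasSubgaussianMGF
      (fun x : Fin M → 𝒳 => h (x j) - ∫ y, h y ∂P) c (iidLaw P M) := by
    intro j _
    have hmp := measurePreserving_eval (fun _ : Fin M => P) j
    refine HasSubgaussianMGF.of_map (Y := Function.eval j) (X := fun y => h y - ∫ y, h y ∂P)
      hmp.aemeasurable ?_
    rw [hmp.map_eq]
    exact hasSubgaussianMGF_of_mem_Icc hm.aemeasurable (hB.mono fun x hx => abs_le.mp hx)
  have hindep : iIndepFun (fun j (x : Fin M → 𝒳) => h (x j) - ∫ y, h y ∂P) (iidLaw P M) :=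
    iIndepFun_pi (X := fun _ y => h y - ∫ y, h y ∂P) fun _ => (hm.sub_const _).aemeasurable
  refine (HasSubgaussianMGF.measure_sum_ge_le_of_iIndepFun hindep hsubgaussian
    (by positivity)).trans_eq ?_
  rw [Finset.sum_const, Finset.card_univ, Fintype.card_fin, nsmul_eq_mul]
  push_cast
  rw [hc]
  congr 1
  rcases Nat.eq_zero_or_pos M with rfl | hM
  · simp
  · field_simp

lemma measureReal_deviationSet_le {h : 𝒳 → ℝ} (hm : Measurable h) {B : ℝ} (hB0 : 0 < B)
    (hB : ∀ᵐ x ∂P, |h x| ≤ B) {δ : ℝ} (hδ : 0 ≤ δ) {M : ℕ} (hM : 0 < M) :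
    (iidLaw P M).real (deviationSet P h δ M) ≤
      2 * Real.exp (-(δ ^ 2 / (2 * B ^ 2)) * M) := by
  have hsum (x : Fin M → 𝒳) :
      ∑ j, (h (x j) - ∫ y, h y ∂P) = M * (empiricalMean h x - ∫ y, h y ∂P) := by
    rw [mul_sub, natCast_mul_empiricalMean hM, Finset.sum_sub_distrib]
    simp
  have hsubset : deviationSet P h δ M ⊆ {x | M * δ ≤ ∑ j, (h (x j) - ∫ y, h y ∂P)} ∪
      {x | M * δ ≤ ∑ j, (-h (x j) - ∫ y, -h y ∂P)} := by
    intro x hx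
    have hneg : ∑ j, (-h (x j) - ∫ y, -h y ∂P) = M * -(empiricalMean h x - ∫ y, h y ∂P) := by
      rw [integral_neg, mul_neg, ← hsum, ← Finset.sum_neg_distrib]
      exact Finset.sum_congr rfl fun j _ => by ring
    simp only [Set.mem_union, Set.mem_ofPred_eq, hneg, hsum]
    exact (le_abs.mp hx).imp (mul_le_mul_of_nonneg_left · (Nat.cast_nonneg M))
      (mul_le_mul_of_nonneg_left · (Nat.cast_nonneg M))
  calc (iidLaw P M).real (deviationSet P h δ M) ≤ _ :=
        (measureReal_mono hsubset).trans (measureReal_union_le _ _)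
    _ ≤ _ := add_le_add (measureReal_le_sum_sub_integral_le_exp hm hB0 hB hδ M)
        (measureReal_le_sum_sub_integral_le_exp hm.neg hB0
          (by simpa only [Pi.neg_apply, abs_neg]) hδ M)
    _ = _ := (two_mul _).symm

lemma tendsto_natCast_mul_measureReal_deviationSet {h : 𝒳 → ℝ} (hm : Measurable h) {B : ℝ}
    (hB : ∀ᵐ x ∂P, |h x| ≤ B) {δ : ℝ} (hδ : 0 < δ) :
    Tendsto (fun M : ℕ => (M : ℝ) * (iidLaw P M).real (deviationSet P h δ M)) atTop (𝓝 0) := by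
  have hB' : ∀ᵐ x ∂P, |h x| ≤ |B| + 1 := hB.mono fun x hx => by linarith [le_abs_self B]
  set k : ℝ := δ ^ 2 / (2 * (|B| + 1) ^ 2)
  have hk : 0 < k := by positivity
  have hexp : Tendsto (fun M : ℕ => 2 / k * ((k * M) ^ 1 * Real.exp (-(k * M)))) atTop (𝓝 0) := by
    simpa only [mul_zero, Function.comp_def] using
      ((Real.tendsto_pow_mul_exp_neg_atTop_nhds_zero 1).comp
      (tendsto_natCast_atTop_atTop.const_mul_atTop hk)).const_mul (2 / k)
  refine squeeze_zero' (Eventually.of_forall fun M => by positivity) ?_ hexp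
  filter_upwards [eventually_gt_atTop 0] with M hM
  calc (M : ℝ) * (iidLaw P M).real (deviationSet P h δ M) ≤ M * (2 * Real.exp (-k * M)) := by
        gcongr
        exact measureReal_deviationSet_le hm (by positivity) hB' hδ.le hM
    _ = 2 / k * ((k * M) ^ 1 * Real.exp (-(k * M))) := by
        rw [neg_mul]
        field_simp

end EmpiricalMean

section SecondMoments

open ProbabilityTheory

lemma covariance_sq_le_variance_mul_variance {Ω : Type*} {mΩ : MeasurableSpace Ω} {μ : Measure Ω}
    [IsFiniteMeasure μ] {X Y : Ω → ℝ} (hX : MemLp X 2 μ) (hY : MemLp Y 2 μ) :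
    cov[X, Y; μ] ^ 2 ≤ Var[X; μ] * Var[Y; μ] := by
  have hquad (s : ℝ) : 0 ≤ Var[X; μ] * (s * s) + 2 * cov[X, Y; μ] * s + Var[Y; μ] := by
    have hvar := variance_add (hX.const_smul s) hY
    rw [variance_smul, covariance_smul_left] at hvar
    nlinarith [variance_nonneg (s • X + Y) μ]
  have hdiscrim := discrim_le_zero hquad
  rw [discrim] at hdiscrim
  linarith

lemma integral_sub_sq_eq_variance_add_sq {Ω : Type*} {mΩ : MeasurableSpace Ω} {μ : Measure Ω}
    [IsProbabilityMeasure μ] {X : Ω → ℝ} (hX : MemLp X 2 μ) (θ : ℝ) :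
    ∫ x, (X x - θ) ^ 2 ∂μ = Var[X; μ] + (∫ x, X x ∂μ - θ) ^ 2 := by
  have hint : ∫ x, X x ∂μ - θ = ∫ x, (X x - θ) ∂μ := by
    rw [integral_sub (hX.integrable one_le_two) (integrable_const _)]
    simp
  rw [hint, ← variance_sub_const hX.aestronglyMeasurable θ,
    variance_eq_sub (X := fun x => X x - θ) (hX.sub (memLp_const θ))]
  simp only [Pi.pow_apply, sub_add_cancel]

lemma integral_sq_le_of_abs_le {Ω : Type*} {mΩ : MeasurableSpace Ω} {μ : Measure Ω}
    [IsFiniteMeasure μ] {R W : Ω → ℝ} {N : Set Ω} {C κ : ℝ} (hN : MeasurableSet N)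
    (hW : MemLp W 2 μ) (hR : ∀ᵐ x ∂μ, |R x| ≤ C)
    (hRW : ∀ᵐ x ∂μ, x ∉ N → |R x| ≤ κ * |W x|) :
    ∫ x, R x ^ 2 ∂μ ≤ κ ^ 2 * ∫ x, W x ^ 2 ∂μ + C ^ 2 * μ.real N := by
  have hW' := hW.integrable_sq.const_mul (κ ^ 2)
  have hind : Integrable (N.indicator fun _ => C ^ 2) μ := (integrable_const _).indicator hN
  have hle : ∀ᵐ x ∂μ, R x ^ 2 ≤ κ ^ 2 * W x ^ 2 + N.indicator (fun _ => C ^ 2) x := by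
    filter_upwards [hR, hRW] with x hx hxN
    by_cases h : x ∈ N
    · rw [Set.indicator_of_mem h, ← sq_abs (R x)]
      have := pow_le_pow_left₀ (abs_nonneg _) hx 2
      have : 0 ≤ κ ^ 2 * W x ^ 2 := by positivity
      linarith
    · rw [Set.indicator_of_notMem h, add_zero, ← sq_abs (R x), ← sq_abs (W x), ← mul_pow]
      exact pow_le_pow_left₀ (abs_nonneg _) (hxN h) 2
  calc ∫ x, R x ^ 2 ∂μ ≤ ∫ x, (κ ^ 2 * W x ^ 2 + N.indicator (fun _ => C ^ 2) x) ∂μ :=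
        integral_mono_of_nonneg (Eventually.of_forall fun x => sq_nonneg _) (hW'.add hind) hle
    _ = _ := by
        rw [integral_add hW' hind, integral_const_mul, integral_indicator_const _ hN, smul_eq_mul,
          mul_comm (μ.real N)]

variable {Ω : ℕ → Type*} [∀ n, MeasurableSpace (Ω n)] {μ : ∀ n, Measure (Ω n)}
  [∀ n, IsProbabilityMeasure (μ n)] {W Y : ∀ n, Ω n → ℝ} {v : ℝ}

lemma tendsto_integral_of_tendsto_natCast_mul_integral_sq (hY : ∀ n, MemLp (Y n) 2 (μ n))
    (hlim : Tendsto (fun n : ℕ => (n : ℝ) * ∫ x, Y n x ^ 2 ∂(μ n)) atTop (𝓝 0)) :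
    Tendsto (fun n => ∫ x, Y n x ∂(μ n)) atTop (𝓝 0) := by
  have hsq : Tendsto (fun n => (∫ x, Y n x ∂(μ n)) ^ 2) atTop (𝓝 0) := by
    refine squeeze_zero' (Eventually.of_forall fun n => sq_nonneg _) ?_ hlim
    filter_upwards [eventually_ge_atTop 1] with n hn
    have hvar := variance_nonneg (Y n) (μ n)
    rw [variance_eq_sub (hY n), sub_nonneg] at hvar
    exact hvar.trans (le_mul_of_one_le_left (integral_nonneg fun x => sq_nonneg _)
      (by exact_mod_cast hn))
  refine (tendsto_zero_iff_abs_tendsto_zero _).mpr ?_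
  simpa only [Function.comp_def, Real.sqrt_sq_eq_abs, Real.sqrt_zero] using hsq.sqrt

lemma tendsto_natCast_mul_variance_add (hW : ∀ n, MemLp (W n) 2 (μ n))
    (hY : ∀ n, MemLp (Y n) 2 (μ n))
    (hWlim : Tendsto (fun n : ℕ => (n : ℝ) * Var[W n; μ n]) atTop (𝓝 v))
    (hYlim : Tendsto (fun n : ℕ => (n : ℝ) * ∫ x, Y n x ^ 2 ∂(μ n)) atTop (𝓝 0)) :
    Tendsto (fun n : ℕ => (n : ℝ) * Var[W n + Y n; μ n]) atTop (𝓝 v) := by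
  have hYvar : Tendsto (fun n : ℕ => (n : ℝ) * Var[Y n; μ n]) atTop (𝓝 0) :=
    squeeze_zero (fun n => mul_nonneg n.cast_nonneg (variance_nonneg _ _))
      (fun n => mul_le_mul_of_nonneg_left
        (variance_le_expectation_sq (hY n).aestronglyMeasurable) n.cast_nonneg) hYlim
  have hcov : Tendsto (fun n : ℕ => (n : ℝ) * cov[W n, Y n; μ n]) atTop (𝓝 0) := by
    have hsqrt := (hWlim.mul hYvar).sqrt
    rw [mul_zero, Real.sqrt_zero] at hsqrt
    refine squeeze_zero_norm (fun n => Real.abs_le_sqrt ?_) hsqrt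
    calc ((n : ℝ) * cov[W n, Y n; μ n]) ^ 2 = (n : ℝ) ^ 2 * cov[W n, Y n; μ n] ^ 2 := mul_pow _ _ _
      _ ≤ (n : ℝ) ^ 2 * (Var[W n; μ n] * Var[Y n; μ n]) := by
        gcongr
        exact covariance_sq_le_variance_mul_variance (hW n) (hY n)
      _ = _ := by ring
  have hsum := (hWlim.add (hcov.const_mul 2)).add hYvar
  rw [mul_zero, add_zero, add_zero] at hsum
  refine hsum.congr fun n => ?_
  rw [variance_add (hW n) (hY n)]
  ring

end SecondMoments

section Argmax

variable {X : Type*} [PseudoMetricSpace X] {A L : X → ℝ} {s t : Set X} {θ e : X}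

lemma exists_gap_of_forall_lt {r : ℝ} (hs : IsCompact s) (hL : ContinuousOn L s)
    (hθ : ∀ φ ∈ s, φ ≠ θ → L φ < L θ) (hr : 0 < r) :
    ∃ g > 0, ∀ φ ∈ s, r ≤ dist φ θ → L φ ≤ L θ - g := by
  have hclosed : IsClosed {φ : X | r ≤ dist φ θ} :=
    isClosed_le continuous_const (continuous_id.dist continuous_const)
  rcases (s ∩ {φ : X | r ≤ dist φ θ}).eq_empty_or_nonempty with hempty | hne
  · exact ⟨1, one_pos, fun φ hφ hφr => (Set.eq_empty_iff_forall_notMem.mp hempty φ ⟨hφ, hφr⟩).elim⟩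
  · obtain ⟨x, ⟨hxs, hxr⟩, hmax⟩ :=
      (hs.inter_right hclosed).exists_isMaxOn hne (hL.mono Set.inter_subset_left)
    have hxθ : x ≠ θ := fun h => hr.not_ge (by simpa [h] using hxr)
    refine ⟨L θ - L x, sub_pos.mpr (hθ x hxs hxθ), fun φ hφ hφr => ?_⟩
    rw [sub_sub_cancel]
    exact hmax ⟨hφ, hφr⟩

lemma abs_sub_lt_of_net {B g ρ : ℝ} (hA : ∀ φ ∈ s, ∀ ψ ∈ s, |A φ - A ψ| ≤ B * dist φ ψ)
    (hL : ∀ φ ∈ s, ∀ ψ ∈ s, |L φ - L ψ| ≤ B * dist φ ψ) (hB : 0 ≤ B) (hBρ : B * ρ ≤ g)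
    (hts : t ⊆ s) (hcover : s ⊆ ⋃ x ∈ t, Metric.ball x ρ) (hnet : ∀ φ ∈ t, |A φ - L φ| < g)
    {φ : X} (hφ : φ ∈ s) : |A φ - L φ| < 3 * g := by
  obtain ⟨ψ, hψ, hφψ⟩ := Set.mem_iUnion₂.mp (hcover hφ)
  have hdist : B * dist φ ψ ≤ g :=
    (mul_le_mul_of_nonneg_left (Metric.mem_ball.mp hφψ).le hB).trans hBρ
  have hAψ := abs_le.mp ((hA φ hφ ψ (hts hψ)).trans hdist)
  have hLψ := abs_le.mp ((hL φ hφ ψ (hts hψ)).trans hdist)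
  have hψ' := abs_lt.mp (hnet ψ hψ)
  exact abs_lt.mpr ⟨by linarith [hAψ.1, hLψ.2, hψ'.1], by linarith [hAψ.2, hLψ.1, hψ'.2]⟩

lemma dist_argmax_lt {δ r : ℝ} (hclose : ∀ φ ∈ s, |A φ - L φ| < δ)
    (hgap : ∀ φ ∈ s, r ≤ dist φ θ → L φ ≤ L θ - 2 * δ) (hθ : θ ∈ s) (he : e ∈ s)
    (hmax : A θ ≤ A e) : dist e θ < r := by
  by_contra! hr
  linarith [hgap e he hr, (abs_lt.mp (hclose e he)).2, (abs_lt.mp (hclose θ hθ)).1]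

/-- With `w = -f θ / D`, the mean value inequality for `f - D` gives `|e - θ - w| ≤ κ |e - θ|`, and
then `|e - θ| ≤ |e - θ - w| + |w|`. -/
lemma abs_root_sub_newton_le {f f' : ℝ → ℝ} {s : Set ℝ} {θ e D κ : ℝ} (hs : Convex ℝ s)
    (hf : ∀ φ ∈ s, HasDerivAt f (f' φ) φ) (hθ : θ ∈ s) (he : e ∈ s) (hD : D ≠ 0)
    (hκ : κ ≤ 1 / 2) (hf' : ∀ φ ∈ s, |f' φ - D| ≤ κ * |D|) (hroot : f e = 0) :
    |e - θ - -f θ / D| ≤ 2 * κ * |-f θ / D| := by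
  have hD' : 0 < |D| := abs_pos.mpr hD
  set w := -f θ / D with hw
  have hmvt : |(f e - D * e) - (f θ - D * θ)| ≤ κ * |D| * |e - θ| :=
    hs.norm_image_sub_le_of_norm_hasDerivWithin_le (f := fun φ => f φ - D * φ)
      (f' := fun φ => f' φ - D)
      (fun φ hφ => by
        simpa using ((hf φ hφ).fun_sub ((hasDerivAt_id φ).const_mul D)).hasDerivWithinAt)
      hf' hθ he
  have hfactor : (f e - D * e) - (f θ - D * θ) = -D * (e - θ - w) := by
    rw [hroot, hw]
    field_simp
    ring
  have hclose : |e - θ - w| ≤ κ * |e - θ| := by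
    rw [hfactor, abs_mul, abs_neg] at hmvt
    refine le_of_mul_le_mul_left (hmvt.trans_eq ?_) hD'
    ring
  have hκ0 : 0 ≤ κ := nonneg_of_mul_nonneg_left ((abs_nonneg _).trans (hf' θ hθ)) hD'
  have htri : |e - θ| ≤ |e - θ - w| + |w| := by
    simpa only [sub_add_cancel] using abs_add_le (e - θ - w) w
  nlinarith [mul_le_mul_of_nonneg_left htri hκ0, abs_nonneg (e - θ - w)]

lemma exists_pos_lt_lt_mul_lt (B : ℝ) {a b c : ℝ} (ha : 0 < a) (hb : 0 < b) (hc : 0 < c) :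
    ∃ r > 0, r < a ∧ r < b ∧ B * r < c := by
  have hsmall : ∀ᶠ r in 𝓝[>] (0 : ℝ), r < a ∧ r < b ∧ B * r < c :=
    nhdsWithin_le_nhds (((continuous_id.tendsto _).eventually_lt_const ha).and
      (((continuous_id.tendsto _).eventually_lt_const hb).and
        (((continuous_const_mul B).tendsto _).eventually_lt_const (by rwa [mul_zero]))))
  obtain ⟨r, h, hr⟩ := (hsmall.and self_mem_nhdsWithin).exists
  exact ⟨r, hr, h⟩

end Argmax

section MEstimation

open ProbabilityTheory

variable {𝒳 : Type*} [MeasurableSpace 𝒳]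

/-- The regularity conditions under which the maximizers of an empirical contrast are
asymptotically normal: the contrast `m x φ` is smooth in `φ ∈ [l, u]` with derivatives `m₁`, `m₂`,
all of them bounded by `B` on a set `K` of full measure, and the mean contrast has a strict,
nondegenerate maximum at an interior point `θ`. -/
structure RegularContrast (P : Measure 𝒳) (K : Set 𝒳) (l u θ B : ℝ) (m m₁ m₂ : 𝒳 → ℝ → ℝ) :
    Prop where
  ae_mem : ∀ᵐ x ∂P, x ∈ K
  measurable : ∀ φ, Measurable fun x => m x φ
  measurable₁ : ∀ φ, Measurable fun x => m₁ x φ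
  measurable₂ : ∀ φ, Measurable fun x => m₂ x φ
  hasDerivAt : ∀ x ∈ K, ∀ φ ∈ Set.Icc l u, HasDerivAt (m x) (m₁ x φ) φ
  hasDerivAt₁ : ∀ x ∈ K, ∀ φ ∈ Set.Icc l u, HasDerivAt (m₁ x) (m₂ x φ) φ
  abs_le : ∀ x ∈ K, ∀ φ ∈ Set.Icc l u, |m x φ| ≤ B
  abs_le₁ : ∀ x ∈ K, ∀ φ ∈ Set.Icc l u, |m₁ x φ| ≤ B
  abs_le₂ : ∀ x ∈ K, ∀ φ ∈ Set.Icc l u, |m₂ x φ| ≤ B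
  lipschitz₂ : ∀ x ∈ K, ∀ φ ∈ Set.Icc l u, ∀ ψ ∈ Set.Icc l u, |m₂ x φ - m₂ x ψ| ≤ B * |φ - ψ|
  mem_Ioo : θ ∈ Set.Ioo l u
  strict_max : ∀ φ ∈ Set.Icc l u, φ ≠ θ → ∫ x, m x φ ∂P < ∫ x, m x θ ∂P
  nondegenerate : ∫ x, m₂ x θ ∂P < 0

/-- On samples from `K`, the estimators `est` maximize the empirical mean of the contrast `m` over
`s`; one estimator for each sample size. -/
structure IsContrastMaximizer (K : Set 𝒳) (s : Set ℝ) (m : 𝒳 → ℝ → ℝ)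
    (est : (M : ℕ) → (Fin M → 𝒳) → ℝ) : Prop where
  measurable : ∀ M, Measurable (est M)
  mem : ∀ M (x : Fin M → 𝒳), (∀ j, x j ∈ K) → est M x ∈ s
  isMax : ∀ M (x : Fin M → 𝒳), (∀ j, x j ∈ K) → ∀ φ ∈ s,
    empiricalMean (fun y => m y φ) x ≤ empiricalMean (fun y => m y (est M x)) x

/-- The first-order approximation of the error of a contrast maximizer: one Newton step for the
empirical score, with the curvature replaced by its mean. -/
noncomputable def linearError (P : Measure 𝒳) (θ : ℝ) (m₁ m₂ : 𝒳 → ℝ → ℝ) {M : ℕ}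
    (x : Fin M → 𝒳) : ℝ :=
  -(empiricalMean (fun y => m₁ y θ) x) / ∫ y, m₂ y θ ∂P

namespace RegularContrast

variable {P : Measure 𝒳} {K : Set 𝒳} {l u θ B : ℝ} {m m₁ m₂ : 𝒳 → ℝ → ℝ}
  {est : (M : ℕ) → (Fin M → 𝒳) → ℝ}

lemma mem_Icc (h : RegularContrast P K l u θ B m m₁ m₂) : θ ∈ Set.Icc l u :=
  Set.Ioo_subset_Icc_self h.mem_Ioo

lemma lipschitz (h : RegularContrast P K l u θ B m m₁ m₂) {x : 𝒳} (hx : x ∈ K) {φ ψ : ℝ}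
    (hφ : φ ∈ Set.Icc l u) (hψ : ψ ∈ Set.Icc l u) : |m x φ - m x ψ| ≤ B * |φ - ψ| :=
  Convex.norm_image_sub_le_of_norm_hasDerivWithin_le (f' := m₁ x)
    (fun χ hχ => (h.hasDerivAt x hx χ hχ).hasDerivWithinAt) (fun χ hχ => h.abs_le₁ x hx χ hχ)
    (convex_Icc l u) hψ hφ

lemma measurable_linearError (h : RegularContrast P K l u θ B m m₁ m₂) (M : ℕ) :
    Measurable fun x : Fin M → 𝒳 => linearError P θ m₁ m₂ x :=
  (measurable_empiricalMean (h.measurable₁ θ) M).neg.div_const _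

variable [IsProbabilityMeasure P]

lemma bound_nonneg (h : RegularContrast P K l u θ B m m₁ m₂) : 0 ≤ B := by
  obtain ⟨x, hx⟩ := h.ae_mem.exists
  exact (abs_nonneg _).trans (h.abs_le x hx θ h.mem_Icc)

lemma integrable (h : RegularContrast P K l u θ B m m₁ m₂) {φ : ℝ} (hφ : φ ∈ Set.Icc l u) :
    Integrable (fun x => m x φ) P :=
  Integrable.of_bound (h.measurable φ).aestronglyMeasurable B
    (h.ae_mem.mono fun x hx => h.abs_le x hx φ hφ)

lemma memLp_two₁ (h : RegularContrast P K l u θ B m m₁ m₂) : MemLp (fun x => m₁ x θ) 2 P :=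
  MemLp.of_bound (h.measurable₁ θ).aestronglyMeasurable B
    (h.ae_mem.mono fun x hx => h.abs_le₁ x hx θ h.mem_Icc)

lemma lipschitz_integral (h : RegularContrast P K l u θ B m m₁ m₂) {φ ψ : ℝ}
    (hφ : φ ∈ Set.Icc l u) (hψ : ψ ∈ Set.Icc l u) :
    |∫ x, m x φ ∂P - ∫ x, m x ψ ∂P| ≤ B * |φ - ψ| := by
  rw [← integral_sub (h.integrable hφ) (h.integrable hψ)]
  simpa using norm_integral_le_of_norm_le_const (μ := P) (f := fun x => m x φ - m x ψ)
    (h.ae_mem.mono fun x hx => h.lipschitz hx hφ hψ)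

lemma continuousOn_integral (h : RegularContrast P K l u θ B m m₁ m₂) :
    ContinuousOn (fun φ => ∫ x, m x φ ∂P) (Set.Icc l u) :=
  (LipschitzOnWith.of_dist_le_mul (K := ⟨B, h.bound_nonneg⟩) fun _ hφ _ hψ =>
    h.lipschitz_integral hφ hψ).continuousOn

lemma integral_score_eq_zero (h : RegularContrast P K l u θ B m m₁ m₂) :
    ∫ x, m₁ x θ ∂P = 0 := by
  have hnhds : Set.Icc l u ∈ 𝓝 θ := Icc_mem_nhds h.mem_Ioo.1 h.mem_Ioo.2
  have hderiv := (hasDerivAt_integral_of_dominated_loc_of_deriv_le (μ := P)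
    (F := fun φ x => m x φ) (F' := fun φ x => m₁ x φ) (bound := fun _ => B) hnhds
    (Eventually.of_forall fun φ => (h.measurable φ).aestronglyMeasurable) (h.integrable h.mem_Icc)
    (h.measurable₁ θ).aestronglyMeasurable
    (h.ae_mem.mono fun x hx φ hφ => h.abs_le₁ x hx φ hφ) (integrable_const _)
    (h.ae_mem.mono fun x hx φ hφ => h.hasDerivAt x hx φ hφ)).2
  refine IsLocalMax.hasDerivAt_eq_zero (Filter.eventually_of_mem hnhds fun φ hφ => ?_) hderiv
  rcases eq_or_ne φ θ with rfl | hne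
  · exact le_rfl
  · exact (h.strict_max φ hφ hne).le

lemma abs_linearError_le (h : RegularContrast P K l u θ B m m₁ m₂) {M : ℕ} {x : Fin M → 𝒳}
    (hx : ∀ j, x j ∈ K) : |linearError P θ m₁ m₂ x| ≤ B / |∫ y, m₂ y θ ∂P| := by
  rw [linearError, abs_div, abs_neg]
  gcongr
  exact abs_empiricalMean_le h.bound_nonneg fun j => h.abs_le₁ _ (hx j) θ h.mem_Icc

lemma memLp_linearError (h : RegularContrast P K l u θ B m m₁ m₂) (M : ℕ) :
    MemLp (linearError P θ m₁ m₂) 2 (iidLaw P M) :=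
  MemLp.of_bound (h.measurable_linearError M).aestronglyMeasurable (B / |∫ y, m₂ y θ ∂P|)
    ((ae_iidLaw_forall_mem h.ae_mem M).mono fun _ hx => h.abs_linearError_le hx)

lemma integral_linearError (h : RegularContrast P K l u θ B m m₁ m₂) {M : ℕ} (hM : 0 < M) :
    ∫ x, linearError P θ m₁ m₂ x ∂(iidLaw P M) = 0 := by
  unfold linearError
  rw [integral_div, integral_neg, integral_empiricalMean (h.memLp_two₁.integrable one_le_two) hM,
    h.integral_score_eq_zero, neg_zero, zero_div]

lemma natCast_mul_variance_linearError (h : RegularContrast P K l u θ B m m₁ m₂) {M : ℕ}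
    (hM : 0 < M) : M * Var[linearError P θ m₁ m₂; iidLaw P M] =
      (∫ x, m₁ x θ ^ 2 ∂P) / (∫ x, m₂ x θ ∂P) ^ 2 := by
  have hscale : linearError P θ m₁ m₂ = fun x : Fin M → 𝒳 =>
      (-(∫ y, m₂ y θ ∂P)⁻¹) * empiricalMean (fun y => m₁ y θ) x := by
    ext x
    rw [linearError, div_eq_inv_mul, neg_mul_comm]
  rw [hscale, variance_const_mul, mul_left_comm,
    natCast_mul_variance_empiricalMean h.memLp_two₁ hM,
    variance_of_integral_eq_zero (h.measurable₁ θ).aemeasurable h.integral_score_eq_zero, neg_sq,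
    inv_pow, inv_mul_eq_div]

/-- Consistency: by Lipschitz continuity, the law of large numbers on a finite net makes the
empirical contrast uniformly close to its mean. -/
lemma exists_net_abs_sub_lt (h : RegularContrast P K l u θ B m m₁ m₂) {r : ℝ} (hr : 0 < r) :
    ∃ t ⊆ Set.Icc l u, t.Finite ∧ ∃ g > 0, ∀ (M : ℕ) (x : Fin M → 𝒳) (e : ℝ), (∀ j, x j ∈ K) →
      e ∈ Set.Icc l u →
      empiricalMean (fun y => m y θ) x ≤ empiricalMean (fun y => m y e) x →
      (∀ φ ∈ t, x ∉ deviationSet P (fun y => m y φ) g M) → |e - θ| < r := by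
  have hB := h.bound_nonneg
  obtain ⟨g, hg, hgap⟩ :=
    exists_gap_of_forall_lt isCompact_Icc h.continuousOn_integral h.strict_max hr
  have hρ : 0 < g / 6 / (B + 1) := by positivity
  have hBρ : B * (g / 6 / (B + 1)) ≤ g / 6 := by
    rw [mul_div_assoc', div_le_iff₀ (by positivity)]
    nlinarith
  obtain ⟨t, hts, htf, hcover⟩ := (isCompact_Icc (a := l) (b := u)).finite_cover_balls hρ
  refine ⟨t, hts, htf, g / 6, by positivity, fun M x e hx he hmax hdev => ?_⟩
  have hLipschitz : ∀ φ ∈ Set.Icc l u, ∀ ψ ∈ Set.Icc l u,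
      |empiricalMean (fun y => m y φ) x - empiricalMean (fun y => m y ψ) x| ≤ B * |φ - ψ| := by
    intro φ hφ ψ hψ
    rw [empiricalMean_sub]
    exact abs_empiricalMean_le (by positivity) fun j => h.lipschitz (hx j) hφ hψ
  have hclose : ∀ φ ∈ Set.Icc l u,
      |empiricalMean (fun y => m y φ) x - ∫ y, m y φ ∂P| < 3 * (g / 6) := fun φ hφ =>
    abs_sub_lt_of_net hLipschitz (fun φ hφ ψ hψ => h.lipschitz_integral hφ hψ) hB hBρ hts hcover
      (fun φ hφ => not_le.mp (hdev φ hφ)) hφ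
  refine dist_argmax_lt hclose (fun φ hφ hφr => ?_) h.mem_Icc he hmax
  linarith [hgap φ hφ hφr]

lemma abs_sub_linearError_le (h : RegularContrast P K l u θ B m m₁ m₂) {κ : ℝ} (hκ : κ ≤ 1 / 2)
    {M : ℕ} {x : Fin M → 𝒳} {e : ℝ} (hx : ∀ j, x j ∈ K) (he : e ∈ Set.Ioo l u)
    (hmax : ∀ φ ∈ Set.Icc l u,
      empiricalMean (fun y => m y φ) x ≤ empiricalMean (fun y => m y e) x)
    (hclose : B * |e - θ| ≤ κ / 2 * |∫ y, m₂ y θ ∂P|)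
    (hdev : x ∉ deviationSet P (fun y => m₂ y θ) (κ / 2 * |∫ y, m₂ y θ ∂P|) M) :
    |e - θ - linearError P θ m₁ m₂ x| ≤ 2 * κ * |linearError P θ m₁ m₂ x| := by
  have hB := h.bound_nonneg
  have hsub : Set.uIcc θ e ⊆ Set.Icc l u :=
    Set.uIcc_subset_Icc h.mem_Icc (Set.Ioo_subset_Icc_self he)
  have hroot : empiricalMean (fun y => m₁ y e) x = 0 :=
    IsLocalMax.hasDerivAt_eq_zero
      (Filter.eventually_of_mem (Icc_mem_nhds he.1 he.2) fun φ hφ => hmax φ hφ)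
      (hasDerivAt_empiricalMean fun j => h.hasDerivAt _ (hx j) e (Set.Ioo_subset_Icc_self he))
  refine abs_root_sub_newton_le (f := fun φ => empiricalMean (fun y => m₁ y φ) x)
    (f' := fun φ => empiricalMean (fun y => m₂ y φ) x) (convex_uIcc θ e)
    (fun φ hφ => hasDerivAt_empiricalMean fun j => h.hasDerivAt₁ _ (hx j) φ (hsub hφ))
    Set.left_mem_uIcc Set.right_mem_uIcc h.nondegenerate.ne hκ (fun φ hφ => ?_) hroot
  have hcurv : |empiricalMean (fun y => m₂ y φ) x - empiricalMean (fun y => m₂ y θ) x| ≤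
      κ / 2 * |∫ y, m₂ y θ ∂P| := by
    rw [empiricalMean_sub]
    refine (abs_empiricalMean_le (by positivity) fun j =>
      h.lipschitz₂ _ (hx j) φ (hsub hφ) θ h.mem_Icc).trans (le_trans ?_ hclose)
    exact mul_le_mul_of_nonneg_left (Set.abs_sub_left_of_mem_uIcc hφ) hB
  calc _ ≤ _ := abs_sub_le _ (empiricalMean (fun y => m₂ y θ) x) _
    _ ≤ κ / 2 * |∫ y, m₂ y θ ∂P| + κ / 2 * |∫ y, m₂ y θ ∂P| :=
        add_le_add hcurv (not_le.mp hdev).le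
    _ = κ * |∫ y, m₂ y θ ∂P| := by ring

lemma exists_exceptionalSet (h : RegularContrast P K l u θ B m m₁ m₂)
    (hest : IsContrastMaximizer K (Set.Icc l u) m est) {κ : ℝ} (hκ₀ : 0 < κ) (hκ : κ ≤ 1 / 2) :
    ∃ N : (M : ℕ) → Set (Fin M → 𝒳), (∀ M, MeasurableSet (N M)) ∧
      Tendsto (fun M : ℕ => (M : ℝ) * (iidLaw P M).real (N M)) atTop (𝓝 0) ∧
      ∀ M, ∀ x ∉ N M, (∀ j, x j ∈ K) →
        |est M x - θ - linearError P θ m₁ m₂ x| ≤ 2 * κ * |linearError P θ m₁ m₂ x| := by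
  have hB := h.bound_nonneg
  have hD : 0 < |∫ y, m₂ y θ ∂P| := abs_pos.mpr h.nondegenerate.ne
  obtain ⟨r, hr, hrl, hru, hrB⟩ :=
    exists_pos_lt_lt_mul_lt B (sub_pos.mpr h.mem_Ioo.1) (sub_pos.mpr h.mem_Ioo.2)
      (by positivity : 0 < κ / 2 * |∫ y, m₂ y θ ∂P|)
  obtain ⟨t, hts, htf, g, hg, hnet⟩ := h.exists_net_abs_sub_lt hr
  refine ⟨fun M => (⋃ φ ∈ htf.toFinset, deviationSet P (fun y => m y φ) g M) ∪
    deviationSet P (fun y => m₂ y θ) (κ / 2 * |∫ y, m₂ y θ ∂P|) M, fun M => ?_, ?_, ?_⟩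
  · exact (Finset.measurableSet_biUnion _ fun φ _ =>
      measurableSet_deviationSet P (h.measurable φ) g M).union
      (measurableSet_deviationSet P (h.measurable₂ θ) _ M)
  · have hlim := (tendsto_finsetSum htf.toFinset fun φ hφ =>
      tendsto_natCast_mul_measureReal_deviationSet (h.measurable φ) (h.ae_mem.mono fun x hx =>
        h.abs_le x hx φ (hts (htf.mem_toFinset.mp hφ))) hg).add
      (tendsto_natCast_mul_measureReal_deviationSet (h.measurable₂ θ) (h.ae_mem.mono fun x hx =>
        h.abs_le₂ x hx θ h.mem_Icc) (by positivity : 0 < κ / 2 * |∫ y, m₂ y θ ∂P|))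
    rw [Finset.sum_const_zero, add_zero] at hlim
    refine squeeze_zero (fun M => by positivity) (fun M => ?_) hlim
    rw [← Finset.mul_sum, ← mul_add]
    gcongr
    exact (measureReal_union_le _ _).trans
      (add_le_add_left (measureReal_biUnion_finset_le _ _) _)
  · intro M x hxN hx
    simp only [Set.mem_union, Set.mem_iUnion, not_or, not_exists, Set.Finite.mem_toFinset] at hxN
    have hloc : |est M x - θ| < r := hnet M x _ hx (hest.mem M x hx)
      (hest.isMax M x hx θ h.mem_Icc) hxN.1
    have hmem : est M x ∈ Set.Ioo l u := by
      have := abs_lt.mp hloc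
      exact ⟨by linarith, by linarith⟩
    exact h.abs_sub_linearError_le hκ hx hmem (hest.isMax M x hx)
      ((mul_le_mul_of_nonneg_left hloc.le hB).trans hrB.le) hxN.2

end RegularContrast

lemma IsContrastMaximizer.memLp {P : Measure 𝒳} [IsProbabilityMeasure P] {K : Set 𝒳} {l u : ℝ}
    {m : 𝒳 → ℝ → ℝ} {est : (M : ℕ) → (Fin M → 𝒳) → ℝ}
    (hest : IsContrastMaximizer K (Set.Icc l u) m est) (hK : ∀ᵐ x ∂P, x ∈ K) (M : ℕ) :
    MemLp (est M) 2 (iidLaw P M) :=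
  MemLp.of_bound (hest.measurable M).aestronglyMeasurable (max |l| |u|)
    ((ae_iidLaw_forall_mem hK M).mono fun x hx =>
      abs_le_max_abs_abs (hest.mem M x hx).1 (hest.mem M x hx).2)

namespace RegularContrast

variable {P : Measure 𝒳} [IsProbabilityMeasure P] {K : Set 𝒳} {l u θ B : ℝ}
  {m m₁ m₂ : 𝒳 → ℝ → ℝ} {est : (M : ℕ) → (Fin M → 𝒳) → ℝ}

lemma abs_remainder_le (h : RegularContrast P K l u θ B m m₁ m₂)
    (hest : IsContrastMaximizer K (Set.Icc l u) m est) {M : ℕ} {x : Fin M → 𝒳}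
    (hx : ∀ j, x j ∈ K) :
    |est M x - θ - linearError P θ m₁ m₂ x| ≤ (u - l) + B / |∫ y, m₂ y θ ∂P| :=
  (abs_sub _ _).trans (add_le_add
    (Real.dist_le_of_mem_Icc (hest.mem M x hx) h.mem_Icc) (h.abs_linearError_le hx))

lemma tendsto_natCast_mul_integral_sq_remainder (h : RegularContrast P K l u θ B m m₁ m₂)
    (hest : IsContrastMaximizer K (Set.Icc l u) m est) :
    Tendsto (fun M : ℕ => (M : ℝ) * ∫ x, (est M x - θ - linearError P θ m₁ m₂ x) ^ 2
      ∂(iidLaw P M)) atTop (𝓝 0) := by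
  set v : ℝ := (∫ x, m₁ x θ ^ 2 ∂P) / (∫ x, m₂ x θ ∂P) ^ 2 with hv
  set C : ℝ := (u - l) + B / |∫ y, m₂ y θ ∂P|
  have hbound {κ : ℝ} (hκ₀ : 0 < κ) (hκ : κ ≤ 1 / 2) : ∃ N : (M : ℕ) → Set (Fin M → 𝒳),
      Tendsto (fun M : ℕ => (M : ℝ) * (iidLaw P M).real (N M)) atTop (𝓝 0) ∧
      ∀ M : ℕ, 0 < M → (M : ℝ) * ∫ x, (est M x - θ - linearError P θ m₁ m₂ x) ^ 2 ∂(iidLaw P M) ≤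
        (2 * κ) ^ 2 * v + C ^ 2 * (M * (iidLaw P M).real (N M)) := by
    obtain ⟨N, hNmeas, hNlim, hN⟩ := h.exists_exceptionalSet hest hκ₀ hκ
    refine ⟨N, hNlim, fun M hM => ?_⟩
    have hae := ae_iidLaw_forall_mem h.ae_mem M
    have hsq := integral_sq_le_of_abs_le (hNmeas M) (h.memLp_linearError M)
      (hae.mono fun x hx => h.abs_remainder_le hest hx)
      (hae.mono fun x hx hxN => hN M x hxN hx)
    calc _ ≤ _ := mul_le_mul_of_nonneg_left hsq M.cast_nonneg
      _ = _ := by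
          rw [hv, ← h.natCast_mul_variance_linearError hM, variance_of_integral_eq_zero
            (h.measurable_linearError M).aemeasurable (h.integral_linearError hM)]
          ring
  refine tendsto_order.mpr ⟨fun a ha => Eventually.of_forall fun M => ha.trans_le
    (mul_nonneg M.cast_nonneg (integral_nonneg fun x => sq_nonneg _)), fun η hη => ?_⟩
  obtain ⟨κ, hκη, hκ, hκ₀⟩ : ∃ κ : ℝ, (2 * κ) ^ 2 * v < η ∧ κ < 1 / 2 ∧ 0 < κ := by
    have hcont : Continuous fun κ : ℝ => (2 * κ) ^ 2 * v := by fun_prop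
    have hsmall : ∀ᶠ κ in 𝓝[>] (0 : ℝ), (2 * κ) ^ 2 * v < η ∧ κ < 1 / 2 :=
      nhdsWithin_le_nhds (((hcont.tendsto _).eventually_lt_const (by simpa using hη)).and
        (eventually_lt_nhds (by norm_num)))
    obtain ⟨κ, hκ⟩ := (hsmall.and self_mem_nhdsWithin).exists
    exact ⟨κ, hκ.1.1, hκ.1.2, hκ.2⟩
  obtain ⟨N, hNlim, hN⟩ := hbound hκ₀ hκ.le
  have hlim := (hNlim.const_mul (C ^ 2)).const_add ((2 * κ) ^ 2 * v)
  rw [mul_zero, add_zero] at hlim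
  filter_upwards [hlim.eventually_lt_const hκη, eventually_gt_atTop 0] with M hM hM₀
  exact (hN M hM₀).trans_lt hM

lemma memLp_remainder (h : RegularContrast P K l u θ B m m₁ m₂)
    (hest : IsContrastMaximizer K (Set.Icc l u) m est) (M : ℕ) :
    MemLp (fun x => est M x - θ - linearError P θ m₁ m₂ x) 2 (iidLaw P M) :=
  ((hest.memLp h.ae_mem M).sub (memLp_const θ)).sub (h.memLp_linearError M)

theorem tendsto_integral (h : RegularContrast P K l u θ B m m₁ m₂)
    (hest : IsContrastMaximizer K (Set.Icc l u) m est) :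
    Tendsto (fun M : ℕ => ∫ x, est M x ∂(iidLaw P M)) atTop (𝓝 θ) := by
  have hlim := (tendsto_integral_of_tendsto_natCast_mul_integral_sq (h.memLp_remainder hest)
    (h.tendsto_natCast_mul_integral_sq_remainder hest)).add_const θ
  rw [zero_add] at hlim
  refine hlim.congr' ?_
  filter_upwards [eventually_gt_atTop 0] with M hM
  have hint := (hest.memLp h.ae_mem M).integrable one_le_two
  have hsub : Integrable (fun x => est M x - θ) (iidLaw P M) := hint.sub (integrable_const θ)
  rw [integral_sub hsub ((h.memLp_linearError M).integrable one_le_two),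
    integral_sub hint (integrable_const θ), h.integral_linearError hM]
  simp

theorem tendsto_natCast_mul_variance (h : RegularContrast P K l u θ B m m₁ m₂)
    (hest : IsContrastMaximizer K (Set.Icc l u) m est) :
    Tendsto (fun M : ℕ => (M : ℝ) * Var[est M; iidLaw P M]) atTop
      (𝓝 ((∫ x, m₁ x θ ^ 2 ∂P) / (∫ x, m₂ x θ ∂P) ^ 2)) := by
  have hlinear : Tendsto (fun M : ℕ => (M : ℝ) * Var[linearError P θ m₁ m₂; iidLaw P M]) atTop
      (𝓝 ((∫ x, m₁ x θ ^ 2 ∂P) / (∫ x, m₂ x θ ∂P) ^ 2)) :=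
    tendsto_const_nhds.congr' ((eventually_gt_atTop 0).mono fun M hM =>
      (h.natCast_mul_variance_linearError hM).symm)
  refine (tendsto_natCast_mul_variance_add h.memLp_linearError (h.memLp_remainder hest) hlinear
    (h.tendsto_natCast_mul_integral_sq_remainder hest)).congr fun M => ?_
  have hsum : (linearError P θ m₁ m₂ + fun x => est M x - θ - linearError P θ m₁ m₂ x) =
      fun x => est M x - θ := by
    ext x
    simp
  rw [hsum, variance_sub_const (hest.measurable M).aestronglyMeasurable]

end RegularContrast

end MEstimation

section IntervalIntegral

variable {f : ℝ → ℝ}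

lemma sub_mul_le_intervalIntegral {a b c : ℝ} (hab : a ≤ b) (hf : IntervalIntegrable f volume a b)
    (h : ∀ x ∈ Set.Icc a b, c ≤ f x) : (b - a) * c ≤ ∫ x in a..b, f x := by
  simpa using intervalIntegral.integral_mono_on hab intervalIntegrable_const hf h

lemma integral_add_integral_le {l a b c d u : ℝ} (hf : IntervalIntegrable f volume l u)
    (hf₀ : ∀ x, 0 ≤ f x) (hla : l ≤ a) (hab : a ≤ b) (hbc : b ≤ c) (hcd : c ≤ d) (hdu : d ≤ u) :
    (∫ x in a..b, f x) + ∫ x in c..d, f x ≤ ∫ x in l..u, f x := by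
  have hsub : ∀ {s t : ℝ}, l ≤ s → s ≤ t → t ≤ u → IntervalIntegrable f volume s t :=
    fun hls hst htu => hf.mono_set (by
      rw [Set.uIcc_of_le hst, Set.uIcc_of_le (hls.trans (hst.trans htu))]
      exact Set.Icc_subset_Icc hls htu)
  have hmid : 0 ≤ ∫ x in b..c, f x := intervalIntegral.integral_nonneg hbc fun x _ => hf₀ x
  have hmono : ∫ x in a..d, f x ≤ ∫ x in l..u, f x :=
    intervalIntegral.integral_mono_interval hla (hab.trans (hbc.trans hcd)) hdu
      (Eventually.of_forall hf₀) hf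
  have hsplit := intervalIntegral.integral_add_adjacent_intervals
    (hsub hla hab (by linarith)) (hsub (by linarith) hbc (by linarith))
  have hsplit' := intervalIntegral.integral_add_adjacent_intervals
    (hsub hla (by linarith) (by linarith)) (hsub (by linarith) hcd hdu)
  linarith

lemma le_integral_of_le_add_reflect (hf : Continuous f) (hf₀ : ∀ x, 0 ≤ f x) {l u θ a b κ : ℝ}
    (ha : 0 ≤ a) (hab : a ≤ b) (hl : l ≤ θ - b) (hu : θ + b ≤ u)
    (h : ∀ x ∈ Set.Icc (θ + a) (θ + b), κ ≤ f x + f (2 * θ - x)) :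
    (b - a) * κ ≤ ∫ x in l..u, f x := by
  have hf' : Continuous fun x => f (2 * θ - x) := hf.comp (by fun_prop)
  have hreflect : ∫ x in (θ + a)..(θ + b), f (2 * θ - x) = ∫ x in (θ - b)..(θ - a), f x := by
    rw [intervalIntegral.integral_comp_sub_left]
    congr 1 <;> ring
  calc (b - a) * κ = (θ + b - (θ + a)) * κ := by ring
    _ ≤ ∫ x in (θ + a)..(θ + b), f x + f (2 * θ - x) :=
        sub_mul_le_intervalIntegral (by linarith) ((hf.add hf').intervalIntegrable _ _) h
    _ = (∫ x in (θ - b)..(θ - a), f x) + ∫ x in (θ + a)..(θ + b), f x := by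
        rw [intervalIntegral.integral_add (hf.intervalIntegrable _ _)
          (hf'.intervalIntegrable _ _), hreflect, add_comm]
    _ ≤ _ := integral_add_integral_le (hf.intervalIntegrable _ _) hf₀ hl (by linarith)
        (by linarith) (by linarith) hu

lemma le_integral_of_le_add_shift (hf : Continuous f) (hf₀ : ∀ x, 0 ≤ f x) {l u a b s κ : ℝ}
    (hab : a ≤ b) (hs : b ≤ a + s) (hl : l ≤ a) (hu : b + s ≤ u)
    (h : ∀ x ∈ Set.Icc a b, κ ≤ f x + f (x + s)) :
    (b - a) * κ ≤ ∫ x in l..u, f x := by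
  have hf' : Continuous fun x => f (x + s) := hf.comp (by fun_prop)
  calc (b - a) * κ ≤ ∫ x in a..b, f x + f (x + s) :=
        sub_mul_le_intervalIntegral hab ((hf.add hf').intervalIntegrable _ _) h
    _ = (∫ x in a..b, f x) + ∫ x in (a + s)..(b + s), f x := by
        rw [intervalIntegral.integral_add (hf.intervalIntegrable _ _)
          (hf'.intervalIntegrable _ _), intervalIntegral.integral_comp_add_right]
    _ ≤ _ := integral_add_integral_le (hf.intervalIntegrable _ _) hf₀ hl hab hs (by linarith) hu

end IntervalIntegral

/-- The Gaussian bump of width `σ` and height one centred at `φ`. -/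
noncomputable def bump (σ x φ : ℝ) : ℝ := Real.exp (-(x - φ) ^ 2 / (2 * σ ^ 2))

section Bump

variable {σ : ℝ}

lemma bump_pos (σ x φ : ℝ) : 0 < bump σ x φ := Real.exp_pos _

lemma bump_le_one (σ x φ : ℝ) : bump σ x φ ≤ 1 := by
  rw [bump, Real.exp_le_one_iff, neg_div]
  exact neg_nonpos.mpr (by positivity)

lemma continuous_bump (σ φ : ℝ) : Continuous fun x => bump σ x φ := by
  unfold bump
  fun_prop

lemma bump_reflect (σ x φ : ℝ) : bump σ (2 * φ - x) φ = bump σ x φ := by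
  unfold bump
  congr 2
  ring

lemma bump_add_mul (hσ : 0 < σ) (θ y d : ℝ) :
    bump σ (θ + y * σ) (θ + d * σ) = Real.exp (-(y - d) ^ 2 / 2) := by
  unfold bump
  congr 1
  field_simp
  ring

lemma bump_add_mul_self (hσ : 0 < σ) (θ y : ℝ) :
    bump σ (θ + y * σ) θ = Real.exp (-y ^ 2 / 2) := by
  simpa using bump_add_mul hσ θ y 0

lemma hasDerivAt_bump_right (hσ : 0 < σ) (x φ : ℝ) :
    HasDerivAt (fun φ => bump σ x φ) (bump σ x φ * ((x - φ) / σ / σ)) φ := by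
  have hexponent : HasDerivAt (fun φ => -(x - φ) ^ 2 / (2 * σ ^ 2)) ((x - φ) / σ / σ) φ := by
    refine ((((hasDerivAt_id φ).const_sub x).pow 2).neg.div_const (2 * σ ^ 2)).congr_deriv ?_
    simp only [id_eq]
    field_simp
    norm_num
    ring
  exact hexponent.exp

lemma hasDerivAt_bump_left (hσ : 0 < σ) (x φ : ℝ) :
    HasDerivAt (fun x => bump σ x φ) (-(bump σ x φ * ((x - φ) / σ / σ))) x := by
  have hsymm : (fun x => bump σ x φ) = fun x => bump σ φ x := by
    ext x
    simp only [bump, sub_sq_comm]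
  rw [hsymm]
  refine (hasDerivAt_bump_right hσ φ x).congr_deriv ?_
  rw [congrFun hsymm x, ← neg_sub x φ]
  ring

lemma integral_bump_le (hσ : 0 < σ) {l u : ℝ} (hlu : l ≤ u) (φ : ℝ) :
    ∫ x in l..u, bump σ x φ ≤ 3 * σ := by
  have hb : 0 < 1 / (2 * σ ^ 2) := by positivity
  have hfun : (fun x => bump σ x φ) = fun x => Real.exp (-(1 / (2 * σ ^ 2)) * (x - φ) ^ 2) := by
    ext x
    unfold bump
    congr 1
    ring
  have hint : Integrable (fun x => bump σ x φ) := by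
    rw [hfun]
    exact (integrable_exp_neg_mul_sq hb).comp_sub_right φ
  calc ∫ x in l..u, bump σ x φ ≤ ∫ x, bump σ x φ := by
        rw [intervalIntegral.integral_of_le hlu]
        exact setIntegral_le_integral hint (Eventually.of_forall fun x => (bump_pos σ x φ).le)
    _ = √(π / (1 / (2 * σ ^ 2))) := by
        rw [hfun, integral_sub_right_eq_self fun x => Real.exp (-(1 / (2 * σ ^ 2)) * x ^ 2),
          integral_gaussian]
    _ ≤ 3 * σ := by
        refine Real.sqrt_le_iff.mpr ⟨by positivity, ?_⟩
        rw [div_div_eq_mul_div, div_one]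
        nlinarith [sq_nonneg σ, Real.pi_lt_four]

lemma half_le_bump (hσ : 0 < σ) {x φ : ℝ} (h : |x - φ| ≤ σ) : 1 / 2 ≤ bump σ x φ := by
  have hsq : (x - φ) ^ 2 / (2 * σ ^ 2) ≤ 1 / 2 := by
    rw [div_le_div_iff₀ (by positivity) (by norm_num)]
    linarith [sq_le_sq' (neg_le_of_abs_le h) (le_of_abs_le h)]
  have hexp := Real.add_one_le_exp (-(x - φ) ^ 2 / (2 * σ ^ 2))
  unfold bump
  rw [neg_div] at hexp ⊢
  linarith

lemma le_integral_bump (hσ : 0 < σ) {l u φ : ℝ} (hlu : 2 * σ ≤ u - l) (hφ : φ ∈ Set.Icc l u) :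
    σ / 2 ≤ ∫ x in l..u, bump σ x φ := by
  have hint : ∀ a b, IntervalIntegrable (fun x => bump σ x φ) volume a b :=
    fun a b => (continuous_bump σ φ).intervalIntegrable a b
  obtain ⟨a, hla, hau, ha⟩ : ∃ a, l ≤ a ∧ a + σ ≤ u ∧ ∀ x ∈ Set.Icc a (a + σ), |x - φ| ≤ σ := by
    rcases le_total (φ + σ) u with h | h
    · exact ⟨φ, hφ.1, h, fun x hx => abs_le.mpr ⟨by linarith [hx.1], by linarith [hx.2]⟩⟩
    · exact ⟨φ - σ, by linarith, by linarith [hφ.2],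
        fun x hx => abs_le.mpr ⟨by linarith [hx.1], by linarith [hx.2]⟩⟩
  calc σ / 2 = (a + σ - a) * (1 / 2) := by ring
    _ ≤ ∫ x in a..(a + σ), bump σ x φ :=
        sub_mul_le_intervalIntegral (by linarith) (hint _ _) fun x hx => half_le_bump hσ (ha x hx)
    _ ≤ _ := intervalIntegral.integral_mono_interval hla (by linarith) hau
        (Eventually.of_forall fun x => (bump_pos σ x φ).le) (hint _ _)

end Bump

section LogDeriv

variable {f f₁ f₂ f₃ : ℝ → ℝ} {x : ℝ}

lemma hasDerivAt_div_of_hasDerivAt (hf : HasDerivAt f (f₁ x) x) (hf₁ : HasDerivAt f₁ (f₂ x) x)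
    (hne : f x ≠ 0) :
    HasDerivAt (fun x => f₁ x / f x) (f₂ x / f x - (f₁ x / f x) ^ 2) x := by
  refine (hf₁.div hf hne).congr_deriv ?_
  field_simp

lemma hasDerivAt_div_sub_sq_of_hasDerivAt (hf : HasDerivAt f (f₁ x) x)
    (hf₁ : HasDerivAt f₁ (f₂ x) x) (hf₂ : HasDerivAt f₂ (f₃ x) x) (hne : f x ≠ 0) :
    HasDerivAt (fun x => f₂ x / f x - (f₁ x / f x) ^ 2)
      (f₃ x / f x - 3 * (f₂ x / f x) * (f₁ x / f x) + 2 * (f₁ x / f x) ^ 3) x := by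
  refine ((hf₂.div hf hne).sub
    ((hasDerivAt_div_of_hasDerivAt hf hf₁ hne).pow 2)).congr_deriv ?_
  simp only [Nat.add_one_sub_one, pow_one, Nat.cast_ofNat]
  field_simp
  ring

end LogDeriv

/-- A Gaussian peak of height `α` and width `σ` above a uniform floor of height `β`, observed in
the window `[l, u]`; the centre of the peak is the parameter to be estimated. -/
structure PeakModel where
  /-- the height of the peak -/
  α : ℝ
  /-- the height of the floor -/
  β : ℝ
  /-- the width of the peak -/
  σ : ℝ
  /-- the left end of the window -/
  l : ℝ
  /-- the right end of the window -/
  u : ℝ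
  α_pos : 0 < α
  β_pos : 0 < β
  σ_pos : 0 < σ
  l_lt_u : l < u

namespace PeakModel

variable (G : PeakModel)

/-- The length of the window in units of the width of the peak. -/
noncomputable def R : ℝ := (G.u - G.l) / G.σ

/-- The unnormalized density at `x` of the model with centre `φ`. -/
noncomputable def q (x φ : ℝ) : ℝ := G.α * bump G.σ x φ + G.β

/-- The derivative of `q` with respect to the centre. -/
noncomputable def q₁ (x φ : ℝ) : ℝ := G.α * bump G.σ x φ * ((x - φ) / G.σ / G.σ)

/-- The second derivative of `q` with respect to the centre. -/
noncomputable def q₂ (x φ : ℝ) : ℝ :=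
  G.α * bump G.σ x φ * ((((x - φ) / G.σ) ^ 2 - 1) / G.σ ^ 2)

/-- The third derivative of `q` with respect to the centre. -/
noncomputable def q₃ (x φ : ℝ) : ℝ :=
  G.α * bump G.σ x φ * ((((x - φ) / G.σ) ^ 3 - 3 * ((x - φ) / G.σ)) / G.σ ^ 3)

/-- The mass of the unnormalized density in the window. -/
noncomputable def Z (φ : ℝ) : ℝ := ∫ x in G.l..G.u, G.q x φ

/-- The derivative of `Z`. -/
noncomputable def Z₁ (φ : ℝ) : ℝ := G.q G.l φ - G.q G.u φ

/-- The second derivative of `Z`. -/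
noncomputable def Z₂ (φ : ℝ) : ℝ := G.q₁ G.l φ - G.q₁ G.u φ

/-- The third derivative of `Z`. -/
noncomputable def Z₃ (φ : ℝ) : ℝ := G.q₂ G.l φ - G.q₂ G.u φ

/-- The logarithm of the normalized density. -/
noncomputable def m (x φ : ℝ) : ℝ := Real.log (G.q x φ) - Real.log (G.Z φ)

/-- The score, i.e. the derivative of `m` with respect to the centre. -/
noncomputable def m₁ (x φ : ℝ) : ℝ := G.q₁ x φ / G.q x φ - G.Z₁ φ / G.Z φ

/-- The second derivative of `m` with respect to the centre. -/
noncomputable def m₂ (x φ : ℝ) : ℝ :=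
  (G.q₂ x φ / G.q x φ - (G.q₁ x φ / G.q x φ) ^ 2) - (G.Z₂ φ / G.Z φ - (G.Z₁ φ / G.Z φ) ^ 2)

/-- The third derivative of `m` with respect to the centre. -/
noncomputable def m₃ (x φ : ℝ) : ℝ :=
  (G.q₃ x φ / G.q x φ - 3 * (G.q₂ x φ / G.q x φ) * (G.q₁ x φ / G.q x φ) +
    2 * (G.q₁ x φ / G.q x φ) ^ 3) -
  (G.Z₃ φ / G.Z φ - 3 * (G.Z₂ φ / G.Z φ) * (G.Z₁ φ / G.Z φ) + 2 * (G.Z₁ φ / G.Z φ) ^ 3)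

lemma R_mul_σ : G.R * G.σ = G.u - G.l := div_mul_cancel₀ _ G.σ_pos.ne'

lemma R_pos : 0 < G.R := div_pos (sub_pos.mpr G.l_lt_u) G.σ_pos

lemma mul_bump_pos (x φ : ℝ) : 0 < G.α * bump G.σ x φ := mul_pos G.α_pos (bump_pos G.σ x φ)

lemma mul_bump_le (x φ : ℝ) : G.α * bump G.σ x φ ≤ G.α :=
  mul_le_of_le_one_right G.α_pos.le (bump_le_one G.σ x φ)

lemma q_pos (x φ : ℝ) : 0 < G.q x φ := add_pos (G.mul_bump_pos x φ) G.β_pos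

lemma q_le (x φ : ℝ) : G.q x φ ≤ G.α + G.β := add_le_add_left (G.mul_bump_le x φ) G.β

lemma q_reflect (x θ : ℝ) : G.q (2 * θ - x) θ = G.q x θ := by
  rw [q, bump_reflect, q]

lemma q₁_reflect (x θ : ℝ) : G.q₁ (2 * θ - x) θ = -G.q₁ x θ := by
  rw [q₁, bump_reflect, q₁]
  ring

lemma continuous_q (φ : ℝ) : Continuous fun x => G.q x φ := by
  have := continuous_bump G.σ φ
  unfold q
  fun_prop

lemma continuous_q₁ (φ : ℝ) : Continuous fun x => G.q₁ x φ := by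
  have := continuous_bump G.σ φ
  unfold q₁
  fun_prop

lemma continuous_q₂ (φ : ℝ) : Continuous fun x => G.q₂ x φ := by
  have := continuous_bump G.σ φ
  unfold q₂
  fun_prop

lemma continuous_m (φ : ℝ) : Continuous fun x => G.m x φ :=
  ((G.continuous_q φ).log fun x => (G.q_pos x φ).ne').sub continuous_const

lemma continuous_m₁ (φ : ℝ) : Continuous fun x => G.m₁ x φ :=
  ((G.continuous_q₁ φ).div (G.continuous_q φ) fun x => (G.q_pos x φ).ne').sub continuous_const

lemma continuous_m₂ (φ : ℝ) : Continuous fun x => G.m₂ x φ :=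
  (((G.continuous_q₂ φ).div (G.continuous_q φ) fun x => (G.q_pos x φ).ne').sub
    (((G.continuous_q₁ φ).div (G.continuous_q φ) fun x => (G.q_pos x φ).ne').pow 2)).sub
    continuous_const

lemma hasDerivAt_q (x φ : ℝ) : HasDerivAt (fun φ => G.q x φ) (G.q₁ x φ) φ :=
  (((hasDerivAt_bump_right G.σ_pos x φ).const_mul G.α).add_const G.β).congr_deriv
    (mul_assoc _ _ _).symm

lemma hasDerivAt_rescaled (x φ : ℝ) : HasDerivAt (fun φ => (x - φ) / G.σ) (-1 / G.σ) φ :=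
  ((hasDerivAt_id φ).const_sub x).div_const G.σ

lemma hasDerivAt_q₁ (x φ : ℝ) : HasDerivAt (fun φ => G.q₁ x φ) (G.q₂ x φ) φ := by
  have hσ := G.σ_pos.ne'
  refine (((hasDerivAt_bump_right G.σ_pos x φ).const_mul G.α).mul
    ((G.hasDerivAt_rescaled x φ).div_const G.σ)).congr_deriv ?_
  unfold q₂
  field_simp
  ring

lemma hasDerivAt_q₂ (x φ : ℝ) : HasDerivAt (fun φ => G.q₂ x φ) (G.q₃ x φ) φ := by
  have hσ := G.σ_pos.ne'
  refine (((hasDerivAt_bump_right G.σ_pos x φ).const_mul G.α).mul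
    ((((G.hasDerivAt_rescaled x φ).pow 2).sub_const 1).div_const (G.σ ^ 2))).congr_deriv ?_
  unfold q₃
  simp only [Pi.pow_apply, Nat.add_one_sub_one, pow_one, Nat.cast_ofNat]
  field_simp
  ring

lemma Z_eq (φ : ℝ) :
    G.Z φ = G.α * (∫ x in G.l..G.u, bump G.σ x φ) + G.β * (G.u - G.l) := by
  unfold Z q
  rw [intervalIntegral.integral_add, intervalIntegral.integral_const_mul,
    intervalIntegral.integral_const, smul_eq_mul, mul_comm G.β]
  · exact ((continuous_bump G.σ φ).const_mul G.α).intervalIntegrable _ _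
  · exact intervalIntegrable_const

/-- `q x φ` depends on `x - φ` only, so its derivative in `x` is `-q₁` and the integral
telescopes. -/
lemma integral_q₁ (φ : ℝ) : ∫ x in G.l..G.u, G.q₁ x φ = G.Z₁ φ := by
  have hderiv : ∀ x, HasDerivAt (fun x => -G.q x φ) (G.q₁ x φ) x := fun x =>
    (((hasDerivAt_bump_left G.σ_pos x φ).const_mul G.α).add_const G.β).fun_neg.congr_deriv
      (by rw [q₁]; ring)
  rw [intervalIntegral.integral_eq_sub_of_hasDerivAt (fun x _ => hderiv x)
    ((G.continuous_q₁ φ).intervalIntegrable _ _), Z₁]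
  ring

lemma integral_q₂ (φ : ℝ) : ∫ x in G.l..G.u, G.q₂ x φ = G.Z₂ φ := by
  have hσ := G.σ_pos.ne'
  have hderiv : ∀ x, HasDerivAt (fun x => -G.q₁ x φ) (G.q₂ x φ) x := fun x => by
    refine (((hasDerivAt_bump_left G.σ_pos x φ).const_mul G.α).fun_mul
      ((((hasDerivAt_id x).sub_const φ).div_const G.σ).div_const G.σ)).fun_neg.congr_deriv ?_
    simp only [q₂, id_eq]
    field_simp
    ring
  rw [intervalIntegral.integral_eq_sub_of_hasDerivAt (fun x _ => hderiv x)
    ((G.continuous_q₂ φ).intervalIntegrable _ _), Z₂]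
  ring

lemma hasDerivAt_Z (φ : ℝ) : HasDerivAt G.Z (G.Z₁ φ) φ := by
  set f : ℝ → ℝ := fun z => G.q z 0
  have hf : Continuous f := G.continuous_q 0
  have hq : ∀ x φ, G.q x φ = f (x - φ) := fun x φ => by simp [f, q, bump]
  have hprim : ∀ t, HasDerivAt (fun t => ∫ z in (0 : ℝ)..t, f z) (f t) t := fun t =>
    intervalIntegral.integral_hasDerivAt_right (hf.intervalIntegrable _ _)
      (hf.stronglyMeasurableAtFilter _ _) hf.continuousAt
  have hZ : G.Z = fun φ => (∫ z in (0 : ℝ)..(G.u - φ), f z) - ∫ z in (0 : ℝ)..(G.l - φ), f z := by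
    ext φ
    rw [intervalIntegral.integral_interval_sub_left (hf.intervalIntegrable _ _)
      (hf.intervalIntegrable _ _), ← intervalIntegral.integral_comp_sub_right f φ]
    simp only [Z, hq]
  have hend : ∀ x, HasDerivAt (fun φ => ∫ z in (0 : ℝ)..(x - φ), f z) (f (x - φ) * -1) φ :=
    fun x => (hprim (x - φ)).comp φ ((hasDerivAt_id φ).const_sub x)
  rw [hZ]
  refine ((hend G.u).sub (hend G.l)).congr_deriv ?_
  rw [Z₁, hq, hq]
  ring

lemma hasDerivAt_Z₁ (φ : ℝ) : HasDerivAt G.Z₁ (G.Z₂ φ) φ :=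
  (G.hasDerivAt_q G.l φ).sub (G.hasDerivAt_q G.u φ)

lemma hasDerivAt_Z₂ (φ : ℝ) : HasDerivAt G.Z₂ (G.Z₃ φ) φ :=
  (G.hasDerivAt_q₁ G.l φ).sub (G.hasDerivAt_q₁ G.u φ)

lemma le_Z (hR : 2 ≤ G.R) {φ : ℝ} (hφ : φ ∈ Set.Icc G.l G.u) :
    G.α * G.σ / 2 + G.β * (G.u - G.l) ≤ G.Z φ := by
  have hlen : 2 * G.σ ≤ G.u - G.l := by
    rw [← G.R_mul_σ]
    exact mul_le_mul_of_nonneg_right hR G.σ_pos.le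
  rw [G.Z_eq]
  linarith [mul_le_mul_of_nonneg_left (le_integral_bump G.σ_pos hlen hφ) G.α_pos.le]

lemma Z_le (φ : ℝ) : G.Z φ ≤ 3 * (G.α * G.σ) + G.β * (G.u - G.l) := by
  rw [G.Z_eq]
  linarith [mul_le_mul_of_nonneg_left (integral_bump_le G.σ_pos G.l_lt_u.le φ) G.α_pos.le]

lemma Z_pos (φ : ℝ) : 0 < G.Z φ :=
  intervalIntegral.intervalIntegral_pos_of_pos ((G.continuous_q φ).intervalIntegrable _ _)
    (fun x => G.q_pos x φ) G.l_lt_u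

lemma Z_le_six_mul_Z (hR : 2 ≤ G.R) {φ φ' : ℝ} (hφ' : φ' ∈ Set.Icc G.l G.u) :
    G.Z φ ≤ 6 * G.Z φ' := by
  linarith [G.Z_le φ, G.le_Z hR hφ', mul_pos G.β_pos (sub_pos.mpr G.l_lt_u)]

lemma hasDerivAt_m (x φ : ℝ) : HasDerivAt (fun φ => G.m x φ) (G.m₁ x φ) φ :=
  ((G.hasDerivAt_q x φ).log (G.q_pos x φ).ne').sub ((G.hasDerivAt_Z φ).log (G.Z_pos φ).ne')

lemma hasDerivAt_m₁ (x φ : ℝ) : HasDerivAt (fun φ => G.m₁ x φ) (G.m₂ x φ) φ :=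
  (hasDerivAt_div_of_hasDerivAt (G.hasDerivAt_q x φ) (G.hasDerivAt_q₁ x φ) (G.q_pos x φ).ne').sub
  (hasDerivAt_div_of_hasDerivAt (G.hasDerivAt_Z φ) (G.hasDerivAt_Z₁ φ) (G.Z_pos φ).ne')

lemma hasDerivAt_m₂ (x φ : ℝ) : HasDerivAt (fun φ => G.m₂ x φ) (G.m₃ x φ) φ :=
  (hasDerivAt_div_sub_sq_of_hasDerivAt (G.hasDerivAt_q x φ) (G.hasDerivAt_q₁ x φ)
    (G.hasDerivAt_q₂ x φ) (G.q_pos x φ).ne').sub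
  (hasDerivAt_div_sub_sq_of_hasDerivAt (G.hasDerivAt_Z φ) (G.hasDerivAt_Z₁ φ)
    (G.hasDerivAt_Z₂ φ) (G.Z_pos φ).ne')

end PeakModel

lemma abs_third_logDeriv_le {a b c A B C : ℝ} (ha : |a| ≤ A) (hb : |b| ≤ B) (hc : |c| ≤ C) :
    |c - 3 * b * a + 2 * a ^ 3| ≤ C + 3 * (B * A) + 2 * A ^ 3 := by
  have hba : |b * a| ≤ B * A := by
    rw [abs_mul]
    exact mul_le_mul hb ha (abs_nonneg _) ((abs_nonneg _).trans hb)
  have ha3 : |a ^ 3| ≤ A ^ 3 := by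
    rw [abs_pow]
    exact pow_le_pow_left₀ (abs_nonneg _) ha 3
  rw [abs_le] at *
  constructor <;> linarith [hba.1, hba.2, ha3.1, ha3.2]

lemma abs_sub_le_of_abs_deriv_le {f f' : ℝ → ℝ} {s : Set ℝ} {C : ℝ} (hs : Convex ℝ s)
    (hf : ∀ φ, HasDerivAt f (f' φ) φ) (hC : ∀ φ ∈ s, |f' φ| ≤ C) {φ φ' : ℝ} (hφ : φ ∈ s)
    (hφ' : φ' ∈ s) : |f φ - f φ'| ≤ C * |φ - φ'| :=
  hs.norm_image_sub_le_of_norm_hasDerivWithin_le (fun ψ _ => (hf ψ).hasDerivWithinAt) hC hφ' hφ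

namespace PeakModel

variable (G : PeakModel) {x φ φ' : ℝ}

lemma abs_rescaled_le (hx : x ∈ Set.Icc G.l G.u) (hφ : φ ∈ Set.Icc G.l G.u) :
    |(x - φ) / G.σ| ≤ G.R := by
  rw [abs_div, abs_of_pos G.σ_pos]
  exact div_le_div_of_nonneg_right (Real.dist_le_of_mem_Icc hx hφ) G.σ_pos.le

lemma abs_mul_bump_mul_le {b B : ℝ} (h : |b| ≤ B) (x φ : ℝ) :
    |G.α * bump G.σ x φ * b| ≤ G.α * bump G.σ x φ * B := by
  rw [abs_mul, abs_of_pos (G.mul_bump_pos x φ)]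
  exact mul_le_mul_of_nonneg_left h (G.mul_bump_pos x φ).le

lemma abs_q₁_le (hx : x ∈ Set.Icc G.l G.u) (hφ : φ ∈ Set.Icc G.l G.u) :
    |G.q₁ x φ| ≤ G.α * bump G.σ x φ * (G.R / G.σ) := by
  refine G.abs_mul_bump_mul_le ?_ x φ
  rw [abs_div _ G.σ, abs_of_pos G.σ_pos]
  exact div_le_div_of_nonneg_right (G.abs_rescaled_le hx hφ) G.σ_pos.le

lemma abs_q₂_le (hR : 2 ≤ G.R) (hx : x ∈ Set.Icc G.l G.u) (hφ : φ ∈ Set.Icc G.l G.u) :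
    |G.q₂ x φ| ≤ G.α * bump G.σ x φ * (G.R ^ 2 / G.σ ^ 2) := by
  refine G.abs_mul_bump_mul_le ?_ x φ
  have hsq := sq_le_sq.mpr ((G.abs_rescaled_le hx hφ).trans (le_abs_self _))
  rw [abs_div, abs_of_pos (pow_pos G.σ_pos 2)]
  refine div_le_div_of_nonneg_right (abs_le.mpr ⟨?_, ?_⟩) (pow_pos G.σ_pos 2).le
  · nlinarith [sq_nonneg ((x - φ) / G.σ)]
  · linarith

lemma abs_q₃_le (hR : 2 ≤ G.R) (hx : x ∈ Set.Icc G.l G.u) (hφ : φ ∈ Set.Icc G.l G.u) :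
    |G.q₃ x φ| ≤ G.α * bump G.σ x φ * (2 * G.R ^ 3 / G.σ ^ 3) := by
  refine G.abs_mul_bump_mul_le ?_ x φ
  have hy := G.abs_rescaled_le hx hφ
  rw [abs_div, abs_of_pos (pow_pos G.σ_pos 3)]
  refine div_le_div_of_nonneg_right ?_ (pow_pos G.σ_pos 3).le
  calc |((x - φ) / G.σ) ^ 3 - 3 * ((x - φ) / G.σ)|
      ≤ |(x - φ) / G.σ| ^ 3 + 3 * |(x - φ) / G.σ| := by
        refine (abs_sub _ _).trans_eq ?_
        rw [abs_pow, abs_mul, abs_of_pos (by norm_num : (0 : ℝ) < 3)]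
    _ ≤ G.R ^ 3 + 3 * G.R := by gcongr
    _ ≤ 2 * G.R ^ 3 := by nlinarith [mul_self_nonneg (G.R - 2)]

lemma abs_div_q_le {a B : ℝ} (hB : 0 ≤ B) (h : |a| ≤ G.α * bump G.σ x φ * B) :
    |a / G.q x φ| ≤ B := by
  rw [abs_div, abs_of_pos (G.q_pos x φ), div_le_iff₀' (G.q_pos x φ)]
  exact h.trans (mul_le_mul_of_nonneg_right (le_add_of_nonneg_right G.β_pos.le) hB)

lemma abs_q₁_div_q_le (hx : x ∈ Set.Icc G.l G.u) (hφ : φ ∈ Set.Icc G.l G.u) :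
    |G.q₁ x φ / G.q x φ| ≤ G.R / G.σ :=
  G.abs_div_q_le (div_pos G.R_pos G.σ_pos).le (G.abs_q₁_le hx hφ)

lemma abs_q₂_div_q_le (hR : 2 ≤ G.R) (hx : x ∈ Set.Icc G.l G.u) (hφ : φ ∈ Set.Icc G.l G.u) :
    |G.q₂ x φ / G.q x φ| ≤ G.R ^ 2 / G.σ ^ 2 :=
  G.abs_div_q_le (by positivity) (G.abs_q₂_le hR hx hφ)

lemma abs_q₃_div_q_le (hR : 2 ≤ G.R) (hx : x ∈ Set.Icc G.l G.u) (hφ : φ ∈ Set.Icc G.l G.u) :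
    |G.q₃ x φ / G.q x φ| ≤ 2 * G.R ^ 3 / G.σ ^ 3 := by
  have := G.R_pos
  have hσ := G.σ_pos
  exact G.abs_div_q_le (by positivity) (G.abs_q₃_le hR hx hφ)

lemma abs_sub_div_Z_le (hR : 2 ≤ G.R) (hφ : φ ∈ Set.Icc G.l G.u) {f : ℝ → ℝ} {B : ℝ}
    (hB : 0 ≤ B) (h : ∀ x ∈ Set.Icc G.l G.u, |f x| ≤ G.α * bump G.σ x φ * B) :
    |(f G.l - f G.u) / G.Z φ| ≤ 4 * B / G.σ := by
  have hα := G.α_pos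
  have hσ := G.σ_pos
  have hend : ∀ x ∈ Set.Icc G.l G.u, |f x| ≤ G.α * B := fun x hx =>
    (h x hx).trans (mul_le_mul_of_nonneg_right (G.mul_bump_le x φ) hB)
  have hsub : |f G.l - f G.u| ≤ 2 * (G.α * B) := by
    linarith [abs_sub (f G.l) (f G.u), hend _ (Set.left_mem_Icc.mpr G.l_lt_u.le),
      hend _ (Set.right_mem_Icc.mpr G.l_lt_u.le)]
  have hZ : G.α * G.σ / 2 ≤ G.Z φ := by
    linarith [G.le_Z hR hφ, mul_pos G.β_pos (sub_pos.mpr G.l_lt_u)]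
  rw [abs_div, abs_of_pos (G.Z_pos φ)]
  calc _ ≤ 2 * (G.α * B) / (G.α * G.σ / 2) := div_le_div₀ (by positivity) hsub (by positivity) hZ
    _ = 4 * B / G.σ := by field_simp; ring

lemma abs_Z₁_div_Z_le (hR : 2 ≤ G.R) (hφ : φ ∈ Set.Icc G.l G.u) :
    |G.Z₁ φ / G.Z φ| ≤ 4 / G.σ := by
  have hZ₁ : G.Z₁ φ = G.α * bump G.σ G.l φ - G.α * bump G.σ G.u φ := by
    simp only [Z₁, q, add_sub_add_right_eq_sub]
  rw [hZ₁]
  simpa using G.abs_sub_div_Z_le hR hφ (f := fun x => G.α * bump G.σ x φ) zero_le_one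
    fun x _ => by rw [abs_of_pos (G.mul_bump_pos x φ), mul_one]

lemma abs_Z₂_div_Z_le (hR : 2 ≤ G.R) (hφ : φ ∈ Set.Icc G.l G.u) :
    |G.Z₂ φ / G.Z φ| ≤ 4 * G.R / G.σ ^ 2 := by
  refine (G.abs_sub_div_Z_le hR hφ (div_pos G.R_pos G.σ_pos).le
    fun x hx => G.abs_q₁_le hx hφ).trans_eq ?_
  rw [mul_div_assoc', div_div, sq]

lemma abs_Z₃_div_Z_le (hR : 2 ≤ G.R) (hφ : φ ∈ Set.Icc G.l G.u) :
    |G.Z₃ φ / G.Z φ| ≤ 4 * G.R ^ 2 / G.σ ^ 3 := by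
  refine (G.abs_sub_div_Z_le hR hφ (by positivity) fun x hx => G.abs_q₂_le hR hx hφ).trans_eq ?_
  rw [mul_div_assoc', div_div, pow_succ G.σ 2]

lemma abs_m₁_le (hR : 8 ≤ G.R) (hx : x ∈ Set.Icc G.l G.u) (hφ : φ ∈ Set.Icc G.l G.u) :
    |G.m₁ x φ| ≤ 2 * G.R / G.σ := by
  have hσ := G.σ_pos
  calc |G.m₁ x φ| ≤ G.R / G.σ + 4 / G.σ := (abs_sub _ _).trans
        (add_le_add (G.abs_q₁_div_q_le hx hφ) (G.abs_Z₁_div_Z_le (by linarith) hφ))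
    _ = (G.R + 4) / G.σ := by ring
    _ ≤ 2 * G.R / G.σ := by gcongr; linarith

lemma abs_m₂_le (hR : 8 ≤ G.R) (hx : x ∈ Set.Icc G.l G.u) (hφ : φ ∈ Set.Icc G.l G.u) :
    |G.m₂ x φ| ≤ 3 * G.R ^ 2 / G.σ ^ 2 := by
  have hσ := G.σ_pos
  have hR₂ : 2 ≤ G.R := by linarith
  have hq := pow_le_pow_left₀ (abs_nonneg _) (G.abs_q₁_div_q_le hx hφ) 2
  have hZ := pow_le_pow_left₀ (abs_nonneg _) (G.abs_Z₁_div_Z_le hR₂ hφ) 2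
  rw [← abs_pow] at hq hZ
  calc |G.m₂ x φ| ≤ (G.R ^ 2 / G.σ ^ 2 + (G.R / G.σ) ^ 2) +
        (4 * G.R / G.σ ^ 2 + (4 / G.σ) ^ 2) :=
        (abs_sub _ _).trans (add_le_add
          ((abs_sub _ _).trans (add_le_add (G.abs_q₂_div_q_le hR₂ hx hφ) hq))
          ((abs_sub _ _).trans (add_le_add (G.abs_Z₂_div_Z_le hR₂ hφ) hZ)))
    _ = (2 * G.R ^ 2 + 4 * G.R + 16) / G.σ ^ 2 := by field_simp; ring
    _ ≤ 3 * G.R ^ 2 / G.σ ^ 2 := by gcongr; nlinarith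

lemma abs_m₃_le (hR : 8 ≤ G.R) (hx : x ∈ Set.Icc G.l G.u) (hφ : φ ∈ Set.Icc G.l G.u) :
    |G.m₃ x φ| ≤ 9 * G.R ^ 3 / G.σ ^ 3 := by
  have hσ := G.σ_pos
  have hR₂ : 2 ≤ G.R := by linarith
  have hsq : 8 * G.R ≤ G.R ^ 2 := by nlinarith
  have hcube : 8 * G.R ^ 2 ≤ G.R ^ 3 := by nlinarith [sq_nonneg G.R]
  calc |G.m₃ x φ| ≤ (2 * G.R ^ 3 / G.σ ^ 3 + 3 * (G.R ^ 2 / G.σ ^ 2 * (G.R / G.σ)) +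
          2 * (G.R / G.σ) ^ 3) + (4 * G.R ^ 2 / G.σ ^ 3 +
          3 * (4 * G.R / G.σ ^ 2 * (4 / G.σ)) + 2 * (4 / G.σ) ^ 3) :=
        (abs_sub _ _).trans (add_le_add
          (abs_third_logDeriv_le (G.abs_q₁_div_q_le hx hφ) (G.abs_q₂_div_q_le hR₂ hx hφ)
            (G.abs_q₃_div_q_le hR₂ hx hφ))
          (abs_third_logDeriv_le (G.abs_Z₁_div_Z_le hR₂ hφ) (G.abs_Z₂_div_Z_le hR₂ hφ)
            (G.abs_Z₃_div_Z_le hR₂ hφ)))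
    _ = (7 * G.R ^ 3 + 4 * G.R ^ 2 + 48 * G.R + 128) / G.σ ^ 3 := by field_simp; ring
    _ ≤ 9 * G.R ^ 3 / G.σ ^ 3 := by gcongr; nlinarith

lemma abs_m_sub_le (hR : 8 ≤ G.R) (hx : x ∈ Set.Icc G.l G.u) (hφ : φ ∈ Set.Icc G.l G.u)
    (hφ' : φ' ∈ Set.Icc G.l G.u) : |G.m x φ - G.m x φ'| ≤ 2 * G.R / G.σ * |φ - φ'| :=
  abs_sub_le_of_abs_deriv_le (convex_Icc _ _) (G.hasDerivAt_m x)
    (fun _ hψ => G.abs_m₁_le hR hx hψ) hφ hφ'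

lemma abs_m₁_sub_le (hR : 8 ≤ G.R) (hx : x ∈ Set.Icc G.l G.u) (hφ : φ ∈ Set.Icc G.l G.u)
    (hφ' : φ' ∈ Set.Icc G.l G.u) : |G.m₁ x φ - G.m₁ x φ'| ≤ 3 * G.R ^ 2 / G.σ ^ 2 * |φ - φ'| :=
  abs_sub_le_of_abs_deriv_le (convex_Icc _ _) (G.hasDerivAt_m₁ x)
    (fun _ hψ => G.abs_m₂_le hR hx hψ) hφ hφ'

lemma abs_m₂_sub_le (hR : 8 ≤ G.R) (hx : x ∈ Set.Icc G.l G.u) (hφ : φ ∈ Set.Icc G.l G.u)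
    (hφ' : φ' ∈ Set.Icc G.l G.u) : |G.m₂ x φ - G.m₂ x φ'| ≤ 9 * G.R ^ 3 / G.σ ^ 3 * |φ - φ'| :=
  abs_sub_le_of_abs_deriv_le (convex_Icc _ _) (G.hasDerivAt_m₂ x)
    (fun _ hψ => G.abs_m₃_le hR hx hψ) hφ hφ'

lemma exists_abs_m_le (hR : 8 ≤ G.R) :
    ∃ B, ∀ x ∈ Set.Icc G.l G.u, ∀ φ ∈ Set.Icc G.l G.u, |G.m x φ| ≤ B := by
  have hl : G.l ∈ Set.Icc G.l G.u := Set.left_mem_Icc.mpr G.l_lt_u.le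
  have hσ := G.σ_pos
  obtain ⟨B, hB⟩ := (isCompact_Icc (a := G.l) (b := G.u)).exists_bound_of_continuousOn
    (G.continuous_m G.l).continuousOn
  refine ⟨2 * G.R / G.σ * (G.u - G.l) + B, fun x hx φ hφ => ?_⟩
  calc |G.m x φ| ≤ |G.m x φ - G.m x G.l| + |G.m x G.l| := by
        simpa only [sub_add_cancel] using abs_add_le (G.m x φ - G.m x G.l) (G.m x G.l)
    _ ≤ _ := add_le_add ((G.abs_m_sub_le hR hx hφ hl).trans ?_) (hB x hx)
  have := G.R_pos
  exact mul_le_mul_of_nonneg_left (Real.dist_le_of_mem_Icc hφ hl) (by positivity)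

end PeakModel

/-- The constant in the lower bounds for the Fisher information and the likelihood gap; `exp (-68)`
is the least value of `exp (-(y ^ 2 + d ^ 2))` for `|y| ≤ 2` and `|d| ≤ 8`. -/
noncomputable def gapConst : ℝ := Real.exp (-68) / 1008

lemma gapConst_pos : 0 < gapConst := div_pos (Real.exp_pos _) (by norm_num)

lemma gapConst_le : gapConst ≤ 1 / 1008 := by
  unfold gapConst
  gcongr
  exact Real.exp_le_one_iff.mpr (by norm_num)

lemma exists_eq_add_mul {σ θ a b x : ℝ} (hσ : 0 < σ)
    (hx : x ∈ Set.Icc (θ + a * σ) (θ + b * σ)) : ∃ y ∈ Set.Icc a b, x = θ + y * σ := by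
  refine ⟨(x - θ) / σ, ⟨?_, ?_⟩, ?_⟩
  · rw [le_div_iff₀ hσ]
    linarith [hx.1]
  · rw [div_le_iff₀ hσ]
    linarith [hx.2]
  · rw [div_mul_cancel₀ _ hσ.ne']
    ring

lemma sq_sub_div_le_mul_log {a b : ℝ} (ha : 0 < a) (hb : 0 < b) :
    (a - b) ^ 2 / (2 * (a + b)) ≤ a * (Real.log a - Real.log b) - a + b := by
  obtain ⟨r, hr, rfl⟩ : ∃ r, 0 < r ∧ a = r ^ 2 :=
    ⟨√a, Real.sqrt_pos.mpr ha, (Real.sq_sqrt ha.le).symm⟩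
  obtain ⟨s, hs, rfl⟩ : ∃ s, 0 < s ∧ b = s ^ 2 :=
    ⟨√b, Real.sqrt_pos.mpr hb, (Real.sq_sqrt hb.le).symm⟩
  have hlog : r ^ 2 * (Real.log s - Real.log r) ≤ r * s - r ^ 2 := by
    rw [← Real.log_div hs.ne' hr.ne']
    calc r ^ 2 * Real.log (s / r) ≤ r ^ 2 * (s / r - 1) := by
          gcongr
          exact Real.log_le_sub_one_of_pos (div_pos hs hr)
      _ = r * s - r ^ 2 := by field_simp
  calc (r ^ 2 - s ^ 2) ^ 2 / (2 * (r ^ 2 + s ^ 2)) ≤ (r - s) ^ 2 := by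
        rw [div_le_iff₀ (by positivity)]
        nlinarith [sq_nonneg ((r - s) ^ 2)]
    _ ≤ r ^ 2 * (Real.log (r ^ 2) - Real.log (s ^ 2)) - r ^ 2 + s ^ 2 := by
        rw [Real.log_pow, Real.log_pow]
        push_cast
        linarith

lemma sq_le_sq_exp_sub_exp_neg (t : ℝ) : t ^ 2 ≤ (Real.exp t - Real.exp (-t)) ^ 2 := by
  have of_nonneg : ∀ s : ℝ, 0 ≤ s → s ^ 2 ≤ (Real.exp s - Real.exp (-s)) ^ 2 := fun s hs => by
    have hneg : Real.exp (-s) ≤ 1 := Real.exp_le_one_iff.mpr (by linarith)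
    exact pow_le_pow_left₀ hs (by linarith [Real.add_one_le_exp s]) 2
  rcases le_total 0 t with h | h
  · exact of_nonneg t h
  · simpa only [neg_neg, neg_sq, sub_sq_comm] using of_nonneg (-t) (by linarith)

lemma exp_mul_sq_le_sq_exp_sub_exp {y d : ℝ} (hy : y ∈ Set.Icc 1 2) (hd : |d| ≤ 8) :
    Real.exp (-68) * d ^ 2 ≤ (Real.exp (-(y - d) ^ 2 / 2) - Real.exp (-(-y - d) ^ 2 / 2)) ^ 2 := by
  have hfactor : Real.exp (-(y - d) ^ 2 / 2) - Real.exp (-(-y - d) ^ 2 / 2) =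
      Real.exp (-(y ^ 2 + d ^ 2) / 2) * (Real.exp (y * d) - Real.exp (-(y * d))) := by
    rw [mul_sub, ← Real.exp_add, ← Real.exp_add]
    ring_nf
  rw [hfactor, mul_pow]
  have hexp : Real.exp (-68) ≤ Real.exp (-(y ^ 2 + d ^ 2) / 2) ^ 2 := by
    rw [← Real.exp_nat_mul]
    have hd2 : d ^ 2 ≤ 8 ^ 2 := sq_le_sq' (abs_le.mp hd).1 (abs_le.mp hd).2
    refine Real.exp_le_exp.mpr ?_
    push_cast
    nlinarith [hy.1, hy.2]
  have hsinh : d ^ 2 ≤ (Real.exp (y * d) - Real.exp (-(y * d))) ^ 2 :=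
    calc d ^ 2 ≤ (y * d) ^ 2 := by
          rw [mul_pow]
          exact le_mul_of_one_le_left (sq_nonneg d) (one_le_pow₀ hy.1)
      _ ≤ _ := sq_le_sq_exp_sub_exp_neg (y * d)
  gcongr

lemma exp_neg_nat_le {n : ℕ} {t c : ℝ} (ht : t ≤ -n) (hc : c ≤ 2 ^ n) (hc₀ : 0 < c) :
    Real.exp t ≤ 1 / c :=
  calc Real.exp t ≤ Real.exp (-n) := Real.exp_le_exp.mpr ht
    _ = 1 / Real.exp 1 ^ n := by rw [Real.exp_neg, Real.exp_one_pow, one_div]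
    _ ≤ 1 / c := by
      refine one_div_le_one_div_of_le hc₀ (hc.trans ?_)
      exact pow_le_pow_left₀ (by norm_num) (by linarith [Real.add_one_le_exp (1 : ℝ)]) n

lemma exp_neg_sq_le_of_far {z d : ℝ} (hz : z ∈ Set.Icc 0 (5 / 2)) (hd : 8 ≤ |d|) :
    Real.exp (-(z - d) ^ 2 / 2) ≤ 1 / 24 := by
  have hsq : (11 / 2 : ℝ) ^ 2 ≤ (z - d) ^ 2 := by
    rw [sq_le_sq, abs_of_pos (by norm_num : (0 : ℝ) < 11 / 2), le_abs]
    rcases le_abs.mp hd with h | h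
    · right
      linarith [hz.2]
    · left
      linarith [hz.1]
  exact exp_neg_nat_le (n := 5) (by push_cast; linarith) (by norm_num) (by norm_num)

namespace PeakModel

variable (G : PeakModel) {θ φ : ℝ}

/-- The signal-to-noise ratio of the peak: up to absolute constants, and in units of the width of
the peak, it is the Fisher information of the unnormalized model. -/
noncomputable def snr : ℝ := G.σ * G.α ^ 2 / (G.α + G.β)

/-- The possible centres at distance at least `5σ/2` from the ends of the window. -/
def core : Set ℝ := Set.Icc (G.l + 5 / 2 * G.σ) (G.u - 5 / 2 * G.σ)

/-- The Fisher information of the model at the centre `θ`, up to the factor `Z θ`. -/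
noncomputable def fisher (θ : ℝ) : ℝ := ∫ x in G.l..G.u, G.q x θ * G.m₁ x θ ^ 2

/-- The Kullback-Leibler divergence of the model with centre `φ` from the model with centre `θ`,
up to the factor `Z θ`. -/
noncomputable def likelihoodGap (θ φ : ℝ) : ℝ :=
  ∫ x in G.l..G.u, G.q x θ * (G.m x θ - G.m x φ)

lemma snr_pos : 0 < G.snr :=
  div_pos (mul_pos G.σ_pos (pow_pos G.α_pos 2)) (add_pos G.α_pos G.β_pos)

lemma mem_Icc_of_mem_core (hθ : θ ∈ G.core) : θ ∈ Set.Icc G.l G.u :=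
  ⟨by linarith [hθ.1, G.σ_pos], by linarith [hθ.2, G.σ_pos]⟩

lemma two_le_R_of_mem_core (hθ : θ ∈ G.core) : 2 ≤ G.R := by
  rw [R, le_div_iff₀ G.σ_pos]
  linarith [hθ.1, hθ.2, G.σ_pos]

lemma le_q₁ {x : ℝ} (hx : x ∈ Set.Icc (θ + 1 * G.σ) (θ + 2 * G.σ)) :
    G.α * Real.exp (-2) / G.σ ≤ G.q₁ x θ := by
  have hσ := G.σ_pos
  obtain ⟨y, hy, rfl⟩ := exists_eq_add_mul hσ hx
  have hexp : Real.exp (-2) ≤ Real.exp (-y ^ 2 / 2) :=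
    Real.exp_le_exp.mpr (by nlinarith [hy.1, hy.2])
  rw [q₁, bump_add_mul_self hσ, add_sub_cancel_left, mul_div_cancel_right₀ _ hσ.ne', mul_div_assoc',
    div_le_div_iff_of_pos_right hσ]
  calc G.α * Real.exp (-2) = G.α * Real.exp (-2) * 1 := (mul_one _).symm
    _ ≤ G.α * Real.exp (-y ^ 2 / 2) * y :=
        mul_le_mul (mul_le_mul_of_nonneg_left hexp G.α_pos.le) hy.1 zero_le_one
          (mul_pos G.α_pos (Real.exp_pos _)).le

lemma le_m₁_sq_add_m₁_reflect_sq (x θ : ℝ) :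
    2 * (G.q₁ x θ / G.q x θ) ^ 2 ≤ G.m₁ x θ ^ 2 + G.m₁ (2 * θ - x) θ ^ 2 := by
  rw [m₁, m₁, G.q_reflect, G.q₁_reflect, neg_div]
  nlinarith [sq_nonneg (G.Z₁ θ / G.Z θ)]

lemma gapConst_mul_snr_le_fisher (hθ : θ ∈ G.core) : gapConst * G.snr / G.σ ^ 2 ≤ G.fisher θ := by
  have hσ := G.σ_pos
  have hα := G.α_pos
  have hβ := G.β_pos
  have hc : Continuous fun x => G.q x θ * G.m₁ x θ ^ 2 :=
    (G.continuous_q _).mul ((G.continuous_m₁ _).pow 2)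
  set κ : ℝ := 2 * (G.α * Real.exp (-2) / G.σ) ^ 2 / (G.α + G.β) with hκ
  have hconst : gapConst ≤ 2 * Real.exp (-2) ^ 2 := by
    have : Real.exp (-68) ≤ Real.exp (-2) ^ 2 := by
      rw [← Real.exp_nat_mul]
      exact Real.exp_le_exp.mpr (by norm_num)
    unfold gapConst
    linarith [Real.exp_pos (-68)]
  calc gapConst * G.snr / G.σ ^ 2 ≤ 2 * Real.exp (-2) ^ 2 * G.snr / G.σ ^ 2 := by
        have := G.snr_pos
        gcongr
    _ = (2 * G.σ - 1 * G.σ) * κ := by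
        rw [hκ, snr]
        field_simp
        ring
    _ ≤ G.fisher θ := by
        refine le_integral_of_le_add_reflect (θ := θ) hc
          (fun x => mul_nonneg (G.q_pos x θ).le (sq_nonneg _)) (by linarith) (by linarith)
          (by linarith [hθ.1]) (by linarith [hθ.2]) fun x hx => ?_
        have hq := G.q_pos x θ
        calc κ ≤ 2 * G.q₁ x θ ^ 2 / G.q x θ :=
              div_le_div₀ (by positivity) (by gcongr; exact G.le_q₁ hx) hq (G.q_le x θ)
          _ = G.q x θ * (2 * (G.q₁ x θ / G.q x θ) ^ 2) := by field_simp
          _ ≤ G.q x θ * (G.m₁ x θ ^ 2 + G.m₁ (2 * θ - x) θ ^ 2) :=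
              mul_le_mul_of_nonneg_left (G.le_m₁_sq_add_m₁_reflect_sq x θ) hq.le
          _ = _ := by rw [G.q_reflect, mul_add]

lemma fisher_pos (hθ : θ ∈ G.core) : 0 < G.fisher θ :=
  (div_pos (mul_pos gapConst_pos G.snr_pos) (pow_pos G.σ_pos 2)).trans_le
    (G.gapConst_mul_snr_le_fisher hθ)

lemma q_mul_m₂_add_q_mul_m₁_sq (x θ : ℝ) :
    G.q x θ * G.m₂ x θ + G.q x θ * G.m₁ x θ ^ 2 = G.q₂ x θ - 2 * (G.Z₁ θ / G.Z θ) * G.q₁ x θ +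
      (2 * (G.Z₁ θ / G.Z θ) ^ 2 - G.Z₂ θ / G.Z θ) * G.q x θ := by
  have hq := (G.q_pos x θ).ne'
  unfold m₁ m₂
  field_simp
  ring

lemma integral_q_mul_m₂ (θ : ℝ) : ∫ x in G.l..G.u, G.q x θ * G.m₂ x θ = -G.fisher θ := by
  have hZ := (G.Z_pos θ).ne'
  have hi : ∀ {f : ℝ → ℝ}, Continuous f → IntervalIntegrable f volume G.l G.u :=
    fun hf => hf.intervalIntegrable _ _
  have i₀ := hi (G.continuous_q θ)
  have i₁ := hi (G.continuous_q₁ θ)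
  have i₂ := hi (G.continuous_q₂ θ)
  have i₀₂ : IntervalIntegrable (fun x => G.q x θ * G.m₂ x θ) volume G.l G.u :=
    hi ((G.continuous_q θ).mul (G.continuous_m₂ θ))
  have i₀₁ : IntervalIntegrable (fun x => G.q x θ * G.m₁ x θ ^ 2) volume G.l G.u :=
    hi ((G.continuous_q θ).mul ((G.continuous_m₁ θ).pow 2))
  rw [fisher, eq_neg_iff_add_eq_zero, ← intervalIntegral.integral_add i₀₂ i₀₁]
  simp only [q_mul_m₂_add_q_mul_m₁_sq]
  rw [intervalIntegral.integral_add (i₂.sub (i₁.const_mul _)) (i₀.const_mul _),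
    intervalIntegral.integral_sub i₂ (i₁.const_mul _), intervalIntegral.integral_const_mul,
    intervalIntegral.integral_const_mul, G.integral_q₁, G.integral_q₂, ← Z]
  field_simp
  ring

/-- The ratio of the masses of the models with centres `θ` and `φ`. -/
noncomputable def massRatio (θ φ : ℝ) : ℝ := G.Z θ / G.Z φ

lemma massRatio_pos (θ φ : ℝ) : 0 < G.massRatio θ φ := div_pos (G.Z_pos θ) (G.Z_pos φ)

lemma massRatio_le_six (hR : 2 ≤ G.R) (hφ : φ ∈ Set.Icc G.l G.u) : G.massRatio θ φ ≤ 6 :=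
  (div_le_iff₀ (G.Z_pos φ)).mpr (G.Z_le_six_mul_Z hR hφ)

lemma one_div_six_le_massRatio (hR : 2 ≤ G.R) (hθ : θ ∈ Set.Icc G.l G.u) :
    1 / 6 ≤ G.massRatio θ φ := by
  rw [massRatio, le_div_iff₀ (G.Z_pos φ)]
  linarith [G.Z_le_six_mul_Z (φ := φ) hR hθ]

lemma m_sub_m_eq (x θ φ : ℝ) :
    G.m x θ - G.m x φ = Real.log (G.q x θ) - Real.log (G.massRatio θ φ * G.q x φ) := by
  rw [Real.log_mul (G.massRatio_pos θ φ).ne' (G.q_pos x φ).ne', massRatio,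
    Real.log_div (G.Z_pos θ).ne' (G.Z_pos φ).ne', m, m]
  ring

lemma integral_sq_div_le_likelihoodGap (hR : 2 ≤ G.R) (hφ : φ ∈ Set.Icc G.l G.u) :
    (∫ x in G.l..G.u, (G.q x θ - G.massRatio θ φ * G.q x φ) ^ 2) / (14 * (G.α + G.β)) ≤
      G.likelihoodGap θ φ := by
  set k := G.massRatio θ φ with hk
  have := add_pos G.α_pos G.β_pos
  have cθ := G.continuous_q θ
  have cφ := G.continuous_q φ
  have iθ := cθ.intervalIntegrable (μ := volume) G.l G.u
  have iφ := (cφ.const_mul k).intervalIntegrable (μ := volume) G.l G.u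
  have im : IntervalIntegrable (fun x => G.q x θ * (G.m x θ - G.m x φ)) volume G.l G.u :=
    (cθ.mul ((G.continuous_m θ).sub (G.continuous_m φ))).intervalIntegrable _ _
  have hmass : ∫ x in G.l..G.u, k * G.q x φ = ∫ x in G.l..G.u, G.q x θ := by
    rw [intervalIntegral.integral_const_mul, ← Z, ← Z, hk, massRatio,
      div_mul_cancel₀ _ (G.Z_pos φ).ne']
  have hgap : G.likelihoodGap θ φ =
      ∫ x in G.l..G.u, (G.q x θ * (G.m x θ - G.m x φ) - G.q x θ + k * G.q x φ) := by
    rw [intervalIntegral.integral_add (im.sub iθ) iφ, intervalIntegral.integral_sub im iθ, hmass,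
      sub_add_cancel, likelihoodGap]
  rw [hgap, ← intervalIntegral.integral_div]
  have cw : Continuous fun x => (G.q x θ - k * G.q x φ) ^ 2 / (14 * (G.α + G.β)) := by fun_prop
  refine intervalIntegral.integral_mono_on G.l_lt_u.le (cw.intervalIntegrable _ _)
    ((im.sub iθ).add iφ) fun x _ => ?_
  have hq := G.q_pos x θ
  have hkq := mul_pos (G.massRatio_pos θ φ) (G.q_pos x φ)
  rw [G.m_sub_m_eq]
  refine le_trans ?_ (sq_sub_div_le_mul_log hq hkq)
  refine div_le_div_of_nonneg_left (sq_nonneg _) (by positivity) ?_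
  have hkq_le : k * G.q x φ ≤ 6 * (G.α + G.β) :=
    mul_le_mul (G.massRatio_le_six hR hφ) (G.q_le x φ) (G.q_pos x φ).le (by norm_num)
  linarith [G.q_le x θ]

lemma le_sq_add_reflect_sq {x d k : ℝ} (hx : x ∈ Set.Icc (θ + 1 * G.σ) (θ + 2 * G.σ))
    (hd : |d| ≤ 8) (hk : 1 / 6 ≤ k) :
    G.α ^ 2 * (Real.exp (-68) * d ^ 2) / 72 ≤ (G.q x θ - k * G.q x (θ + d * G.σ)) ^ 2 +
      (G.q (2 * θ - x) θ - k * G.q (2 * θ - x) (θ + d * G.σ)) ^ 2 := by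
  obtain ⟨y, hy, rfl⟩ := exists_eq_add_mul G.σ_pos hx
  have hy' : 2 * θ - (θ + y * G.σ) = θ + -y * G.σ := by ring
  rw [G.q_reflect, hy']
  simp only [q, bump_add_mul G.σ_pos θ _ d]
  set s := Real.exp (-(y - d) ^ 2 / 2)
  set t := Real.exp (-(-y - d) ^ 2 / 2)
  set a := G.α * bump G.σ (θ + y * G.σ) θ + G.β
  have hst : Real.exp (-68) * d ^ 2 ≤ (s - t) ^ 2 := exp_mul_sq_le_sq_exp_sub_exp hy hd
  calc G.α ^ 2 * (Real.exp (-68) * d ^ 2) / 72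
      = (1 / 6) ^ 2 * (G.α ^ 2 * (Real.exp (-68) * d ^ 2)) / 2 := by ring
    _ ≤ k ^ 2 * (G.α ^ 2 * (s - t) ^ 2) / 2 := by gcongr
    _ ≤ _ := by nlinarith [sq_nonneg ((a - k * (G.α * s + G.β)) + (a - k * (G.α * t + G.β)))]

lemma le_likelihoodGap_of_near {d : ℝ} (hθ : θ ∈ G.core) (hφ : θ + d * G.σ ∈ Set.Icc G.l G.u)
    (hd : |d| ≤ 8) : gapConst * G.snr * d ^ 2 ≤ G.likelihoodGap θ (θ + d * G.σ) := by
  have hσ := G.σ_pos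
  have hsum := add_pos G.α_pos G.β_pos
  have hR := G.two_le_R_of_mem_core hθ
  have hk : 1 / 6 ≤ G.massRatio θ (θ + d * G.σ) :=
    G.one_div_six_le_massRatio hR (G.mem_Icc_of_mem_core hθ)
  have cθ := G.continuous_q θ
  have cφ := G.continuous_q (θ + d * G.σ)
  calc gapConst * G.snr * d ^ 2
      = (2 * G.σ - 1 * G.σ) * (G.α ^ 2 * (Real.exp (-68) * d ^ 2) / 72) /
          (14 * (G.α + G.β)) := by
        unfold gapConst snr
        field_simp
        ring
    _ ≤ _ := by
        gcongr
        exact le_integral_of_le_add_reflect (by fun_prop) (fun x => sq_nonneg _) (by linarith)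
          (by linarith) (by linarith [hθ.1]) (by linarith [hθ.2])
          fun x hx => G.le_sq_add_reflect_sq hx hd hk
    _ ≤ _ := G.integral_sq_div_le_likelihoodGap hR hφ

lemma le_sq_add_shift_sq {x d k : ℝ} (hx : x ∈ Set.Icc (θ + 0 * G.σ) (θ + 1 / 2 * G.σ))
    (hd : 8 ≤ |d|) (hk₀ : 0 < k) (hk : k ≤ 6) :
    G.α ^ 2 / 16 ≤ (G.q x θ - k * G.q x (θ + d * G.σ)) ^ 2 +
      (G.q (x + 2 * G.σ) θ - k * G.q (x + 2 * G.σ) (θ + d * G.σ)) ^ 2 := by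
  obtain ⟨y, hy, rfl⟩ := exists_eq_add_mul G.σ_pos hx
  have hy₀ : 0 ≤ y := hy.1
  have hy₁ : y ≤ 1 / 2 := hy.2
  have hshift : θ + y * G.σ + 2 * G.σ = θ + (y + 2) * G.σ := by ring
  rw [hshift]
  simp only [q, bump_add_mul G.σ_pos θ _ d, bump_add_mul_self G.σ_pos θ]
  set s := Real.exp (-y ^ 2 / 2)
  set s' := Real.exp (-(y + 2) ^ 2 / 2)
  set t := Real.exp (-(y - d) ^ 2 / 2)
  set t' := Real.exp (-(y + 2 - d) ^ 2 / 2)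
  have hs : 7 / 8 ≤ s := le_trans (by nlinarith) (Real.add_one_le_exp (-y ^ 2 / 2))
  have hs' : s' ≤ 1 / 4 :=
    exp_neg_nat_le (n := 2) (by push_cast; nlinarith) (by norm_num) (by norm_num)
  have ht : k * t ≤ 6 * (1 / 24) := mul_le_mul hk
    (exp_neg_sq_le_of_far ⟨hy₀, by linarith⟩ hd) (Real.exp_pos _).le (by norm_num)
  have ht' : 0 < k * t' := mul_pos hk₀ (Real.exp_pos _)
  have hdrop : (G.α * (3 / 8)) ^ 2 ≤ (G.α * (s - s' - k * t + k * t')) ^ 2 := by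
    have hα := G.α_pos
    gcongr
    linarith
  nlinarith [sq_nonneg ((G.α * s + G.β - k * (G.α * t + G.β)) +
    (G.α * s' + G.β - k * (G.α * t' + G.β))), sq_nonneg G.α]

lemma le_likelihoodGap_of_far {d : ℝ} (hθ : θ ∈ G.core) (hφ : θ + d * G.σ ∈ Set.Icc G.l G.u)
    (hd : 8 ≤ |d|) : gapConst * G.snr ≤ G.likelihoodGap θ (θ + d * G.σ) := by
  have hσ := G.σ_pos
  have hα := G.α_pos
  have hsum := add_pos G.α_pos G.β_pos
  have hR := G.two_le_R_of_mem_core hθ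
  have cθ := G.continuous_q θ
  have cφ := G.continuous_q (θ + d * G.σ)
  calc gapConst * G.snr ≤ 1 / 1008 * G.snr := mul_le_mul_of_nonneg_right gapConst_le G.snr_pos.le
    _ ≤ (θ + 1 / 2 * G.σ - (θ + 0 * G.σ)) * (G.α ^ 2 / 16) / (14 * (G.α + G.β)) := by
        rw [snr, mul_div_assoc', div_le_div_iff₀ hsum (by positivity)]
        nlinarith [mul_pos (mul_pos hσ (pow_pos hα 2)) hsum]
    _ ≤ _ := by
        gcongr
        exact le_integral_of_le_add_shift (s := 2 * G.σ) (by fun_prop) (fun x => sq_nonneg _)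
          (by linarith) (by linarith) (by linarith [hθ.1]) (by linarith [hθ.2])
          fun x hx => G.le_sq_add_shift_sq hx hd (G.massRatio_pos _ _) (G.massRatio_le_six hR hφ)
    _ ≤ _ := G.integral_sq_div_le_likelihoodGap hR hφ

lemma le_likelihoodGap (hθ : θ ∈ G.core) (hφ : φ ∈ Set.Icc G.l G.u) :
    gapConst * G.snr * min 1 (((φ - θ) / G.σ) ^ 2) ≤ G.likelihoodGap θ φ := by
  obtain ⟨d, rfl⟩ : ∃ d, φ = θ + d * G.σ :=
    ⟨(φ - θ) / G.σ, by rw [div_mul_cancel₀ _ G.σ_pos.ne']; ring⟩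
  rw [add_sub_cancel_left, mul_div_cancel_right₀ _ G.σ_pos.ne']
  have hpos : 0 ≤ gapConst * G.snr := (mul_pos gapConst_pos G.snr_pos).le
  rcases le_total |d| 8 with hd | hd
  · exact (mul_le_mul_of_nonneg_left (min_le_right _ _) hpos).trans
      (G.le_likelihoodGap_of_near hθ hφ hd)
  · exact (mul_le_of_le_one_right hpos (min_le_left _ _)).trans
      (G.le_likelihoodGap_of_far hθ hφ hd)

end PeakModel

lemma abs_intervalIntegral_le {f : ℝ → ℝ} {l u C : ℝ} (hlu : l ≤ u)
    (h : ∀ x ∈ Set.Icc l u, |f x| ≤ C) : |∫ x in l..u, f x| ≤ C * (u - l) := by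
  have hle : ‖∫ x in l..u, f x‖ ≤ C * |u - l| :=
    intervalIntegral.norm_integral_le_of_norm_le_const fun x hx =>
      h x (Set.Ioc_subset_Icc_self (Set.uIoc_of_le hlu ▸ hx))
  rwa [Real.norm_eq_abs, abs_of_nonneg (sub_nonneg.mpr hlu)] at hle

lemma strictConcaveOn_of_hasDerivAt_of_neg {f f' f'' : ℝ → ℝ} {s : Set ℝ} (hs : Convex ℝ s)
    (hf : ∀ x ∈ s, HasDerivAt f (f' x) x) (hf' : ∀ x ∈ s, HasDerivAt f' (f'' x) x)
    (hneg : ∀ x ∈ s, f'' x < 0) : StrictConcaveOn ℝ s f := by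
  have hanti : StrictAntiOn f' s := strictAntiOn_of_deriv_neg hs
    (fun x hx => (hf' x hx).continuousAt.continuousWithinAt) fun x hx => by
      rw [(hf' x (interior_subset hx)).deriv]
      exact hneg x (interior_subset hx)
  refine StrictAntiOn.strictConcaveOn_of_deriv hs
    (fun x hx => (hf x hx).continuousAt.continuousWithinAt) fun x hx y hy hxy => ?_
  rw [(hf x (interior_subset hx)).deriv, (hf y (interior_subset hy)).deriv]
  exact hanti (interior_subset hx) (interior_subset hy) hxy

lemma exists_forall_lt_of_strictConcaveOn {f : ℝ → ℝ} {s K : Set ℝ} (hK : IsCompact K)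
    (hne : K.Nonempty) (hf : ContinuousOn f K) (hsK : s ⊆ K) (hconc : StrictConcaveOn ℝ s f)
    (hmem : ∀ x ∈ K, IsMaxOn f K x → x ∈ s) :
    ∃ x ∈ s, ∀ y ∈ K, y ≠ x → f y < f x := by
  obtain ⟨x, hxK, hx⟩ := hK.exists_isMaxOn hne hf
  refine ⟨x, hmem x hxK hx, fun y hyK hyx => (hx hyK).lt_of_ne fun hyx' => hyx ?_⟩
  have hy : IsMaxOn f K y := fun z hz => (hx hz).trans_eq hyx'.symm
  exact hconc.eq_of_isMaxOn (hy.on_subset hsK) (hx.on_subset hsK) (hmem y hyK hy) (hmem x hxK hx)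

lemma le_div_of_mul_min_one_sq_le {a c y R : ℝ} (hc : 0 < c) (ha : 0 ≤ a) (haR : a * R < c)
    (hy : 0 ≤ y) (hyR : y ≤ R) (h : c * min 1 (y ^ 2) ≤ a * y) : y ≤ a / c := by
  rw [le_div_iff₀ hc]
  rcases le_total 1 (y ^ 2) with h1 | h1
  · rw [min_eq_left h1] at h
    linarith [mul_le_mul_of_nonneg_left hyR ha]
  · rw [min_eq_right h1] at h
    rcases hy.eq_or_lt with rfl | hy'
    · simpa only [zero_mul] using ha
    · exact le_of_mul_le_mul_right (by linarith) hy'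

section WindowMeasure

/-- The probability measure on `D` with unnormalized density `p`. -/
noncomputable def windowMeasure (D : Set ℝ) (p : ℝ → ℝ) : Measure ℝ :=
  (volume.restrict D).withDensity fun x => ENNReal.ofReal (p x / ∫ y in D, p y)

variable {D : Set ℝ} {p : ℝ → ℝ}

lemma ae_windowMeasure_mem (hD : MeasurableSet D) (p : ℝ → ℝ) : ∀ᵐ x ∂(windowMeasure D p), x ∈ D :=
  (withDensity_absolutelyContinuous _ _).ae_le (ae_restrict_mem hD)

lemma integral_windowMeasure (hD : MeasurableSet D) (hm : Measurable p) (hp : ∀ x ∈ D, 0 ≤ p x)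
    (h : ℝ → ℝ) : ∫ x, h x ∂(windowMeasure D p) = (∫ x in D, p x * h x) / ∫ x in D, p x := by
  have hmass : 0 ≤ ∫ x in D, p x := setIntegral_nonneg hD hp
  rw [windowMeasure,
    integral_withDensity_eq_integral_toReal_smul (hm.div_const _).ennreal_ofReal (by simp),
    ← integral_div]
  refine setIntegral_congr_fun hD fun x hx => ?_
  simp only [smul_eq_mul]
  rw [ENNReal.toReal_ofReal (div_nonneg (hp x hx) hmass), div_mul_eq_mul_div]

lemma isProbabilityMeasure_windowMeasure (hD : MeasurableSet D) (hi : IntegrableOn p D)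
    (hp : ∀ x ∈ D, 0 ≤ p x) (hpos : 0 < ∫ x in D, p x) :
    IsProbabilityMeasure (windowMeasure D p) := by
  constructor
  rw [windowMeasure, withDensity_apply _ MeasurableSet.univ, Measure.restrict_univ,
    ← ofReal_integral_eq_lintegral_ofReal (hi.div_const _)
      ((ae_restrict_mem hD).mono fun x hx => div_nonneg (hp x hx) hpos.le),
    integral_div, div_self hpos.ne', ENNReal.ofReal_one]

end WindowMeasure

namespace PeakModel

variable (G : PeakModel)

lemma setIntegral_Icc (f : ℝ → ℝ) : ∫ x in Set.Icc G.l G.u, f x = ∫ x in G.l..G.u, f x := by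
  rw [integral_Icc_eq_integral_Ioc, intervalIntegral.integral_of_le G.l_lt_u.le]

/-- The expected log-likelihood of the centre `φ` under the unnormalized density `p`. -/
noncomputable def meanLogLik (p : ℝ → ℝ) (φ : ℝ) : ℝ := ∫ x in G.l..G.u, p x * G.m x φ

/-- The expected score at the centre `φ` under the unnormalized density `p`. -/
noncomputable def meanScore (p : ℝ → ℝ) (φ : ℝ) : ℝ := ∫ x in G.l..G.u, p x * G.m₁ x φ

/-- The expected second derivative of the log-likelihood at the centre `φ` under the unnormalized
density `p`. -/
noncomputable def meanCurvature (p : ℝ → ℝ) (φ : ℝ) : ℝ := ∫ x in G.l..G.u, p x * G.m₂ x φ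

/-- A bound, in units of the width of the peak, for how far a contamination of size `η` can move
the maximum of the expected log-likelihood. -/
noncomputable def shift (η : ℝ) : ℝ := 2 * (η * (G.u - G.l)) * G.R / (gapConst * G.snr)

/-- The unnormalized density `p` is that of the model with centre `θ₀` up to a nonnegative
contamination of at most `η`. -/
structure Contaminated (θ₀ : ℝ) (p : ℝ → ℝ) (η : ℝ) : Prop where
  measurable : Measurable p
  le : ∀ x ∈ Set.Icc G.l G.u, G.q x θ₀ ≤ p x
  le_add : ∀ x ∈ Set.Icc G.l G.u, p x ≤ G.q x θ₀ + η

/-- The contamination is small enough for the expected log-likelihood to keep a unique maximum near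
`θ₀`; a lower bound for the divergence from the centre `θ₀` is of order `gapConst * snr`. -/
structure SlightlyContaminated (θ₀ : ℝ) (p : ℝ → ℝ) (η : ℝ) : Prop extends
    G.Contaminated θ₀ p η where
  eight_le_R : 8 ≤ G.R
  mem_core : θ₀ ∈ G.core
  Z_le_two : G.Z θ₀ ≤ 2
  small : 192 * (η * (G.u - G.l)) * G.R ^ 4 ≤ (gapConst * G.snr) ^ 2

lemma intervalIntegrable_q_mul (θ : ℝ) {h : ℝ → ℝ} (hh : Continuous h) :
    IntervalIntegrable (fun x => G.q x θ * h x) volume G.l G.u :=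
  ((G.continuous_q θ).mul hh).intervalIntegrable _ _

lemma abs_integral_q_mul_le (θ : ℝ) {h : ℝ → ℝ} (hh : Continuous h) {C : ℝ}
    (hC : ∀ x ∈ Set.Icc G.l G.u, |h x| ≤ C) : |∫ x in G.l..G.u, G.q x θ * h x| ≤ G.Z θ * C :=
  calc |∫ x in G.l..G.u, G.q x θ * h x| ≤ ∫ x in G.l..G.u, |G.q x θ * h x| :=
        intervalIntegral.abs_integral_le_integral_abs G.l_lt_u.le
    _ ≤ ∫ x in G.l..G.u, G.q x θ * C := by
        refine intervalIntegral.integral_mono_on G.l_lt_u.le (G.intervalIntegrable_q_mul θ hh).abs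
          (G.intervalIntegrable_q_mul θ continuous_const) fun x hx => ?_
        rw [abs_mul, abs_of_pos (G.q_pos x θ)]
        exact mul_le_mul_of_nonneg_left (hC x hx) (G.q_pos x θ).le
    _ = G.Z θ * C := intervalIntegral.integral_mul_const _ _

lemma gapConst_mul_snr_le_one {θ : ℝ} (hR : 2 ≤ G.R) (hθ : θ ∈ Set.Icc G.l G.u)
    (hZ : G.Z θ ≤ 2) : gapConst * G.snr ≤ 1 := by
  have hα := G.α_pos
  have hsnr : G.snr ≤ G.α * G.σ := by
    rw [snr, div_le_iff₀ (add_pos hα G.β_pos)]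
    nlinarith [mul_pos (mul_pos hα G.σ_pos) G.β_pos]
  have hle := G.le_Z hR hθ
  have hfloor := mul_pos G.β_pos (sub_pos.mpr G.l_lt_u)
  nlinarith [gapConst_le, gapConst_pos, G.snr_pos]

variable {G} {θ₀ η : ℝ} {p : ℝ → ℝ}

namespace Contaminated

variable (hp : G.Contaminated θ₀ p η)

include hp

lemma nonneg : 0 ≤ η := by
  have hl : G.l ∈ Set.Icc G.l G.u := Set.left_mem_Icc.mpr G.l_lt_u.le
  linarith [hp.le _ hl, hp.le_add _ hl]

lemma mul_length_nonneg : 0 ≤ η * (G.u - G.l) := mul_nonneg hp.nonneg (sub_pos.mpr G.l_lt_u).le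

lemma pos {x : ℝ} (hx : x ∈ Set.Icc G.l G.u) : 0 < p x := (G.q_pos x θ₀).trans_le (hp.le x hx)

lemma abs_le {x : ℝ} (hx : x ∈ Set.Icc G.l G.u) : |p x| ≤ G.α + G.β + η := by
  rw [abs_of_pos (hp.pos hx)]
  linarith [hp.le_add x hx, G.q_le x θ₀]

lemma integrableOn : IntegrableOn p (Set.Icc G.l G.u) :=
  Measure.integrableOn_of_bounded (M := G.α + G.β + η) (by simp)
    hp.measurable.aestronglyMeasurable
    ((ae_restrict_mem measurableSet_Icc).mono fun _ hx => hp.abs_le hx)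

lemma intervalIntegrable : IntervalIntegrable p volume G.l G.u :=
  (intervalIntegrable_iff_integrableOn_Icc_of_le G.l_lt_u.le).mpr hp.integrableOn

lemma intervalIntegrable_mul {h : ℝ → ℝ} (hh : Continuous h) :
    IntervalIntegrable (fun x => p x * h x) volume G.l G.u :=
  hp.intervalIntegrable.mul_continuousOn hh.continuousOn

lemma abs_integral_sub_le {h : ℝ → ℝ} (hh : Continuous h) {C : ℝ}
    (hC : ∀ x ∈ Set.Icc G.l G.u, |h x| ≤ C) :
    |(∫ x in G.l..G.u, p x * h x) - ∫ x in G.l..G.u, G.q x θ₀ * h x| ≤ η * (G.u - G.l) * C := by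
  rw [← intervalIntegral.integral_sub (hp.intervalIntegrable_mul hh)
    (G.intervalIntegrable_q_mul θ₀ hh), mul_right_comm]
  refine abs_intervalIntegral_le G.l_lt_u.le fun x hx => ?_
  rw [← sub_mul, abs_mul, abs_of_nonneg (sub_nonneg.mpr (hp.le x hx))]
  exact mul_le_mul (by linarith [hp.le_add x hx]) (hC x hx) (abs_nonneg _) hp.nonneg

lemma integral_pos : 0 < ∫ x in G.l..G.u, p x :=
  (G.Z_pos θ₀).trans_le (intervalIntegral.integral_mono_on G.l_lt_u.le
    ((G.continuous_q _).intervalIntegrable _ _) hp.intervalIntegrable hp.le)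

lemma integral_le : ∫ x in G.l..G.u, p x ≤ G.Z θ₀ + η * (G.u - G.l) := by
  have h := (_root_.abs_le.mp (hp.abs_integral_sub_le (h := fun _ => 1) continuous_const
    (C := 1) (by simp))).2
  simp only [mul_one] at h
  rw [← Z] at h
  linarith

lemma continuousOn_meanLogLik (hR : 8 ≤ G.R) :
    ContinuousOn (G.meanLogLik p) (Set.Icc G.l G.u) := by
  have hσ := G.σ_pos
  have hlen := sub_pos.mpr G.l_lt_u
  have hsum : 0 ≤ G.α + G.β + η := add_nonneg (add_pos G.α_pos G.β_pos).le hp.nonneg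
  have hC : 0 ≤ (G.α + G.β + η) * (2 * G.R / G.σ) * (G.u - G.l) := by positivity
  refine (LipschitzOnWith.of_dist_le_mul
    (K := Real.toNNReal ((G.α + G.β + η) * (2 * G.R / G.σ) * (G.u - G.l)))
    fun φ hφ φ' hφ' => ?_).continuousOn
  rw [Real.dist_eq, Real.dist_eq, meanLogLik, meanLogLik, ← intervalIntegral.integral_sub
    (hp.intervalIntegrable_mul (G.continuous_m φ)) (hp.intervalIntegrable_mul (G.continuous_m φ')),
    Real.coe_toNNReal _ hC, mul_right_comm, mul_assoc (G.α + G.β + η)]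
  refine abs_intervalIntegral_le G.l_lt_u.le fun x hx => ?_
  rw [← mul_sub, abs_mul]
  exact mul_le_mul (hp.abs_le hx) (G.abs_m_sub_le hR hx hφ hφ') (abs_nonneg _) hsum

lemma hasDerivAt_integral {f f' : ℝ → ℝ → ℝ} {C : ℝ} (hf : ∀ φ, Continuous fun x => f x φ)
    (hf' : ∀ φ, Continuous fun x => f' x φ) (hd : ∀ x φ, HasDerivAt (f x) (f' x φ) φ)
    (hC : ∀ x ∈ Set.Icc G.l G.u, ∀ φ ∈ Set.Icc G.l G.u, |f' x φ| ≤ C) {φ : ℝ}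
    (hφ : φ ∈ Set.Ioo G.l G.u) :
    HasDerivAt (fun φ => ∫ x in G.l..G.u, p x * f x φ) (∫ x in G.l..G.u, p x * f' x φ) φ := by
  have hmeas : ∀ h : ℝ → ℝ, Continuous h →
      AEStronglyMeasurable (fun x => p x * h x) (volume.restrict (Set.uIoc G.l G.u)) :=
    fun h hh => (hp.measurable.mul hh.measurable).aestronglyMeasurable
  refine (intervalIntegral.hasDerivAt_integral_of_dominated_loc_of_deriv_le
    (F := fun φ x => p x * f x φ) (F' := fun φ x => p x * f' x φ)
    (bound := fun _ => (G.α + G.β + η) * C) (Icc_mem_nhds hφ.1 hφ.2)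
    (Eventually.of_forall fun φ => hmeas _ (hf φ)) (hp.intervalIntegrable_mul (hf φ))
    (hmeas _ (hf' φ)) (ae_of_all _ fun x hx ψ hψ => ?_) intervalIntegrable_const
    (ae_of_all _ fun x _ ψ _ => (hd x ψ).const_mul (p x))).2
  have hx' : x ∈ Set.Icc G.l G.u := Set.Ioc_subset_Icc_self (Set.uIoc_of_le G.l_lt_u.le ▸ hx)
  rw [norm_mul]
  exact mul_le_mul (hp.abs_le hx') (hC x hx' ψ hψ) (norm_nonneg _)
    ((abs_nonneg _).trans (hp.abs_le hx'))

lemma hasDerivAt_meanLogLik (hR : 8 ≤ G.R) {φ : ℝ} (hφ : φ ∈ Set.Ioo G.l G.u) :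
    HasDerivAt (G.meanLogLik p) (G.meanScore p φ) φ :=
  hp.hasDerivAt_integral G.continuous_m G.continuous_m₁ G.hasDerivAt_m
    (fun _ hx _ hψ => G.abs_m₁_le hR hx hψ) hφ

lemma hasDerivAt_meanScore (hR : 8 ≤ G.R) {φ : ℝ} (hφ : φ ∈ Set.Ioo G.l G.u) :
    HasDerivAt (G.meanScore p) (G.meanCurvature p φ) φ :=
  hp.hasDerivAt_integral G.continuous_m₁ G.continuous_m₂ G.hasDerivAt_m₁
    (fun _ hx _ hψ => G.abs_m₂_le hR hx hψ) hφ

lemma integral_windowMeasure (h : ℝ → ℝ) : ∫ x, h x ∂(windowMeasure (Set.Icc G.l G.u) p) =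
    (∫ x in G.l..G.u, p x * h x) / ∫ x in G.l..G.u, p x := by
  rw [QPE.integral_windowMeasure measurableSet_Icc hp.measurable fun x hx => (hp.pos hx).le,
    G.setIntegral_Icc, G.setIntegral_Icc]

lemma isProbabilityMeasure : IsProbabilityMeasure (windowMeasure (Set.Icc G.l G.u) p) :=
  isProbabilityMeasure_windowMeasure measurableSet_Icc hp.integrableOn
    (fun _ hx => (hp.pos hx).le) (by rw [G.setIntegral_Icc]; exact hp.integral_pos)

lemma mul_min_one_sq_le (hR : 8 ≤ G.R) (hθ₀ : θ₀ ∈ G.core) {θ : ℝ} (hθ : θ ∈ Set.Icc G.l G.u)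
    (hle : G.meanLogLik p θ₀ ≤ G.meanLogLik p θ) :
    gapConst * G.snr * min 1 ((|θ - θ₀| / G.σ) ^ 2) ≤
      2 * (η * (G.u - G.l)) * G.R * (|θ - θ₀| / G.σ) := by
  have hθ₀' := G.mem_Icc_of_mem_core hθ₀
  have hcont := hp.abs_integral_sub_le (h := fun x => G.m x θ₀ - G.m x θ)
    ((G.continuous_m _).sub (G.continuous_m _)) fun x hx => G.abs_m_sub_le hR hx hθ₀' hθ
  rw [abs_sub_comm θ₀] at hcont
  have hsplit : ∫ x in G.l..G.u, p x * (G.m x θ₀ - G.m x θ) =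
      G.meanLogLik p θ₀ - G.meanLogLik p θ := by
    simp only [mul_sub]
    exact intervalIntegral.integral_sub (hp.intervalIntegrable_mul (G.continuous_m _))
      (hp.intervalIntegrable_mul (G.continuous_m _))
  rw [div_pow, sq_abs, ← div_pow]
  calc gapConst * G.snr * min 1 (((θ - θ₀) / G.σ) ^ 2) ≤ G.likelihoodGap θ₀ θ :=
        G.le_likelihoodGap hθ₀ hθ
    _ ≤ η * (G.u - G.l) * (2 * G.R / G.σ * |θ - θ₀|) := by
        rw [likelihoodGap]
        linarith [(_root_.abs_le.mp hcont).1]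
    _ = _ := by ring

end Contaminated

namespace SlightlyContaminated

variable (hp : G.SlightlyContaminated θ₀ p η)

include hp

lemma center_mem : θ₀ ∈ Set.Icc G.l G.u := G.mem_Icc_of_mem_core hp.mem_core

lemma gapConst_mul_snr_le_one : gapConst * G.snr ≤ 1 :=
  G.gapConst_mul_snr_le_one (by linarith [hp.eight_le_R]) hp.center_mem hp.Z_le_two

lemma mul_R_sq_le : 16 * (η * (G.u - G.l)) * G.R ^ 2 ≤ gapConst * G.snr := by
  have hR := hp.eight_le_R
  have hc := mul_pos gapConst_pos G.snr_pos
  have := hp.mul_length_nonneg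
  calc 16 * (η * (G.u - G.l)) * G.R ^ 2 ≤ 192 * (η * (G.u - G.l)) * G.R ^ 4 := by
        gcongr <;> linarith
    _ ≤ (gapConst * G.snr) ^ 2 := hp.small
    _ ≤ gapConst * G.snr := by nlinarith [hp.gapConst_mul_snr_le_one]

lemma R_cube_mul_shift_le : 96 * (G.R ^ 3 * G.shift η) ≤ gapConst * G.snr := by
  have hc := mul_pos gapConst_pos G.snr_pos
  rw [shift, mul_div_assoc', mul_div_assoc', div_le_iff₀ hc]
  linarith [hp.small]

lemma shift_nonneg : 0 ≤ G.shift η :=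
  div_nonneg (mul_nonneg (mul_nonneg zero_le_two hp.mul_length_nonneg) G.R_pos.le)
    (mul_pos gapConst_pos G.snr_pos).le

lemma shift_lt_one : G.shift η < 1 := by
  have hR : 1 ≤ G.R ^ 3 := one_le_pow₀ (by linarith [hp.eight_le_R])
  nlinarith [hp.R_cube_mul_shift_le, hp.gapConst_mul_snr_le_one, hp.shift_nonneg]

lemma mem_Ioo_of_abs_sub_le {θ : ℝ} (hθ : |θ - θ₀| ≤ G.σ * G.shift η) : θ ∈ Set.Ioo G.l G.u := by
  have hσ := G.σ_pos
  have hlt : |θ - θ₀| < G.σ := hθ.trans_lt (mul_lt_of_lt_one_right hσ hp.shift_lt_one)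
  obtain ⟨hneg, hpos⟩ := abs_lt.mp hlt
  exact ⟨by linarith [hp.mem_core.1], by linarith [hp.mem_core.2]⟩

lemma abs_sub_le_of_meanLogLik_le {θ : ℝ} (hθ : θ ∈ Set.Icc G.l G.u)
    (hle : G.meanLogLik p θ₀ ≤ G.meanLogLik p θ) : |θ - θ₀| ≤ G.σ * G.shift η := by
  have hσ := G.σ_pos
  have hc := mul_pos gapConst_pos G.snr_pos
  have he := hp.mul_length_nonneg
  have hR := G.R_pos
  rw [← div_le_iff₀' hσ]
  refine le_div_of_mul_min_one_sq_le (R := G.R) hc (by positivity) ?_ (by positivity) ?_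
    (hp.mul_min_one_sq_le hp.eight_le_R hp.mem_core hθ hle)
  · nlinarith [hp.mul_R_sq_le]
  · exact div_le_div_of_nonneg_right (Real.dist_le_of_mem_Icc hθ hp.center_mem) hσ.le

lemma abs_integral_sub_le_half_fisher {h h₀ : ℝ → ℝ} (hh : Continuous h) (hh₀ : Continuous h₀)
    (hC : ∀ x ∈ Set.Icc G.l G.u, |h x| ≤ 4 * G.R ^ 2 / G.σ ^ 2)
    (hδ : ∀ x ∈ Set.Icc G.l G.u, |h x - h₀ x| ≤ 12 * (G.R ^ 3 * G.shift η) / G.σ ^ 2) :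
    |(∫ x in G.l..G.u, p x * h x) - ∫ x in G.l..G.u, G.q x θ₀ * h₀ x| ≤ G.fisher θ₀ / 2 := by
  have hσ := G.σ_pos
  have hR := G.R_pos
  have := hp.shift_nonneg
  have hq := G.abs_integral_q_mul_le θ₀ (hh.sub hh₀) hδ
  have hsplit : ∫ x in G.l..G.u, G.q x θ₀ * (h x - h₀ x) =
      (∫ x in G.l..G.u, G.q x θ₀ * h x) - ∫ x in G.l..G.u, G.q x θ₀ * h₀ x := by
    simp only [mul_sub]
    exact intervalIntegral.integral_sub (G.intervalIntegrable_q_mul θ₀ hh)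
      (G.intervalIntegrable_q_mul θ₀ hh₀)
  calc |(∫ x in G.l..G.u, p x * h x) - ∫ x in G.l..G.u, G.q x θ₀ * h₀ x|
      ≤ |(∫ x in G.l..G.u, p x * h x) - ∫ x in G.l..G.u, G.q x θ₀ * h x| +
        |(∫ x in G.l..G.u, G.q x θ₀ * h x) - ∫ x in G.l..G.u, G.q x θ₀ * h₀ x| :=
        abs_sub_le _ _ _
    _ ≤ η * (G.u - G.l) * (4 * G.R ^ 2 / G.σ ^ 2) +
        2 * (12 * (G.R ^ 3 * G.shift η) / G.σ ^ 2) := by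
        rw [← hsplit]
        exact add_le_add (hp.abs_integral_sub_le hh hC)
          (hq.trans (mul_le_mul_of_nonneg_right hp.Z_le_two (by positivity)))
    _ = (4 * (η * (G.u - G.l)) * G.R ^ 2 + 24 * (G.R ^ 3 * G.shift η)) / G.σ ^ 2 := by ring
    _ ≤ gapConst * G.snr / 2 / G.σ ^ 2 := by
        gcongr
        linarith [hp.mul_R_sq_le, hp.R_cube_mul_shift_le]
    _ = gapConst * G.snr / G.σ ^ 2 / 2 := by ring
    _ ≤ G.fisher θ₀ / 2 := by
        gcongr
        exact G.gapConst_mul_snr_le_fisher hp.mem_core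

variable {θ : ℝ} (hθ : |θ - θ₀| ≤ G.σ * G.shift η)

include hθ

lemma abs_meanCurvature_add_fisher_le :
    |G.meanCurvature p θ + G.fisher θ₀| ≤ G.fisher θ₀ / 2 := by
  have hσ := G.σ_pos
  have hR := hp.eight_le_R
  have := G.R_pos
  have := hp.shift_nonneg
  have hθ' := Set.Ioo_subset_Icc_self (hp.mem_Ioo_of_abs_sub_le hθ)
  have key := hp.abs_integral_sub_le_half_fisher (G.continuous_m₂ θ) (G.continuous_m₂ θ₀)
    (fun x hx => (G.abs_m₂_le hR hx hθ').trans (by gcongr; norm_num)) fun x hx => by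
      calc |G.m₂ x θ - G.m₂ x θ₀| ≤ 9 * G.R ^ 3 / G.σ ^ 3 * |θ - θ₀| :=
            G.abs_m₂_sub_le hR hx hθ' hp.center_mem
        _ ≤ 9 * G.R ^ 3 / G.σ ^ 3 * (G.σ * G.shift η) := by gcongr
        _ = 9 * (G.R ^ 3 * G.shift η) / G.σ ^ 2 := by field_simp
        _ ≤ 12 * (G.R ^ 3 * G.shift η) / G.σ ^ 2 := by gcongr; norm_num
  rwa [G.integral_q_mul_m₂, sub_neg_eq_add] at key

lemma abs_integral_score_sq_sub_fisher_le :
    |(∫ x in G.l..G.u, p x * G.m₁ x θ ^ 2) - G.fisher θ₀| ≤ G.fisher θ₀ / 2 := by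
  have hσ := G.σ_pos
  have hR := hp.eight_le_R
  have := G.R_pos
  have hθ' := Set.Ioo_subset_Icc_self (hp.mem_Ioo_of_abs_sub_le hθ)
  refine hp.abs_integral_sub_le_half_fisher ((G.continuous_m₁ θ).pow 2)
    ((G.continuous_m₁ θ₀).pow 2) (fun x hx => ?_) fun x hx => ?_
  · calc |G.m₁ x θ ^ 2| = |G.m₁ x θ| ^ 2 := abs_pow _ _
      _ ≤ (2 * G.R / G.σ) ^ 2 := by gcongr; exact G.abs_m₁_le hR hx hθ'
      _ = 4 * G.R ^ 2 / G.σ ^ 2 := by ring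
  · have hsum : |G.m₁ x θ + G.m₁ x θ₀| ≤ 2 * G.R / G.σ + 2 * G.R / G.σ := (abs_add_le _ _).trans
      (add_le_add (G.abs_m₁_le hR hx hθ') (G.abs_m₁_le hR hx hp.center_mem))
    have hdiff : |G.m₁ x θ - G.m₁ x θ₀| ≤ 3 * G.R ^ 2 / G.σ ^ 2 * (G.σ * G.shift η) :=
      (G.abs_m₁_sub_le hR hx hθ' hp.center_mem).trans (by gcongr)
    calc |G.m₁ x θ ^ 2 - G.m₁ x θ₀ ^ 2| = |G.m₁ x θ + G.m₁ x θ₀| * |G.m₁ x θ - G.m₁ x θ₀| := by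
          rw [sq_sub_sq, abs_mul]
      _ ≤ (2 * G.R / G.σ + 2 * G.R / G.σ) * (3 * G.R ^ 2 / G.σ ^ 2 * (G.σ * G.shift η)) := by
          gcongr
      _ = 12 * (G.R ^ 3 * G.shift η) / G.σ ^ 2 := by field_simp; ring

omit hθ

lemma strictConcaveOn_meanLogLik :
    StrictConcaveOn ℝ (Metric.closedBall θ₀ (G.σ * G.shift η)) (G.meanLogLik p) := by
  refine strictConcaveOn_of_hasDerivAt_of_neg (convex_closedBall _ _)
    (fun φ hφ => hp.hasDerivAt_meanLogLik hp.eight_le_R (hp.mem_Ioo_of_abs_sub_le hφ))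
    (fun φ hφ => hp.hasDerivAt_meanScore hp.eight_le_R (hp.mem_Ioo_of_abs_sub_le hφ))
    fun φ hφ => ?_
  linarith [(_root_.abs_le.mp (hp.abs_meanCurvature_add_fisher_le hφ)).2,
    G.fisher_pos hp.mem_core]

lemma exists_strict_max : ∃ θ, |θ - θ₀| ≤ G.σ * G.shift η ∧
    ∀ φ ∈ Set.Icc G.l G.u, φ ≠ θ → G.meanLogLik p φ < G.meanLogLik p θ :=
  exists_forall_lt_of_strictConcaveOn isCompact_Icc ⟨θ₀, hp.center_mem⟩
    (hp.continuousOn_meanLogLik hp.eight_le_R)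
    (fun _ hφ => Set.Ioo_subset_Icc_self (hp.mem_Ioo_of_abs_sub_le hφ))
    hp.strictConcaveOn_meanLogLik
    fun _ hφ hmax => hp.abs_sub_le_of_meanLogLik_le hφ (hmax hp.center_mem)

lemma exists_regularContrast (hθ : |θ - θ₀| ≤ G.σ * G.shift η)
    (hmax : ∀ φ ∈ Set.Icc G.l G.u, φ ≠ θ → G.meanLogLik p φ < G.meanLogLik p θ) :
    ∃ B, RegularContrast (windowMeasure (Set.Icc G.l G.u) p) (Set.Icc G.l G.u) G.l G.u θ B
      G.m G.m₁ G.m₂ := by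
  have hR := hp.eight_le_R
  have hmass := hp.integral_pos
  obtain ⟨B₀, hB₀⟩ := G.exists_abs_m_le hR
  obtain ⟨B, hB⟩ := ({B₀, 2 * G.R / G.σ, 3 * G.R ^ 2 / G.σ ^ 2, 9 * G.R ^ 3 / G.σ ^ 3} :
    Finset ℝ).exists_le
  simp only [Finset.mem_insert, Finset.mem_singleton, forall_eq_or_imp, forall_eq] at hB
  obtain ⟨hm, hm₁, hm₂, hm₃⟩ := hB
  refine ⟨B, {
    ae_mem := ae_windowMeasure_mem measurableSet_Icc p
    measurable := fun φ => (G.continuous_m φ).measurable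
    measurable₁ := fun φ => (G.continuous_m₁ φ).measurable
    measurable₂ := fun φ => (G.continuous_m₂ φ).measurable
    hasDerivAt := fun x _ φ _ => G.hasDerivAt_m x φ
    hasDerivAt₁ := fun x _ φ _ => G.hasDerivAt_m₁ x φ
    abs_le := fun x hx φ hφ => (hB₀ x hx φ hφ).trans hm
    abs_le₁ := fun x hx φ hφ => (G.abs_m₁_le hR hx hφ).trans hm₁
    abs_le₂ := fun x hx φ hφ => (G.abs_m₂_le hR hx hφ).trans hm₂
    lipschitz₂ := fun x hx φ hφ φ' hφ' => (G.abs_m₂_sub_le hR hx hφ hφ').trans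
      (mul_le_mul_of_nonneg_right hm₃ (abs_nonneg _))
    mem_Ioo := hp.mem_Ioo_of_abs_sub_le hθ
    strict_max := fun φ hφ hne => ?_
    nondegenerate := ?_ }⟩
  · rw [hp.integral_windowMeasure, hp.integral_windowMeasure]
    exact div_lt_div_of_pos_right (hmax φ hφ hne) hmass
  · rw [hp.integral_windowMeasure, ← meanCurvature]
    exact div_neg_of_neg_of_pos (by linarith
      [(_root_.abs_le.mp (hp.abs_meanCurvature_add_fisher_le hθ)).2, G.fisher_pos hp.mem_core])
      hmass

include hθ

lemma asymptoticVariance_mem_Ioc :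
    (∫ x, G.m₁ x θ ^ 2 ∂(windowMeasure (Set.Icc G.l G.u) p)) /
      (∫ x, G.m₂ x θ ∂(windowMeasure (Set.Icc G.l G.u) p)) ^ 2 ∈
    Set.Ioc 0 (6 * (∫ x in G.l..G.u, p x) * G.σ ^ 2 / (gapConst * G.snr)) := by
  have hσ := G.σ_pos
  have hF := G.fisher_pos hp.mem_core
  have hc := mul_pos gapConst_pos G.snr_pos
  have hmass := hp.integral_pos
  have hscore := _root_.abs_le.mp (hp.abs_integral_score_sq_sub_fisher_le hθ)
  have hcurv := _root_.abs_le.mp (hp.abs_meanCurvature_add_fisher_le hθ)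
  rw [hp.integral_windowMeasure, hp.integral_windowMeasure, ← meanCurvature]
  set A := ∫ x in G.l..G.u, p x
  set J := ∫ x in G.l..G.u, p x * G.m₁ x θ ^ 2
  set D := G.meanCurvature p θ
  have hD : D < 0 := by linarith [hcurv.2]
  have hJ : 0 < J := by linarith [hscore.1]
  have hv : J / A / (D / A) ^ 2 = J * A / D ^ 2 := by
    have := hD.ne
    field_simp
  rw [hv]
  refine ⟨div_pos (mul_pos hJ hmass) (sq_pos_of_neg hD), ?_⟩
  have hD2 : G.fisher θ₀ ^ 2 / 4 ≤ D ^ 2 := by nlinarith [hcurv.2]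
  calc J * A / D ^ 2 ≤ 3 / 2 * G.fisher θ₀ * A / (G.fisher θ₀ ^ 2 / 4) := by
        gcongr
        linarith [hscore.2]
    _ = 6 * A / G.fisher θ₀ := by field_simp; ring
    _ ≤ 6 * A / (gapConst * G.snr / G.σ ^ 2) := by
        gcongr
        exact G.gapConst_mul_snr_le_fisher hp.mem_core
    _ = 6 * A * G.σ ^ 2 / (gapConst * G.snr) := by field_simp

omit hθ

theorem exists_tendsto_integral_and_variance {est : (M : ℕ) → (Fin M → ℝ) → ℝ}
    (hest : IsContrastMaximizer (Set.Icc G.l G.u) (Set.Icc G.l G.u) G.m est) :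
    ∃ θ v : ℝ, |θ - θ₀| ≤ G.σ * G.shift η ∧
      v ∈ Set.Ioc 0 (6 * (∫ x in G.l..G.u, p x) * G.σ ^ 2 / (gapConst * G.snr)) ∧
      Tendsto (fun M : ℕ => ∫ x, est M x ∂(iidLaw (windowMeasure (Set.Icc G.l G.u) p) M)) atTop
        (𝓝 θ) ∧
      Tendsto (fun M : ℕ => (M : ℝ) * ProbabilityTheory.variance (est M)
        (iidLaw (windowMeasure (Set.Icc G.l G.u) p) M)) atTop (𝓝 v) := by
  have := hp.isProbabilityMeasure
  obtain ⟨θ, hθ, hmax⟩ := hp.exists_strict_max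
  obtain ⟨B, hreg⟩ := hp.exists_regularContrast hθ hmax
  exact ⟨θ, _, hθ, hp.asymptoticVariance_mem_Ioc hθ, hreg.tendsto_integral hest,
    hreg.tendsto_natCast_mul_variance hest⟩

end SlightlyContaminated

end PeakModel

section Kernel

/-- The normalization constant of the Gaussian kernel. -/
noncomputable def kernelMass (σ : ℝ) : ℝ := ∫ y in (-π)..π, bump σ y 0

lemma gaussianKernel_eq (σ x : ℝ) :
    gaussianKernel σ x = bump σ (toIocMod Real.two_pi_pos (-π) x) 0 / kernelMass σ := by
  simp only [gaussianKernel, kernelMass, bump, sub_zero]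

lemma kernelMass_pos (σ : ℝ) : 0 < kernelMass σ :=
  intervalIntegral.intervalIntegral_pos_of_pos ((continuous_bump σ 0).intervalIntegrable _ _)
    (fun y => bump_pos σ y 0) (neg_lt_self Real.pi_pos)

lemma kernelMass_le {σ : ℝ} (hσ : 0 < σ) : kernelMass σ ≤ 3 * σ :=
  integral_bump_le hσ (neg_lt_self Real.pi_pos).le 0

lemma half_le_kernelMass {σ : ℝ} (hσ : σ ∈ Set.Ioc 0 π) : σ / 2 ≤ kernelMass σ :=
  le_integral_bump hσ.1 (by linarith [hσ.2]) ⟨neg_nonpos.mpr Real.pi_pos.le, Real.pi_pos.le⟩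

lemma integral_bump_le_kernelMass (σ : ℝ) {l u φ : ℝ} (hl : -π ≤ l - φ) (hlu : l ≤ u)
    (hu : u - φ ≤ π) : ∫ x in l..u, bump σ x φ ≤ kernelMass σ :=
  calc ∫ x in l..u, bump σ x φ = ∫ x in (l - φ)..(u - φ), bump σ x 0 := by
        rw [← intervalIntegral.integral_comp_sub_right (fun x => bump σ x 0)]
        simp only [bump, sub_zero]
    _ ≤ kernelMass σ := intervalIntegral.integral_mono_interval hl (by linarith) hu
        (Eventually.of_forall fun x => (bump_pos σ x 0).le)
        ((continuous_bump σ 0).intervalIntegrable _ _)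

lemma sq_toIocMod_neg_pi {x : ℝ} (hx : |x| ≤ π) : toIocMod Real.two_pi_pos (-π) x ^ 2 = x ^ 2 := by
  obtain ⟨hl, hu⟩ := abs_le.mp hx
  rcases hl.eq_or_lt with rfl | hl
  · rw [toIocMod_apply_left]
    ring
  · rw [(toIocMod_eq_self Real.two_pi_pos).mpr ⟨hl, by linarith⟩]

lemma gaussianKernel_sub_eq (σ : ℝ) {x φ : ℝ} (h : |x - φ| ≤ π) :
    gaussianKernel σ (x - φ) = bump σ x φ / kernelMass σ := by
  rw [gaussianKernel_eq, bump, bump, sub_zero, sq_toIocMod_neg_pi h]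

lemma gaussianKernel_nonneg (σ x : ℝ) : 0 ≤ gaussianKernel σ x := by
  rw [gaussianKernel_eq]
  exact div_nonneg (bump_pos _ _ _).le (kernelMass_pos σ).le

lemma gaussianKernel_le (σ : ℝ) {x δ : ℝ} (hδ : 0 ≤ δ)
    (h : δ ≤ |toIocMod Real.two_pi_pos (-π) x|) :
    gaussianKernel σ x ≤ bump σ δ 0 / kernelMass σ := by
  have hsq : δ ^ 2 ≤ toIocMod Real.two_pi_pos (-π) x ^ 2 := by
    rw [← sq_abs (toIocMod _ _ _)]
    gcongr
  have hmass := kernelMass_pos σ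
  rw [gaussianKernel_eq]
  simp only [bump, sub_zero]
  gcongr

lemma measurable_toIocMod {p : ℝ} (hp : 0 < p) (a : ℝ) : Measurable (toIocMod hp a) := by
  have hfloor : toIocMod hp a = fun x => x + (⌊(a + p - x) / p⌋ : ℝ) * p := by
    ext x
    rw [← self_sub_toIocDiv_mul, toIocDiv_eq_neg_floor]
    push_cast
    ring
  rw [hfloor]
  fun_prop

lemma measurable_gaussianKernel (σ : ℝ) : Measurable (gaussianKernel σ) := by
  have := measurable_toIocMod Real.two_pi_pos (-π)
  unfold gaussianKernel
  fun_prop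

lemma le_abs_toIocMod_sub {x φ δ : ℝ} (hx : x ∈ Set.Ico δ (2 * π - δ))
    (hφ : φ ∈ Set.Ico 0 (2 * π)) (hxφ : δ ≤ |x - φ|) :
    δ ≤ |toIocMod Real.two_pi_pos (-π) (x - φ)| := by
  have hmod := self_sub_toIocDiv_mul Real.two_pi_pos (-π) (x - φ)
  rcases lt_trichotomy (toIocDiv Real.two_pi_pos (-π) (x - φ)) 0 with hn | hn | hn
  · have hn' : (toIocDiv Real.two_pi_pos (-π) (x - φ) : ℝ) ≤ -1 := by
      exact_mod_cast Int.le_sub_one_of_lt hn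
    refine le_trans ?_ (le_abs_self _)
    nlinarith [Real.pi_pos, hx.1, hφ.2]
  · rw [← hmod, hn, Int.cast_zero, zero_mul, sub_zero]
    exact hxφ
  · have hn' : (1 : ℝ) ≤ toIocDiv Real.two_pi_pos (-π) (x - φ) := by exact_mod_cast hn
    refine le_trans ?_ (neg_le_abs _)
    nlinarith [Real.pi_pos, hx.2, hφ.1]

end Kernel

/-- The parameters of the single-phase model of the filtered distribution. -/
structure FilteredModel where
  /-- the circuit fidelity -/
  F : ℝ
  /-- the overlap with the target eigenvector -/
  a₀ : ℝ
  /-- the width of the kernel -/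
  σ : ℝ
  /-- the initial guess, at the centre of the window -/
  guess : ℝ
  /-- the length of the window -/
  Δ : ℝ
  F_mem : F ∈ Set.Ioo 0 1
  a₀_mem : a₀ ∈ Set.Ioc 0 1
  σ_mem : σ ∈ Set.Ioc 0 π
  Δ_mem : Δ ∈ Set.Ioc 0 π

namespace FilteredModel

variable (Q : FilteredModel)

/-- The filtering interval of the model. -/
abbrev window : Set ℝ := filterInterval Q.guess Q.Δ

/-- The single-phase model as a peak over a floor: since `Δ ≤ π`, the kernel does not wrap around
the circle inside the window. -/
noncomputable def peak : PeakModel where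
  α := Q.F * Q.a₀ / kernelMass Q.σ
  β := (1 - Q.F) * (1 / (2 * π))
  σ := Q.σ
  l := Q.guess - Q.Δ / 2
  u := Q.guess + Q.Δ / 2
  α_pos := div_pos (mul_pos Q.F_mem.1 Q.a₀_mem.1) (kernelMass_pos Q.σ)
  β_pos := mul_pos (sub_pos.mpr Q.F_mem.2) (one_div_pos.mpr Real.two_pi_pos)
  σ_pos := Q.σ_mem.1
  l_lt_u := by linarith [Q.Δ_mem.1]

/-- A bound on the density inside the window of the phases outside it: their distance from the
window is at least `Δ / 6`. -/
noncomputable def leak : ℝ := Q.F * (bump Q.σ (Q.Δ / 6) 0 / kernelMass Q.σ)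

lemma peak_length : Q.peak.u - Q.peak.l = Q.Δ := by
  simp only [peak]
  ring

lemma peak_R : Q.peak.R = Q.Δ / Q.σ := by
  rw [PeakModel.R, peak_length, peak]

lemma R_mul_σ : Q.peak.R * Q.σ = Q.Δ := by
  rw [peak_R, div_mul_cancel₀ _ Q.σ_mem.1.ne']

lemma fidelity_mul_overlap_pos : 0 < Q.F * Q.a₀ := mul_pos Q.F_mem.1 Q.a₀_mem.1

lemma fidelity_mul_overlap_le_one : Q.F * Q.a₀ ≤ 1 :=
  mul_le_one₀ Q.F_mem.2.le Q.a₀_mem.1.le Q.a₀_mem.2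

lemma abs_sub_le_pi {x φ : ℝ} (hx : x ∈ Q.window) (hφ : φ ∈ Q.window) : |x - φ| ≤ π :=
  (Real.dist_le_of_mem_Icc hx hφ).trans (by linarith [Q.Δ_mem.2])

lemma peak_q {x φ : ℝ} (hx : x ∈ Q.window) (hφ : φ ∈ Q.window) :
    Q.peak.q x φ = Q.F * Q.a₀ * gaussianKernel Q.σ (x - φ) + (1 - Q.F) * (1 / (2 * π)) := by
  rw [gaussianKernel_sub_eq _ (Q.abs_sub_le_pi hx hφ)]
  simp only [PeakModel.q, peak]
  ring

lemma peak_Z {φ : ℝ} (hφ : φ ∈ Q.window) :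
    Q.peak.Z φ = Q.F * Q.a₀ * (∫ y in Q.window, gaussianKernel Q.σ (y - φ)) +
      (1 - Q.F) * (volume.real Q.window / (2 * π)) := by
  have hkernel : ∫ y in Q.window, gaussianKernel Q.σ (y - φ) =
      (∫ y in Q.peak.l..Q.peak.u, bump Q.σ y φ) / kernelMass Q.σ := by
    rw [← intervalIntegral.integral_div, ← PeakModel.setIntegral_Icc]
    exact setIntegral_congr_fun measurableSet_Icc fun y hy =>
      gaussianKernel_sub_eq _ (Q.abs_sub_le_pi hy hφ)
  have hvol : volume.real Q.window = Q.peak.u - Q.peak.l :=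
    Real.volume_real_Icc_of_le Q.peak.l_lt_u.le
  rw [hkernel, hvol, PeakModel.Z_eq]
  simp only [peak]
  ring

lemma log_modelDensity {x φ : ℝ} (hx : x ∈ Q.window) (hφ : φ ∈ Q.window) :
    Real.log (modelDensity Q.F Q.a₀ Q.σ Q.window x φ) = Q.peak.m x φ := by
  rw [modelDensity, ← Q.peak_q hx hφ, ← Q.peak_Z hφ,
    Real.log_div (Q.peak.q_pos x φ).ne' (Q.peak.Z_pos φ).ne', PeakModel.m]

lemma logLikelihood_eq {M : ℕ} {x : Fin M → ℝ} {φ : ℝ} (hx : ∀ j, x j ∈ Q.window)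
    (hφ : φ ∈ Q.window) :
    logLikelihood Q.F Q.a₀ Q.σ Q.window x φ = empiricalMean (fun y => Q.peak.m y φ) x := by
  simp only [logLikelihood, empiricalMean, Q.log_modelDensity (hx _) hφ]

lemma isContrastMaximizer {est : (M : ℕ) → (Fin M → ℝ) → ℝ}
    (hest : IsFMPE Q.F Q.a₀ Q.σ Q.window est) :
    IsContrastMaximizer Q.window Q.window Q.peak.m est where
  measurable := hest.measurable
  mem := hest.mem
  isMax M x hx φ hφ := by
    rw [← Q.logLikelihood_eq hx hφ, ← Q.logLikelihood_eq hx (hest.mem M x hx)]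
    exact hest.isMax M x hx φ hφ

lemma peak_α_mul_kernelMass : Q.peak.α * kernelMass Q.σ = Q.F * Q.a₀ :=
  div_mul_cancel₀ _ (kernelMass_pos Q.σ).ne'

lemma le_peak_α_mul_σ : Q.F * Q.a₀ / 3 ≤ Q.peak.α * Q.σ := by
  have := mul_le_mul_of_nonneg_left (kernelMass_le Q.σ_mem.1) Q.peak.α_pos.le
  linarith [Q.peak_α_mul_kernelMass]

lemma peak_α_mul_σ_le : Q.peak.α * Q.σ ≤ 2 * (Q.F * Q.a₀) := by
  have := mul_le_mul_of_nonneg_left (half_le_kernelMass Q.σ_mem) Q.peak.α_pos.le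
  linarith [Q.peak_α_mul_kernelMass]

lemma peak_β_le : Q.peak.β ≤ 1 / 6 :=
  calc Q.peak.β ≤ 1 * (1 / 6) := by
        refine mul_le_mul (by linarith [Q.F_mem.1]) ?_ (by positivity) one_pos.le
        exact one_div_le_one_div_of_le (by norm_num) (by linarith [Real.pi_gt_three])
    _ = 1 / 6 := one_mul _

lemma peak_Z_le_two {φ : ℝ} (hφ : φ ∈ Q.window) : Q.peak.Z φ ≤ 2 := by
  have hΔ := Q.Δ_mem.2
  have hpeak : Q.peak.α * ∫ x in Q.peak.l..Q.peak.u, bump Q.σ x φ ≤ 1 :=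
    calc Q.peak.α * ∫ x in Q.peak.l..Q.peak.u, bump Q.σ x φ ≤ Q.peak.α * kernelMass Q.σ := by
          refine mul_le_mul_of_nonneg_left ?_ Q.peak.α_pos.le
          have hlu := Q.peak_length
          exact integral_bump_le_kernelMass _ (by linarith [show φ ≤ Q.peak.u from hφ.2])
            Q.peak.l_lt_u.le (by linarith [show Q.peak.l ≤ φ from hφ.1])
      _ ≤ 1 := Q.peak_α_mul_kernelMass.trans_le Q.fidelity_mul_overlap_le_one
  have hfloor : Q.peak.β * (Q.peak.u - Q.peak.l) ≤ 1 / 6 * 4 := by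
    rw [peak_length]
    exact mul_le_mul Q.peak_β_le (hΔ.trans Real.pi_lt_four.le) Q.Δ_mem.1.le (by norm_num)
  rw [PeakModel.Z_eq, show Q.peak.σ = Q.σ from rfl]
  linarith

lemma peak_snr_eq :
    Q.peak.snr = (Q.peak.α * Q.σ) ^ 2 / (Q.peak.α * Q.σ + Q.peak.β * Q.σ) := by
  have hσ := Q.σ_mem.1
  rw [PeakModel.snr, ← add_mul, show Q.peak.σ = Q.σ from rfl]
  field_simp

lemma sq_div_le_peak_snr : (Q.F * Q.a₀) ^ 2 / 27 ≤ Q.peak.snr := by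
  have hpos := Q.fidelity_mul_overlap_pos
  have hα := mul_pos Q.peak.α_pos Q.σ_mem.1
  have hβ := mul_pos Q.peak.β_pos Q.σ_mem.1
  have hfloor : Q.peak.β * Q.σ ≤ 1 / 6 * 4 :=
    mul_le_mul Q.peak_β_le (Q.σ_mem.2.trans Real.pi_lt_four.le) Q.σ_mem.1.le (by norm_num)
  rw [peak_snr_eq]
  calc (Q.F * Q.a₀) ^ 2 / 27 = (Q.F * Q.a₀ / 3) ^ 2 / 3 := by ring
    _ ≤ (Q.peak.α * Q.σ) ^ 2 / (Q.peak.α * Q.σ + Q.peak.β * Q.σ) := by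
        gcongr
        · exact Q.le_peak_α_mul_σ
        · linarith [Q.peak_α_mul_σ_le, Q.fidelity_mul_overlap_le_one]

lemma div_le_peak_snr (hσ : Q.σ ≤ Q.F * Q.a₀) : Q.F * Q.a₀ / 6 ≤ Q.peak.snr := by
  have hα := mul_pos Q.peak.α_pos Q.σ_mem.1
  have hβ := mul_pos Q.peak.β_pos Q.σ_mem.1
  have hle := Q.le_peak_α_mul_σ
  have hfloor : Q.peak.β * Q.σ ≤ Q.peak.α * Q.σ := by
    nlinarith [Q.peak_β_le, Q.σ_mem.1]
  rw [peak_snr_eq, le_div_iff₀ (add_pos hα hβ)]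
  nlinarith

lemma leak_mul_length_le :
    Q.leak * Q.Δ ≤ 2 * Q.F * Real.exp (-Q.peak.R ^ 2 / 72) * Q.peak.R := by
  have hF := Q.F_mem.1
  have hσ := Q.σ_mem.1
  have hΔ := Q.Δ_mem.1
  have hexp : bump Q.σ (Q.Δ / 6) 0 = Real.exp (-Q.peak.R ^ 2 / 72) := by
    rw [bump, peak_R]
    congr 1
    field_simp
    ring
  calc Q.leak * Q.Δ ≤ Q.F * (Real.exp (-Q.peak.R ^ 2 / 72) / (Q.σ / 2)) * Q.Δ := by
        rw [leak, hexp]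
        gcongr
        exact half_le_kernelMass Q.σ_mem
    _ = _ := by
        rw [peak_R]
        field_simp

end FilteredModel

section Input

variable {ι : Type u} {H : Type v} [Fintype ι] [NormedAddCommGroup H] [InnerProductSpace ℂ H]

lemma Input.weight_nonneg (S : Input ι H) (j : ι) : 0 ≤ S.weight j := sq_nonneg _

lemma Input.sum_weight (S : Input ι H) : ∑ j, S.weight j = 1 := by
  simp only [Input.weight]
  rw [S.eigvec.sum_sq_norm_inner_right, S.norm_ψ, one_pow]

lemma Input.sum_weight_mul_le (S : Input ι H) {s : Finset ι} {f : ι → ℝ} {C : ℝ} (hC : 0 ≤ C)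
    (hf : ∀ j ∈ s, f j ≤ C) : ∑ j ∈ s, S.weight j * f j ≤ C :=
  calc ∑ j ∈ s, S.weight j * f j ≤ ∑ j ∈ s, S.weight j * C :=
        Finset.sum_le_sum fun j hj => mul_le_mul_of_nonneg_left (hf j hj) (S.weight_nonneg j)
    _ ≤ ∑ j, S.weight j * C := Finset.sum_le_sum_of_subset_of_nonneg (Finset.subset_univ s)
        fun j _ _ => mul_nonneg (S.weight_nonneg j) hC
    _ = C := by rw [← Finset.sum_mul, S.sum_weight, one_mul]

lemma Input.measurable_noisyDensity (S : Input ι H) (F σ : ℝ) :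
    Measurable (S.noisyDensity F σ) := by
  have := measurable_gaussianKernel σ
  unfold Input.noisyDensity
  fun_prop

/-- The model `Q` is that of the phase `j₀` of `S`: it has the right overlap, and the window is
close to this phase and far from the others. -/
structure Input.IsTarget (S : Input ι H) (j₀ : ι) (Q : FilteredModel) : Prop where
  weight_eq : S.weight j₀ = Q.a₀
  lt_abs_sub : ∀ j, j ≠ j₀ → Q.Δ < |S.phase j - S.phase j₀|
  abs_sub_guess_lt : |S.phase j₀ - Q.guess| < Q.Δ / 3
  window_subset : Q.window ⊆ Set.Ico (Q.Δ / 6) (2 * π - Q.Δ / 6)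

namespace Input.IsTarget

variable {S : Input ι H} {j₀ : ι} {Q : FilteredModel} (h : S.IsTarget j₀ Q)
include h

lemma phase_mem_window : S.phase j₀ ∈ Q.window := by
  obtain ⟨hl, hu⟩ := abs_lt.mp h.abs_sub_guess_lt
  exact ⟨by linarith [Q.Δ_mem.1], by linarith [Q.Δ_mem.1]⟩

lemma gaussianKernel_le_of_ne {x : ℝ} (hx : x ∈ Q.window) {j : ι} (hj : j ≠ j₀) :
    gaussianKernel Q.σ (x - S.phase j) ≤ bump Q.σ (Q.Δ / 6) 0 / kernelMass Q.σ := by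
  refine gaussianKernel_le _ (by linarith [Q.Δ_mem.1])
    (le_abs_toIocMod_sub (h.window_subset hx) (S.phase_mem j) ?_)
  obtain ⟨hl, hu⟩ := abs_lt.mp h.abs_sub_guess_lt
  rcases lt_abs.mp (h.lt_abs_sub j hj) with hsep | hsep
  · exact le_trans (by linarith [hx.2]) (neg_le_abs _)
  · exact le_trans (by linarith [hx.1]) (le_abs_self _)

lemma contaminated :
    Q.peak.Contaminated (S.phase j₀) (S.noisyDensity Q.F Q.σ) Q.leak := by
  classical
  have hsplit : ∀ x ∈ Q.window, S.noisyDensity Q.F Q.σ x = Q.peak.q x (S.phase j₀) +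
      Q.F * ∑ j ∈ Finset.univ.erase j₀, S.weight j * gaussianKernel Q.σ (x - S.phase j) := by
    intro x hx
    rw [Q.peak_q hx h.phase_mem_window, Input.noisyDensity,
      ← Finset.add_sum_erase _ _ (Finset.mem_univ j₀), h.weight_eq]
    ring
  refine ⟨S.measurable_noisyDensity _ _, fun x hx => ?_, fun x hx => ?_⟩
  · rw [hsplit x hx]
    exact le_add_of_nonneg_right (mul_nonneg Q.F_mem.1.le (Finset.sum_nonneg fun j _ =>
      mul_nonneg (S.weight_nonneg j) (gaussianKernel_nonneg _ _)))
  · rw [hsplit x hx, FilteredModel.leak]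
    gcongr
    · exact Q.F_mem.1.le
    · exact S.sum_weight_mul_le (div_nonneg (bump_pos _ _ _).le (kernelMass_pos _).le)
        fun j hj => h.gaussianKernel_le_of_ne hx (Finset.ne_of_mem_erase hj)

end Input.IsTarget

end Input

section Tail

/-- The constant in `tail`, large enough for `tail Q.peak.R ≤ (Q.F * Q.a₀ ^ 2) ^ 3` to make the
contamination of the model `Q` slight. -/
noncomputable def tailConst : ℝ := 384 * 729 / gapConst ^ 2

/-- The influence of the phases outside the window on the fMPE, relative to the length of the
window, when this length is `R` times the width of the kernel. -/
noncomputable def tail (R : ℝ) : ℝ := tailConst * R ^ 5 * Real.exp (-R ^ 2 / 72)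

lemma tailConst_pos : 0 < tailConst := div_pos (by norm_num) (pow_pos gapConst_pos 2)

lemma div_gapConst_le_tailConst : 216 / gapConst ≤ tailConst := by
  have hpos := gapConst_pos
  rw [tailConst, div_le_div_iff₀ hpos (pow_pos hpos 2)]
  nlinarith [gapConst_le]

lemma exists_tail_le : ∃ k > 0, ∀ R : ℝ, 0 < R → Real.exp (-(R / k) ^ 2) ≤ 1 / 3 →
    15 ≤ R ∧ tail R ≤ Real.exp (-(R / k) ^ 2) ^ 3 := by
  have hlim := (Real.tendsto_pow_mul_exp_neg_atTop_nhds_zero 5).const_mul tailConst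
  rw [mul_zero] at hlim
  obtain ⟨k₀, hk₀⟩ := eventually_atTop.mp (hlim.eventually_le_const one_pos)
  have hk : 144 ≤ max k₀ 144 := le_max_right _ _
  set k := max k₀ 144
  refine ⟨k, by linarith, fun R hR hexp => ?_⟩
  have hkR : k ≤ R := by
    have hlt : Real.exp (-(R / k) ^ 2) < Real.exp (-1) := by
      have hinv : 3⁻¹ < (Real.exp 1)⁻¹ :=
        inv_strictAnti₀ (Real.exp_pos 1) (by linarith [Real.exp_one_lt_d9])
      rw [Real.exp_neg 1]
      linarith
    have hone : 1 < (R / k) ^ 2 := by linarith [Real.exp_lt_exp.mp hlt]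
    have := (one_lt_sq_iff₀ (by positivity)).mp hone
    exact ((one_lt_div (by positivity)).mp this).le
  have hpoly : tailConst * R ^ 5 * Real.exp (-R) ≤ 1 := by
    linarith [hk₀ R ((le_max_left _ _).trans hkR)]
  have hfast : 3 * (R / k) ^ 2 ≤ R ^ 2 / 144 := by
    rw [div_pow, ← mul_div_assoc, div_le_div_iff₀ (by positivity) (by norm_num)]
    nlinarith [mul_nonneg (sq_nonneg R) (sub_nonneg.mpr hk)]
  have hfactor : -R ^ 2 / 72 ≤ -R + (3 : ℕ) * -(R / k) ^ 2 := by
    push_cast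
    nlinarith
  refine ⟨by linarith, ?_⟩
  calc tail R ≤ tailConst * R ^ 5 * Real.exp (-R + (3 : ℕ) * -(R / k) ^ 2) := by
        have := tailConst_pos
        rw [tail]
        gcongr
    _ = tailConst * R ^ 5 * Real.exp (-R) * Real.exp (-(R / k) ^ 2) ^ 3 := by
        rw [Real.exp_add, Real.exp_nat_mul, ← mul_assoc]
    _ ≤ Real.exp (-(R / k) ^ 2) ^ 3 := mul_le_of_le_one_left (by positivity) hpoly

/-- The accuracy that `t` calls permit when the window has length `Δ` and `w` stands for `F * a₀²`:
the solution `ε` of `t = c Δ⁻¹ log^(1/2) (Δ ε⁻¹ w⁻¹)`. -/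
noncomputable def minAccuracy (c Δ w t : ℝ) : ℝ := Δ * w⁻¹ * Real.exp (-(t * Δ / c) ^ 2)

lemma sqrt_log_le_iff {x s : ℝ} (hx : 0 < x) (hs : 0 ≤ s) :
    √(Real.log x) ≤ s ↔ x * Real.exp (-s ^ 2) ≤ 1 := by
  rw [Real.sqrt_le_left hs, Real.log_le_iff_le_exp hx, Real.exp_neg,
    mul_inv_le_iff₀ (Real.exp_pos _), one_mul]

variable {c Δ w t : ℝ}

lemma minAccuracy_pos (hΔ : 0 < Δ) (hw : 0 < w) : 0 < minAccuracy c Δ w t := by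
  unfold minAccuracy
  positivity

lemma minAccuracy_le_iff {F a₀ ε : ℝ} (hc : 0 < c) (hΔ : 0 < Δ) (hF : 0 < F) (ha : 0 < a₀)
    (hε : 0 < ε) (ht : 0 ≤ t) : minAccuracy c Δ (F * a₀ ^ 2) t ≤ ε ↔
      c * Δ⁻¹ * √(Real.log (Δ * ε⁻¹ * (a₀ ^ 2)⁻¹ * F⁻¹)) ≤ t := by
  rw [show c * Δ⁻¹ = (Δ / c)⁻¹ by rw [inv_div, div_eq_mul_inv], inv_mul_le_iff₀ (by positivity),
    show Δ / c * t = t * Δ / c by ring, sqrt_log_le_iff (by positivity) (by positivity),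
    minAccuracy, ← div_le_one hε]
  ring_nf

lemma le_of_minAccuracy_le (hc : 0 < c) (hΔ : 0 < Δ) (hw : 0 < w) (ht : 0 ≤ t) {s : ℝ}
    (h : minAccuracy c Δ w t ≤ minAccuracy c Δ w s) : s ≤ t := by
  have hexp : Real.exp (-(t * Δ / c) ^ 2) ≤ Real.exp (-(s * Δ / c) ^ 2) :=
    le_of_mul_le_mul_left h (by positivity)
  have hsq : (s * Δ / c) ^ 2 ≤ (t * Δ / c) ^ 2 := neg_le_neg_iff.mp (Real.exp_le_exp.mp hexp)
  have := (div_le_div_iff_of_pos_right hc).mp (le_of_sq_le_sq hsq (by positivity))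
  exact le_of_mul_le_mul_right this hΔ

lemma pos_of_minAccuracy_lt (hΔ : 0 < Δ) (hw : w ∈ Set.Ioc 0 1) (ht : 0 ≤ t)
    (h : minAccuracy c Δ w t < Δ) : 0 < t := by
  refine ht.lt_of_ne' fun h₀ => h.not_ge ?_
  simpa [minAccuracy, h₀] using le_mul_of_one_le_right hΔ.le (one_le_inv₀ hw.1 |>.mpr hw.2)

lemma exists_tail_le_minAccuracy {κ : ℝ} (hκ : 0 < κ) : ∃ c > 0, ∀ Δ w σ t : ℝ,
    0 < Δ → w ∈ Set.Ioc 0 1 → 0 < σ → 0 ≤ t → t * σ ≤ κ → minAccuracy c Δ w t ≤ Δ / 3 →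
    15 ≤ Δ / σ ∧ tail (Δ / σ) ≤ w ^ 3 ∧ Δ * tail (Δ / σ) ≤ w * minAccuracy c Δ w t := by
  obtain ⟨k, hk, htail⟩ := exists_tail_le
  refine ⟨κ * k, by positivity, fun Δ w σ t hΔ hw hσ ht htσ hacc => ?_⟩
  have hw₀ := hw.1
  have hexp : Real.exp (-(Δ / σ / k) ^ 2) ≤ Real.exp (-(t * Δ / (κ * k)) ^ 2) := by
    have : t * Δ / (κ * k) ≤ Δ / σ / k := by
      rw [div_div, div_le_div_iff₀ (by positivity) (by positivity)]
      calc t * Δ * (σ * k) = t * σ * (Δ * k) := by ring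
        _ ≤ κ * (Δ * k) := by gcongr
        _ = Δ * (κ * k) := by ring
    gcongr
  have hacc' : w * minAccuracy (κ * k) Δ w t = Δ * Real.exp (-(t * Δ / (κ * k)) ^ 2) := by
    rw [minAccuracy]
    field_simp
  have hle : Real.exp (-(Δ / σ / k) ^ 2) ≤ w / 3 := by
    refine hexp.trans (le_of_mul_le_mul_left ?_ hΔ)
    rw [← hacc']
    linarith [mul_le_mul_of_nonneg_left hacc hw₀.le]
  have hpos := Real.exp_pos (-(Δ / σ / k) ^ 2)
  obtain ⟨hR, htail⟩ := htail (Δ / σ) (by positivity) (by linarith [hw.2])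
  refine ⟨hR, htail.trans (by gcongr; linarith), ?_⟩
  rw [hacc']
  gcongr
  exact htail.trans ((pow_le_of_le_one hpos.le (by linarith [hw.2]) three_ne_zero).trans hexp)

end Tail

lemma FilteredModel.shift_mul_le (Q : FilteredModel) (hR : 1 ≤ Q.peak.R) :
    2 * (Q.σ * Q.peak.shift Q.leak) * (Q.F * Q.a₀ ^ 2) ≤ Q.Δ * tail Q.peak.R := by
  have hγ := gapConst_pos
  have hF := Q.F_mem.1
  have ha := Q.a₀_mem.1
  have hσ := Q.σ_mem.1
  have hΔ := Q.Δ_mem.1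
  have hΔR := Q.R_mul_σ
  have hRpos := Q.peak.R_pos
  rw [PeakModel.shift, Q.peak_length]
  set R := Q.peak.R
  calc 2 * (Q.σ * (2 * (Q.leak * Q.Δ) * R / (gapConst * Q.peak.snr))) * (Q.F * Q.a₀ ^ 2)
      ≤ 2 * (Q.σ * (2 * (2 * Q.F * Real.exp (-R ^ 2 / 72) * R) * R /
          (gapConst * ((Q.F * Q.a₀) ^ 2 / 27)))) * (Q.F * Q.a₀ ^ 2) := by
        gcongr 2 * (_ * (2 * ?_ * _ / (_ * ?_))) * _
        · exact Q.leak_mul_length_le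
        · exact Q.sq_div_le_peak_snr
    _ = Q.Δ * (216 / gapConst * R * Real.exp (-R ^ 2 / 72)) := by
        rw [← hΔR]
        field_simp
        norm_num
    _ ≤ Q.Δ * tail R := by
        have := tailConst_pos
        rw [tail]
        gcongr
        · exact div_gapConst_le_tailConst
        · exact le_self_pow₀ hR (by norm_num)

namespace Input.IsTarget

variable {ι : Type u} {H : Type v} [Fintype ι] [NormedAddCommGroup H] [InnerProductSpace ℂ H]
  {S : Input ι H} {j₀ : ι} {Q : FilteredModel} (h : S.IsTarget j₀ Q)
include h

lemma isProbabilityMeasure_filtered : IsProbabilityMeasure (S.filtered Q.F Q.σ Q.window) :=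
  h.contaminated.isProbabilityMeasure

lemma acceptProb_pos : 0 < S.acceptProb Q.F Q.σ Q.window := by
  have := h.contaminated.integral_pos
  rwa [← PeakModel.setIntegral_Icc] at this

lemma memLp_est {est : (M : ℕ) → (Fin M → ℝ) → ℝ} (hest : IsFMPE Q.F Q.a₀ Q.σ Q.window est)
    (M : ℕ) : MemLp (est M) 2 (S.samples Q.F Q.σ Q.window M) := by
  have hD : MeasurableSet Q.window := measurableSet_Icc
  have : IsProbabilityMeasure (windowMeasure Q.window (S.noisyDensity Q.F Q.σ)) :=
    h.isProbabilityMeasure_filtered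
  exact (Q.isContrastMaximizer hest).memLp (ae_windowMeasure_mem hD _) M

variable (hR : 15 ≤ Q.peak.R)
include hR

lemma phase_mem_core : S.phase j₀ ∈ Q.peak.core := by
  obtain ⟨hl, hu⟩ := abs_lt.mp h.abs_sub_guess_lt
  have hσ : 15 * Q.σ ≤ Q.Δ := by
    rw [← Q.R_mul_σ]
    exact mul_le_mul_of_nonneg_right hR Q.σ_mem.1.le
  simp only [PeakModel.core, FilteredModel.peak]
  constructor <;> linarith

variable (htail : tail Q.peak.R ≤ (Q.F * Q.a₀ ^ 2) ^ 3)
include htail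

lemma slightlyContaminated :
    Q.peak.SlightlyContaminated (S.phase j₀) (S.noisyDensity Q.F Q.σ) Q.leak where
  toContaminated := h.contaminated
  eight_le_R := by linarith
  mem_core := h.phase_mem_core hR
  Z_le_two := Q.peak_Z_le_two h.phase_mem_window
  small := by
    have hγ := gapConst_pos
    have hF := Q.F_mem.1
    have ha := Q.a₀_mem
    have hRpos := Q.peak.R_pos
    have hleak := Q.leak_mul_length_le
    have htail' : Q.F * tail Q.peak.R ≤ (Q.F * Q.a₀) ^ 4 :=
      calc Q.F * tail Q.peak.R ≤ Q.F * (Q.F * Q.a₀ ^ 2) ^ 3 := by gcongr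
        _ = (Q.F * Q.a₀) ^ 4 * Q.a₀ ^ 2 := by ring
        _ ≤ (Q.F * Q.a₀) ^ 4 := mul_le_of_le_one_right (by positivity)
          (pow_le_one₀ ha.1.le ha.2)
    rw [Q.peak_length]
    set R := Q.peak.R
    calc 192 * (Q.leak * Q.Δ) * R ^ 4
        ≤ 192 * (2 * Q.F * Real.exp (-R ^ 2 / 72) * R) * R ^ 4 := by
          gcongr 192 * ?_ * _
      _ = Q.F * tail R * (gapConst / 27) ^ 2 := by
          rw [tail, tailConst]
          field_simp
          norm_num
      _ ≤ (Q.F * Q.a₀) ^ 4 * (gapConst / 27) ^ 2 := by gcongr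
      _ = (gapConst * ((Q.F * Q.a₀) ^ 2 / 27)) ^ 2 := by ring
      _ ≤ (gapConst * Q.peak.snr) ^ 2 := by
          gcongr
          exact Q.sq_div_le_peak_snr

lemma acceptProb_le_three : S.acceptProb Q.F Q.σ Q.window ≤ 3 := by
  have hs := h.slightlyContaminated hR htail
  have hR2 : 1 ≤ Q.peak.R ^ 2 := one_le_pow₀ (by linarith)
  have hle := hs.integral_le
  rw [← PeakModel.setIntegral_Icc] at hle
  have hleak : Q.leak * (Q.peak.u - Q.peak.l) ≤ 1 := by
    nlinarith [hs.mul_R_sq_le, hs.gapConst_mul_snr_le_one, hs.mul_length_nonneg]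
  exact hle.trans (by linarith [hs.Z_le_two])

theorem exists_hasAsymptoticBiasVariance {est : (M : ℕ) → (Fin M → ℝ) → ℝ}
    (hest : IsFMPE Q.F Q.a₀ Q.σ Q.window est) :
    ∃ b v : ℝ,
      HasAsymptoticBiasVariance (S.samples Q.F Q.σ Q.window) est (S.phase j₀) b v ∧
      2 * |b| * (Q.F * Q.a₀ ^ 2) ≤ Q.Δ * tail Q.peak.R ∧ 0 < v ∧
      v * (gapConst * Q.peak.snr) ≤ 6 * S.acceptProb Q.F Q.σ Q.window * Q.σ ^ 2 := by
  obtain ⟨θ, v, hθ, hv, hmean, hvar⟩ :=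
    (h.slightlyContaminated hR htail).exists_tendsto_integral_and_variance
      (Q.isContrastMaximizer hest)
  refine ⟨θ - S.phase j₀, v, ⟨hmean.sub_const _, hvar⟩, ?_, hv.1, ?_⟩
  · have hF := Q.F_mem.1
    refine le_trans ?_ (Q.shift_mul_le (by linarith))
    gcongr
    exact hθ
  · have := hv.2
    rwa [← PeakModel.setIntegral_Icc, le_div_iff₀ (mul_pos gapConst_pos Q.peak.snr_pos)] at this

end Input.IsTarget

section SampleSize

variable {law : (M : ℕ) → Measure (Fin M → ℝ)} {est : (M : ℕ) → (Fin M → ℝ) → ℝ} {θ b v ε : ℝ}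

lemma asymptoticRMS_le {M : ℕ} (hM : 0 < M) (hε : 0 < ε) (hb : |b| ≤ ε / 2)
    (hv : 4 * v / ε ^ 2 ≤ M) : asymptoticRMS b v M ≤ ε := by
  have hM' : (0 : ℝ) < M := by exact_mod_cast hM
  have hvar : v / M ≤ ε ^ 2 / 4 := by
    rw [div_le_iff₀ (by positivity)] at hv
    rw [div_le_iff₀ hM']
    linarith
  rw [asymptoticRMS, Real.sqrt_le_left hε.le]
  nlinarith [sq_le_sq' (neg_le_of_abs_le hb) (le_of_abs_le hb)]

lemma rmsError_le {M : ℕ} [IsProbabilityMeasure (law M)] (hL2 : MemLp (est M) 2 (law M))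
    (hM : 0 < M) (hε : 0 < ε) (hmean : |(∫ x, est M x ∂(law M)) - θ| ≤ 2 / 3 * ε)
    (hvar : M * ProbabilityTheory.variance (est M) (law M) ≤ 2 * v)
    (hv : 4 * v / ε ^ 2 ≤ M) : rmsError law est θ M ≤ ε := by
  have hM' : (0 : ℝ) < M := by exact_mod_cast hM
  have hvar' : ProbabilityTheory.variance (est M) (law M) ≤ ε ^ 2 / 2 := by
    rw [div_le_iff₀ (by positivity)] at hv
    exact le_of_mul_le_mul_left (by linarith) hM'
  rw [rmsError, Real.sqrt_le_left hε.le, integral_sub_sq_eq_variance_add_sq hL2]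
  nlinarith [sq_le_sq' (neg_le_of_abs_le hmean) (le_of_abs_le hmean)]

lemma exists_natCast_mem_Icc_max (y : ℝ) :
    ∃ n : ℕ, 1 ≤ n ∧ y ≤ n ∧ (n : ℝ) ≤ max 1 (2 * y) := by
  rcases le_total y 1 with hy | hy
  · exact ⟨1, le_rfl, by simpa using hy, by simp⟩
  · refine ⟨⌈y⌉₊, Nat.one_le_ceil_iff.mpr (by linarith), Nat.le_ceil y, le_max_of_le_right ?_⟩
    linarith [Nat.ceil_lt_add_one (by linarith : 0 ≤ y)]

lemma HasAsymptoticBiasVariance.exists_sampleSize [∀ M, IsProbabilityMeasure (law M)]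
    (h : HasAsymptoticBiasVariance law est θ b v) (hL2 : ∀ M, MemLp (est M) 2 (law M)) {δ : ℝ}
    (hδ : 0 < δ) (hb : |b| ≤ δ / 2) (hv : 0 < v) :
    ∃ N₀ : ℕ, ∀ ε ≥ δ, ∃ n : ℕ, 1 ≤ n ∧ (n : ℝ) ≤ max 1 (8 * v / ε ^ 2) ∧
      ∀ M ≥ n, asymptoticRMS b v M ≤ ε ∧ (N₀ ≤ M → rmsError law est θ M ≤ ε) := by
  have hmean : ∀ᶠ M in atTop, |(∫ x, est M x ∂(law M)) - θ| < 2 / 3 * δ :=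
    h.1.abs.eventually_lt_const (by linarith)
  have hvar : ∀ᶠ M : ℕ in atTop, M * ProbabilityTheory.variance (est M) (law M) < 2 * v :=
    h.2.eventually_lt_const (by linarith)
  obtain ⟨N₀, hN₀⟩ := eventually_atTop.mp (hmean.and hvar)
  refine ⟨N₀, fun ε hε => ?_⟩
  obtain ⟨n, hn, hvn, hn'⟩ := exists_natCast_mem_Icc_max (4 * v / ε ^ 2)
  refine ⟨n, hn, hn'.trans_eq (by ring_nf), fun M hM => ?_⟩
  have hvM : 4 * v / ε ^ 2 ≤ M := hvn.trans (by exact_mod_cast hM)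
  refine ⟨asymptoticRMS_le (by lia) (by linarith) (by linarith) hvM, fun hM₀ => ?_⟩
  obtain ⟨hmean, hvar⟩ := hN₀ M hM₀
  exact rmsError_le (hL2 M) (by lia) (by linarith) (by linarith) hvar.le hvM

end SampleSize

section Cost

variable {Q : FilteredModel} {A v t κ : ℝ}

lemma FilteredModel.sampleSize_le (hσ : Q.σ ≤ Q.F * Q.a₀) (hA : A ≤ 3)
    (hv : v * (gapConst * Q.peak.snr) ≤ 6 * A * Q.σ ^ 2) (hv₀ : 0 ≤ v) (ht : 0 < t)
    (htσ : t * Q.σ ≤ κ) (ε : ℝ) :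
    8 * v / ε ^ 2 ≤ 864 * κ ^ 2 / (gapConst * Q.F) * (Q.a₀⁻¹ * (t ^ 2)⁻¹ * (ε ^ 2)⁻¹) := by
  have hγ := gapConst_pos
  have hF := Q.F_mem.1
  have ha := Q.a₀_mem.1
  have hσ₀ := Q.σ_mem.1
  have hvar : v * (gapConst * (Q.F * Q.a₀ / 6)) * t ^ 2 ≤ 18 * κ ^ 2 :=
    calc v * (gapConst * (Q.F * Q.a₀ / 6)) * t ^ 2
        ≤ v * (gapConst * Q.peak.snr) * t ^ 2 := by
          gcongr
          exact Q.div_le_peak_snr hσ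
      _ ≤ 6 * 3 * Q.σ ^ 2 * t ^ 2 := by
          gcongr ?_ * _
          exact hv.trans (by gcongr)
      _ = 18 * (t * Q.σ) ^ 2 := by ring
      _ ≤ 18 * κ ^ 2 := by gcongr
  have hv' : v ≤ 108 * κ ^ 2 / (gapConst * Q.F * Q.a₀ * t ^ 2) := by
    rw [le_div_iff₀ (by positivity)]
    linarith
  calc 8 * v / ε ^ 2 ≤ 8 * (108 * κ ^ 2 / (gapConst * Q.F * Q.a₀ * t ^ 2)) / ε ^ 2 := by gcongr
    _ = 864 * κ ^ 2 / (gapConst * Q.F) * (Q.a₀⁻¹ * (t ^ 2)⁻¹ * (ε ^ 2)⁻¹) := by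
      field_simp
      ring

lemma FilteredModel.calls_le (hA : 0 < A) (hv : v * (gapConst * Q.peak.snr) ≤ 6 * A * Q.σ ^ 2)
    (hv₀ : 0 ≤ v) (ht : 0 < t) (htσ : t * Q.σ ≤ κ) (ε : ℝ) :
    8 * v / ε ^ 2 * t / A ≤
      1296 * κ ^ 2 / gapConst * ((ε ^ 2)⁻¹ * t⁻¹ * (Q.F ^ 2)⁻¹ * (Q.a₀ ^ 2)⁻¹) := by
  have hγ := gapConst_pos
  have hF := Q.F_mem.1
  have ha := Q.a₀_mem.1
  have hσ₀ := Q.σ_mem.1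
  have hvar : v * (gapConst * ((Q.F * Q.a₀) ^ 2 / 27)) * t ^ 2 ≤ 6 * A * κ ^ 2 :=
    calc v * (gapConst * ((Q.F * Q.a₀) ^ 2 / 27)) * t ^ 2
        ≤ v * (gapConst * Q.peak.snr) * t ^ 2 := by
          gcongr
          exact Q.sq_div_le_peak_snr
      _ ≤ 6 * A * Q.σ ^ 2 * t ^ 2 := by gcongr
      _ = 6 * A * (t * Q.σ) ^ 2 := by ring
      _ ≤ 6 * A * κ ^ 2 := by gcongr
  have hv' : v ≤ 162 * A * κ ^ 2 / (gapConst * (Q.F * Q.a₀) ^ 2 * t ^ 2) := by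
    rw [le_div_iff₀ (by positivity)]
    linarith
  calc 8 * v / ε ^ 2 * t / A
      ≤ 8 * (162 * A * κ ^ 2 / (gapConst * (Q.F * Q.a₀) ^ 2 * t ^ 2)) / ε ^ 2 * t / A := by gcongr
    _ = 1296 * κ ^ 2 / gapConst * ((ε ^ 2)⁻¹ * t⁻¹ * (Q.F ^ 2)⁻¹ * (Q.a₀ ^ 2)⁻¹) := by
      field_simp
      ring

end Cost

theorem Input.IsTarget.exists_sampleSize {ι : Type u} {H : Type v} [Fintype ι]
    [NormedAddCommGroup H] [InnerProductSpace ℂ H] {S : Input ι H} {j₀ : ι} {Q : FilteredModel}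
    (h : S.IsTarget j₀ Q) {est : (M : ℕ) → (Fin M → ℝ) → ℝ}
    (hest : IsFMPE Q.F Q.a₀ Q.σ Q.window est) {t : ℕ} {κ δ : ℝ} (ht : 0 < t)
    (htσ : t * Q.σ ≤ κ) (hR : 15 ≤ Q.peak.R) (htail : tail Q.peak.R ≤ (Q.F * Q.a₀ ^ 2) ^ 3)
    (hδ : 0 < δ) (hbias : Q.Δ * tail Q.peak.R ≤ Q.F * Q.a₀ ^ 2 * δ) :
    ∃ N₀ : ℕ, ∀ ε ≥ δ, ∃ b v : ℝ,
      HasAsymptoticBiasVariance (S.samples Q.F Q.σ Q.window) est (S.phase j₀) b v ∧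
      ∃ Mε : ℕ, 1 ≤ Mε ∧
        (Q.σ ≤ Q.F * Q.a₀ → (Mε : ℝ) ≤
          max 1 (864 * κ ^ 2 / (gapConst * Q.F) * (Q.a₀⁻¹ * ((t : ℝ) ^ 2)⁻¹ * (ε ^ 2)⁻¹))) ∧
        S.calls Q.F Q.σ Q.window t Mε ≤ max (S.calls Q.F Q.σ Q.window t 1)
          (1296 * κ ^ 2 / gapConst *
            ((ε ^ 2)⁻¹ * (t : ℝ)⁻¹ * (Q.F ^ 2)⁻¹ * (Q.a₀ ^ 2)⁻¹)) ∧
        ∀ M ≥ Mε, asymptoticRMS b v M ≤ ε ∧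
          (N₀ ≤ M → rmsError (S.samples Q.F Q.σ Q.window) est (S.phase j₀) M ≤ ε) := by
  have hw : 0 < Q.F * Q.a₀ ^ 2 := mul_pos Q.F_mem.1 (pow_pos Q.a₀_mem.1 2)
  have ht' : (0 : ℝ) < t := by exact_mod_cast ht
  have hA := h.acceptProb_pos
  have := h.isProbabilityMeasure_filtered
  have (M : ℕ) : IsProbabilityMeasure (S.samples Q.F Q.σ Q.window M) := by
    unfold Input.samples
    infer_instance
  obtain ⟨b, v, hbv, hb, hv₀, hv⟩ := h.exists_hasAsymptoticBiasVariance hR htail hest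
  have hb' : |b| ≤ δ / 2 := by nlinarith [hb.trans hbias]
  obtain ⟨N₀, hN₀⟩ := hbv.exists_sampleSize (h.memLp_est hest) hδ hb' hv₀
  refine ⟨N₀, fun ε hε => ⟨b, v, hbv, ?_⟩⟩
  obtain ⟨n, hn, hnv, hrms⟩ := hN₀ ε hε
  refine ⟨n, hn, fun hσ => hnv.trans (max_le_max_left 1 ?_), ?_, hrms⟩
  · exact Q.sampleSize_le hσ (h.acceptProb_le_three hR htail) hv hv₀.le ht' htσ ε
  · rcases le_max_iff.mp hnv with hn₁ | hn₂
    · refine le_max_of_le_left ?_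
      unfold Input.calls
      gcongr
      exact_mod_cast hn₁
    · refine le_max_of_le_right (le_trans ?_ (Q.calls_le hA hv hv₀.le ht' htσ ε))
      unfold Input.calls
      gcongr

end QPE

open QPE in
theorem theorem4_general (κ : ℝ) (hκ : 0 < κ) :
    ∃ c > 0, ∃ CT > 0, ∀ F ∈ Set.Ioo (0 : ℝ) 1, ∃ CM > 0,
      ∀ Δ ∈ Set.Ioc (0 : ℝ) π, ∀ a₀ ∈ Set.Ioc (0 : ℝ) 1, ∃ ε₀ > 0,
      ∀ (ι : Type u) (H : Type v) [Fintype ι] [NormedAddCommGroup H] [InnerProductSpace ℂ H]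
        (S : Input ι H) (j₀ : ι) (guess : ℝ),
        S.weight j₀ = a₀ →
        (∀ j, j ≠ j₀ → Δ < |S.phase j - S.phase j₀|) →
        |S.phase j₀ - guess| < Δ / 3 →
        filterInterval guess Δ ⊆ Set.Ico (Δ / 6) (2 * π - Δ / 6) →
      ∀ (t : ℕ) (σ : ℝ), 0 < σ → t * σ ≤ κ →
      ∀ est : (M : ℕ) → (Fin M → ℝ) → ℝ, IsFMPE F a₀ σ (filterInterval guess Δ) est →
      ∃ N₀ : ℕ, ∀ ε : ℝ, 0 < ε → ε ≤ Δ / 3 →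
        c * Δ⁻¹ * √(Real.log (Δ * ε⁻¹ * (a₀ ^ 2)⁻¹ * F⁻¹)) ≤ t →
        ∃ b v : ℝ,
          HasAsymptoticBiasVariance (S.samples F σ (filterInterval guess Δ)) est
            (S.phase j₀) b v ∧
          ∃ Mε : ℕ, 1 ≤ Mε ∧
            (ε ≤ ε₀ → (Mε : ℝ) ≤ max 1 (CM * (a₀⁻¹ * ((t : ℝ) ^ 2)⁻¹ * (ε ^ 2)⁻¹))) ∧
            S.calls F σ (filterInterval guess Δ) t Mε ≤
              max (S.calls F σ (filterInterval guess Δ) t 1)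
                (CT * ((ε ^ 2)⁻¹ * (t : ℝ)⁻¹ * (F ^ 2)⁻¹ * (a₀ ^ 2)⁻¹)) ∧
            ∀ M : ℕ, Mε ≤ M →
              asymptoticRMS b v M ≤ ε ∧
              (N₀ ≤ M → rmsError (S.samples F σ (filterInterval guess Δ)) est
                (S.phase j₀) M ≤ ε) := by
  have hγ := gapConst_pos
  obtain ⟨c, hc, htail⟩ := exists_tail_le_minAccuracy hκ
  refine ⟨c, hc, 1296 * κ ^ 2 / gapConst, by positivity, fun F hF =>
    have hF₀ := hF.1
    ⟨864 * κ ^ 2 / (gapConst * F), by positivity, fun Δ hΔ a₀ ha => ?_⟩⟩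
  have hFa : 0 < F * a₀ := mul_pos hF.1 ha.1
  have hw : F * a₀ ^ 2 ∈ Set.Ioc 0 1 :=
    ⟨mul_pos hF.1 (pow_pos ha.1 2), mul_le_one₀ hF.2.le (sq_nonneg _) (pow_le_one₀ ha.1.le ha.2)⟩
  refine ⟨minAccuracy c Δ (F * a₀ ^ 2) (κ / (F * a₀)), minAccuracy_pos hΔ.1 hw.1,
    fun ι H _ _ _ S j₀ guess hweight hsep hguess hwindow t σ hσ htσ est hest => ?_⟩
  set δ := minAccuracy c Δ (F * a₀ ^ 2) t
  have hδ (ε : ℝ) (hε : 0 < ε) := minAccuracy_le_iff hc hΔ.1 hF.1 ha.1 hε t.cast_nonneg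
  by_cases hδΔ : δ ≤ Δ / 3
  swap
  · exact ⟨0, fun ε hε hεΔ hεt => absurd (((hδ ε hε).mpr hεt).trans hεΔ) hδΔ⟩
  have ht : (0 : ℝ) < t :=
    pos_of_minAccuracy_lt hΔ.1 hw t.cast_nonneg (hδΔ.trans_lt (by linarith [hΔ.1]))
  obtain ⟨hR, hsmall, hbias⟩ := htail Δ _ σ t hΔ.1 hw hσ ht.le htσ hδΔ
  have hσπ : σ ≤ π := by
    rw [le_div_iff₀ hσ] at hR
    linarith [hΔ.2]
  let Q : FilteredModel := ⟨F, a₀, σ, guess, Δ, hF, ha, ⟨hσ, hσπ⟩, hΔ⟩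
  have hQ : S.IsTarget j₀ Q := ⟨hweight, hsep, hguess, hwindow⟩
  obtain ⟨N₀, hN₀⟩ := hQ.exists_sampleSize hest (Nat.cast_pos.mp ht) htσ
    (by rwa [Q.peak_R]) (by rwa [Q.peak_R]) (minAccuracy_pos hΔ.1 hw.1) (by rwa [Q.peak_R])
  refine ⟨N₀, fun ε hε _ hεt => ?_⟩
  have hδε := (hδ ε hε).mpr hεt
  obtain ⟨b, v, hbv, n, hn, hsize, hrest⟩ := hN₀ ε hδε
  refine ⟨b, v, hbv, n, hn, fun hε₀ => hsize ?_, hrest⟩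
  have hκt := le_of_minAccuracy_le hc hΔ.1 hw.1 ht.le (hδε.trans hε₀)
  rw [div_le_iff₀ hFa] at hκt
  exact le_of_mul_le_mul_left (htσ.trans hκt) ht

theorem theorem4 (κ₁ κ₂ : ℝ) (hκ₁ : 0 < κ₁) (hκ₂ : κ₁ ≤ κ₂) :
    ∃ c > 0, ∃ CT > 0, ∀ F ∈ Set.Ioo (0 : ℝ) 1, ∃ CM > 0,
      ∀ Δ ∈ Set.Ioc (0 : ℝ) π, ∀ a₀ ∈ Set.Ioc (0 : ℝ) 1, ∃ ε₀ > 0,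
      ∀ (ι : Type u) (H : Type v) [Fintype ι] [NormedAddCommGroup H] [InnerProductSpace ℂ H]
        (S : QPE.Input ι H) (j₀ : ι) (guess : ℝ),
        S.weight j₀ = a₀ →
        (∀ j, j ≠ j₀ → Δ < |S.phase j - S.phase j₀|) →
        |S.phase j₀ - guess| < Δ / 3 →
        QPE.filterInterval guess Δ ⊆ Set.Ico (Δ / 6) (2 * π - Δ / 6) →
      ∀ (t : ℕ) (σ : ℝ), 0 < σ → κ₁ ≤ t * σ → t * σ ≤ κ₂ →
      ∀ est : (M : ℕ) → (Fin M → ℝ) → ℝ,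
        QPE.IsFMPE F a₀ σ (QPE.filterInterval guess Δ) est →
      ∃ N₀ : ℕ, ∀ ε : ℝ, 0 < ε → ε ≤ Δ / 3 →
        c * Δ⁻¹ * √(Real.log (Δ * ε⁻¹ * (a₀ ^ 2)⁻¹ * F⁻¹)) ≤ t →
        ∃ b v : ℝ,
          QPE.HasAsymptoticBiasVariance (S.samples F σ (QPE.filterInterval guess Δ)) est
            (S.phase j₀) b v ∧
          ∃ Mε : ℕ, 1 ≤ Mε ∧
            (ε ≤ ε₀ → (Mε : ℝ) ≤ max 1 (CM * (a₀⁻¹ * ((t : ℝ) ^ 2)⁻¹ * (ε ^ 2)⁻¹))) ∧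
            S.calls F σ (QPE.filterInterval guess Δ) t Mε ≤
              max (S.calls F σ (QPE.filterInterval guess Δ) t 1)
                (CT * ((ε ^ 2)⁻¹ * (t : ℝ)⁻¹ * (F ^ 2)⁻¹ * (a₀ ^ 2)⁻¹)) ∧
            ∀ M : ℕ, Mε ≤ M →
              QPE.asymptoticRMS b v M ≤ ε ∧
              (N₀ ≤ M → QPE.rmsError (S.samples F σ (QPE.filterInterval guess Δ)) est
                (S.phase j₀) M ≤ ε) := by
  obtain ⟨c, hc, CT, hCT, h⟩ := theorem4_general κ₂ (hκ₁.trans_le hκ₂)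
  refine ⟨c, hc, CT, hCT, fun F hF => ?_⟩
  obtain ⟨CM, hCM, h⟩ := h F hF
  refine ⟨CM, hCM, fun Δ hΔ a₀ ha => ?_⟩
  obtain ⟨ε₀, hε₀, h⟩ := h Δ hΔ a₀ ha
  exact ⟨ε₀, hε₀, fun ι H _ _ _ S j₀ guess hw hsep hguess hD t σ hσ _ =>
    h ι H S j₀ guess hw hsep hguess hD t σ hσ⟩
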